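/- Let $d\ge 2$, $P=\mathbb C[\partial_0,\dots,\partial_{d-1}]$ and $\mathcal E=C^\infty(\mathbb R^d,\mathbb C)$. Consider a linear system $\sum_i \hat T_{ai}(\partial)\phi^i=0$ ($a=1,\dots,n$) for fields $\phi^1,\dots,\phi^m\in\mathcal E$, with $\hat T\in P^{n\times m}$. *Degree of freedom.* Let $\Sigma\subset\mathcal E^m$ be the space of all solutions, and $\Sigma'\subset\Sigma$ the span of all trivial ones, i.e. of all $(\hat R^1\epsilon,\dots,\hat R^m\epsilon)$ with $\epsilon\in\mathcal E$ and $\hat R\in P^m$ such that $\hat R\,\epsilon'$ is a solution for every $\epsilon'\in\mathcal E$. For a space $S$ of $m$-tuples of functions put $h_S(N)=\dim p_N(S)-\dim p_{N-1}(S)$, where $p_N$ takes Taylor polynomials at $0$ of degree at most $N$ ($p_{-1}=0$). The degree of freedom is $$\mathcal N=\frac1{d-1}\lim_{N\to\infty}N\,\frac{h_\Sigma(N)-h_{\Sigma'}(N)}{\binom{N+d-1}{N}} .$$ *Homogeneity and gauge structure.* Let the system be homogeneous: there are integers $\theta_i$ (orders of the fields) and $k_a$ (orders of the equations) such that $\hat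 T_{ai}$ is homogeneous of degree $k_a-\theta_i$. Fix finite homogeneous generating sets of the gauge symmetries $\hat R,\hat R_{(1)},\hat R_{(2)},\dots$ and of the gauge identities $\hat L,\hat L_{(1)},\dots$ at all stages, finite in number; that is, finite graded free resolutions $$\cdots\to P^{m_2}\xrightarrow{\hat R_{(1)}}P^{m_1}\xrightarrow{\hat R}P^m\xrightarrow{\hat T}P^n,\qquad \cdots\to P^{l_2}\xrightarrow{\hat L_{(1)}^{T}}P^{l_1}\xrightarrow{\hat L^{T}}P^n\xrightarrow{\hat T^{T}}P^m$$ of $\operatorname{Coker}\hat T$ and $\operatorname{Coker}\hat T^{T}$, where the basis elements of $P^n,P^m$ have degrees $-k_a,-\theta_i$ in the first one and $k_a,\theta_i$ in the second one. *BRST complex.* Its generators are: the fields $\phi^i$, of ghost number $0$ and differential order $\theta_i$; the antifields, of ghost number $-1$ and order $k_a$; the ghosts of stage $s\ge0$, one for each basis element of $P^{m_{s+1}}$, of ghost number $s+1$ and of order minus the degree of that basis element; and the antighosts of stage $s\ge 0$, one for each basis element of $P^{l_{s+1}}$, of ghost number $-(s+2)$ and of order the degree of that basis element. The BRST complex $C$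 is the free graded commutative $\mathcal E$-algebra on these generators (commutative or anticommutative according to the parity of the ghost number), $C_{ij}$ is the $\mathcal E$-span of the monomials in the generators of total ghost number $i$ and total order $j$, and $$\chi_C(z)=\sum_{i,j}(-1)^iz^j\operatorname{rk}_{\mathcal E}C_{ij}.$$ The algebraic dual BRST complex $B$ is the free graded commutative $P$-algebra on the dual generators (with opposite ghost numbers and orders), $B_{ij}$ denotes the $P$-span of the monomials in these generators of bidegree $(i,j)$, and its Euler characteristic is the product of rational functions $$\chi_B(z)=H_P(z)\sum_{i,j}(-1)^iz^j\operatorname{rk}_PB_{ij},\qquad H_P(z)=\sum_{N\ge0}z^N\dim_{\mathbb C} P_N .$$ **Proposition.** Suppose that the orders $\theta_i$ are chosen in such a way that all generators of the BRST complex have positive orders. Then: 1. All $C_{ij}$ are free of finite rank over $\mathcal E$, they vanish for $j<0$, and for each $j$ only finitely many $C_{ij}$ are non-zero, so that $\chi_C(z)$ is a well-defined formal power series in $z$. Likewise all $B_{ij}$ are free of finite rank over $P$, they vanish for $j>0$, and for each $j$ only finitely many of them are non-zero, so that $\sum_{i,j}(-1)^iz^j\operatorname{rk}_PB_{ij}$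 is a well-defined formal power series in $z^{-1}$. 2. The limit defining $\mathcal N$ exists. The series $\chi_C$ is the expansion at $0$ of a rational function, again denoted $\chi_C$, and $$\mathcal N=\lim_{|z|\to\infty}z\,(\ln\chi_C(z))',$$ so that $\mathcal N$ is minus the residue at infinity of the logarithmic derivative $\chi_C'/\chi_C$. 3. The series $H_P(z)$ in $z$ and $\sum_{i,j}(-1)^iz^j\operatorname{rk}_PB_{ij}$ in $z^{-1}$ are the expansions, at $z=0$ and at $z=\infty$ respectively, of rational functions, whose product is the rational function $\chi_B$, and $$\mathcal N=-\lim_{z\to0}z\,(\ln\chi_B(z))',$$ so that $\mathcal N$ is minus the residue at $0$ of the logarithmic derivative $\chi_B'/\chi_B$. -/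

import Mathlib

open scoped TensorProduct Topology ContDiff

namespace LinearGauge

noncomputable section

/-! ### Smooth functions, differential operators with constant coefficients -/

/-- The ring `C^∞(ℝ^d, ℂ)` of smooth functions on space-time. -/
def smoothSubalgebra (d : ℕ) : Subalgebra ℂ ((Fin d → ℝ) → ℂ) where
  carrier := {f | ContDiff ℝ ∞ f}
  mul_mem' := fun {f g} hf hg =>
    ContDiff.mul (show ContDiff ℝ ∞ f from hf) (show ContDiff ℝ ∞ g from hg)
  add_mem' := fun {f g} hf hg =>
    ContDiff.add (show ContDiff ℝ ∞ f from hf) (show ContDiff ℝ ∞ g from hg)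
  algebraMap_mem' := fun r => show ContDiff ℝ ∞ (fun _ : Fin d → ℝ => r) from contDiff_const

abbrev Smooth (d : ℕ) : Type := smoothSubalgebra d

theorem Smooth.contDiff {d : ℕ} (f : Smooth d) : ContDiff ℝ ∞ f.1 := f.2

/-- The ring `P = ℂ[∂_0, …, ∂_{d-1}]` of differential operators with constant coefficients. -/
abbrev DiffOp (d : ℕ) : Type := MvPolynomial (Fin d) ℂ

/-- The partial derivative `∂_i`, as a linear endomorphism of `C^∞(ℝ^d, ℂ)`. -/
def partialD {d : ℕ} (i : Fin d) : Module.End ℂ (Smooth d) where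
  toFun f := ⟨fun x => fderiv ℝ f.1 x (Pi.single i 1),
    (f.contDiff.fderiv_right (m := ∞) (by simp)).clm_apply contDiff_const⟩
  map_add' f g := by
    apply Subtype.ext
    funext x
    have hf : DifferentiableAt ℝ f.1 x := f.contDiff.differentiable (by simp) x
    have hg : DifferentiableAt ℝ g.1 x := g.contDiff.differentiable (by simp) x
    change fderiv ℝ (f.1 + g.1) x _ = fderiv ℝ f.1 x _ + fderiv ℝ g.1 x _
    rw [fderiv_add hf hg]
    rfl
  map_smul' c f := by
    apply Subtype.ext
    funext x
    have hf : DifferentiableAt ℝ f.1 x := f.contDiff.differentiable (by simp) x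
    change fderiv ℝ (c • f.1) x _ = c • fderiv ℝ f.1 x _
    rw [fderiv_const_smul hf]
    rfl

/-- The iterated derivative `∂^α` for a multi-index `α`. -/
def multiD {d : ℕ} (α : Fin d → ℕ) : Module.End ℂ (Smooth d) :=
  ((List.finRange d).map fun i => partialD i ^ α i).prod

/-- The action of a polynomial `p(∂)` on smooth functions. -/
def opAct {d : ℕ} (p : DiffOp d) : Module.End ℂ (Smooth d) :=
  ∑ α ∈ p.support, p.coeff α • multiD (fun i => α i)

/-! ### Einstein's count of the degree of freedom -/

/-- The space of all solutions `φ = (φ^1, …, φ^m)` of `∑_i T_{ai}(∂) φ^i = 0`. -/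
def solutions {d n m : ℕ} (T : Matrix (Fin n) (Fin m) (DiffOp d)) :
    Submodule ℂ (Fin m → Smooth d) :=
  ⨅ a : Fin n, LinearMap.ker (∑ i : Fin m, opAct (T a i) ∘ₗ LinearMap.proj i)

/-- A column `R = (R^1, …, R^m)` of differential operators is a gauge symmetry if `R(∂)ε` is a
solution for every smooth function `ε`. -/
def IsGaugeSymmetry {d n m : ℕ} (T : Matrix (Fin n) (Fin m) (DiffOp d))
    (R : Fin m → DiffOp d) : Prop :=
  ∀ ε : Smooth d, (fun i => opAct (R i) ε) ∈ solutions T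

/-- The space of trivial (pure gauge) solutions: the linear combinations of the functions `R(∂)ε`
for gauge symmetries `R` and smooth `ε`. -/
def trivialSolutions {d n m : ℕ} (T : Matrix (Fin n) (Fin m) (DiffOp d)) :
    Submodule ℂ (Fin m → Smooth d) :=
  Submodule.span ℂ {φ | ∃ R : Fin m → DiffOp d, IsGaugeSymmetry T R ∧
    ∃ ε : Smooth d, φ = fun i => opAct (R i) ε}

/-- The Taylor polynomial at the origin, of total degree at most `N`. -/
def taylor (d N : ℕ) : Smooth d →ₗ[ℂ] MvPolynomial (Fin d) ℂ where
  toFun f := ∑ α ∈ (Fintype.piFinset fun _ : Fin d => Finset.range (N + 1)) with ∑ i, α i ≤ N,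
    MvPolynomial.monomial (Finsupp.equivFunOnFinite.symm α)
      ((∏ i, ((α i).factorial : ℂ))⁻¹ * (multiD α f).1 0)
  map_add' f g := by
    rw [← Finset.sum_add_distrib]
    refine Finset.sum_congr rfl fun α _ => ?_
    rw [map_add, ← map_add (MvPolynomial.monomial _)]
    exact congrArg _ (mul_add _ _ _)
  map_smul' c f := by
    rw [Finset.smul_sum]
    refine Finset.sum_congr rfl fun α _ => ?_
    rw [map_smul, RingHom.id_apply, MvPolynomial.smul_monomial]
    exact congrArg _ (mul_left_comm _ _ _)

/-- `dim p_N(S)`, where `p_N` truncates the Taylor series of each component at degree `N`. -/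
def jetDim {d m : ℕ} (S : Submodule ℂ (Fin m → Smooth d)) (N : ℕ) : ℕ :=
  Module.finrank ℂ (S.map (LinearMap.compLeft (taylor d N) (Fin m)))

/-- The Hilbert function `h_S(N) = dim p_N(S) - dim p_{N-1}(S)`, with `p_{-1} = 0`. -/
def hilbertFn {d m : ℕ} (S : Submodule ℂ (Fin m → Smooth d)) : ℕ → ℤ
  | 0 => jetDim S 0
  | N + 1 => (jetDim S (N + 1) : ℤ) - jetDim S N

/-- `𝒩` is the physical degree of freedom of the system `T`:
`𝒩 = (1/(d-1)) lim_{N → ∞} N (h_Σ(N) - h_Σ'(N)) / C(N+d-1, N)`. -/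
def IsDegreeOfFreedom {d n m : ℕ} (T : Matrix (Fin n) (Fin m) (DiffOp d)) (𝒩 : ℝ) : Prop :=
  Filter.Tendsto (fun N : ℕ => 1 / ((d : ℝ) - 1) *
      ((N : ℝ) * ((hilbertFn (solutions T) N : ℝ) - (hilbertFn (trivialSolutions T) N : ℝ)) /
        ((N + d - 1).choose N : ℝ)))
    Filter.atTop (𝓝 𝒩)

/-! ### Homogeneous systems and their gauge structure -/

/-- `p` is homogeneous of degree `e ∈ ℤ` (hence zero if `e < 0`). -/
def IsHomog {d : ℕ} (p : DiffOp d) (e : ℤ) : Prop :=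
  ∀ α ∈ p.support, (α.degree : ℤ) = e

/-- A matrix with row degrees `r` and column degrees `c` is homogeneous if its entries `A a i`
are homogeneous of degree `r a - c i`. -/
def IsHomogMatrix {d p q : ℕ} (A : Matrix (Fin p) (Fin q) (DiffOp d))
    (r : Fin p → ℤ) (c : Fin q → ℤ) : Prop :=
  ∀ a i, IsHomog (A a i) (r a - c i)

/-- A finite homogeneous free resolution `… → P^{b_1} → P^{b_0} → P^q → P^p` extending the map
given by the matrix `A` to the left, where the basis elements of `P^q` have degrees `deg`:
the columns of `map0` generate the syzygies of the columns of `A`, the columns of `map s` generate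
the syzygies of the columns of the previous matrix, and the resolution is finite.
`ord s` are the degrees of the basis elements of `P^{b_s}`. -/
structure SyzygyTower {d p q : ℕ} (A : Matrix (Fin p) (Fin q) (DiffOp d))
    (deg : Fin q → ℤ) where
  rank : ℕ → ℕ
  ord : ∀ s, Fin (rank s) → ℤ
  map0 : Matrix (Fin q) (Fin (rank 0)) (DiffOp d)
  map : ∀ s, Matrix (Fin (rank s)) (Fin (rank (s + 1))) (DiffOp d)
  homog0 : ∀ i α, IsHomog (map0 i α) (ord 0 α - deg i)
  homog : ∀ s α β, IsHomog (map s α β) (ord (s + 1) β - ord s α)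
  exact0 : LinearMap.range map0.mulVecLin = LinearMap.ker A.mulVecLin
  exact1 : LinearMap.range (map 0).mulVecLin = LinearMap.ker map0.mulVecLin
  exact : ∀ s, LinearMap.range (map (s + 1)).mulVecLin = LinearMap.ker (map s).mulVecLin
  finite : ∃ K, ∀ s, K ≤ s → rank s = 0

/-- A homogeneous gauge structure of the homogeneous system `T`, with equations of orders `k` and
fields of orders `θ`: the matrices `R, R_(1), …` of gauge symmetries, gauge symmetries of gauge
symmetries, etc. (columns are generators), and the transposes of the matrices `L, L_(1), …` of
gauge identities, identities between identities, etc. The first tower resolves `Coker T`, where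
the basis elements dual to the fields have degrees `-θ i`; the second one resolves `Coker Tᵀ`. -/
structure GaugeStructure {d n m : ℕ} (T : Matrix (Fin n) (Fin m) (DiffOp d))
    (k : Fin n → ℤ) (θ : Fin m → ℤ) where
  sym : SyzygyTower T (fun i => -θ i)
  ident : SyzygyTower T.transpose k

/-! ### Generators of the BRST complex -/

/-- The generators of the BRST complex. -/
inductive Generator {d n m : ℕ} {T : Matrix (Fin n) (Fin m) (DiffOp d)}
    {k : Fin n → ℤ} {θ : Fin m → ℤ} (G : GaugeStructure T k θ) : Type
  | field (i : Fin m) : Generator G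
  | antifield (a : Fin n) : Generator G
  | ghost (s : ℕ) (α : Fin (G.sym.rank s)) : Generator G
  | antighost (s : ℕ) (A : Fin (G.ident.rank s)) : Generator G

section

variable {d n m : ℕ} {T : Matrix (Fin n) (Fin m) (DiffOp d)} {k : Fin n → ℤ} {θ : Fin m → ℤ}
  {G : GaugeStructure T k θ}

/-- The ghost number. -/
def Generator.gh : Generator G → ℤ
  | .field _ => 0
  | .antifield _ => -1
  | .ghost s _ => (s : ℤ) + 1
  | .antighost s _ => -((s : ℤ) + 2)

/-- The differential order. It is such that the BRST differential, which sends `φ^i` to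
`∑ R^i_α(∂) φ^α`, a ghost to the operators `R_(s)` applied to the ghosts of the next stage,
an antifield `φ̄_a` to `∑ T_{ai}(∂) φ^i`, and an antighost to the operators `L_(s)` applied to the
antifields or antighosts of the previous stage, preserves the differential order. -/
def Generator.order : Generator G → ℤ
  | .field i => θ i
  | .antifield a => k a
  | .ghost s α => -G.sym.ord s α
  | .antighost s A => G.ident.ord s A

end

/-! ### Free graded commutative algebras and their Euler characteristics -/

/-- The free graded commutative `A`-algebra on generators `X` with degrees `gh`: polynomials in the
even generators tensored with the exterior algebra on the odd ones. -/
abbrev FreeGC (A : Type) [CommRing A] {X : Type} (gh : X → ℤ) : Type :=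
  MvPolynomial {x : X // Even (gh x)} A ⊗[A] ExteriorAlgebra A ({x : X // Odd (gh x)} →₀ A)

/-- The monomial with exponents `e` in the even generators and with the odd factors `l`. -/
def gcMonomial (A : Type) [CommRing A] {X : Type} (gh : X → ℤ)
    (e : {x : X // Even (gh x)} →₀ ℕ) (l : List {x : X // Odd (gh x)}) : FreeGC A gh :=
  MvPolynomial.monomial e (1 : A) ⊗ₜ[A]
    (l.map fun x => ExteriorAlgebra.ι A (Finsupp.single x (1 : A))).prod

/-- The weight of such a monomial, for weights `wt` of the generators. -/
def monomialWeight {X : Type} (gh wt : X → ℤ)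
    (e : {x : X // Even (gh x)} →₀ ℕ) (l : List {x : X // Odd (gh x)}) : ℤ :=
  (e.sum fun x r => (r : ℤ) * wt x.1) + (l.map fun x => wt x.1).sum

/-- The `A`-submodule spanned by the monomials in the generators of bidegree `(i, j)`, with
respect to `(gh, ord)`. -/
def component (A : Type) [CommRing A] {X : Type} (gh ord : X → ℤ) (i j : ℤ) :
    Submodule A (FreeGC A gh) :=
  Submodule.span A {y | ∃ e l, monomialWeight gh gh e l = i ∧ monomialWeight gh ord e l = j ∧
    y = gcMonomial A gh e l}

/-- The coefficient `∑_i (-1)^i rk_A C_{ij}` of the Euler characteristic. -/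
def eulerCoeff (A : Type) [CommRing A] {X : Type} (gh ord : X → ℤ) (j : ℤ) : ℤ :=
  ∑ᶠ i : ℤ, (i.negOnePow : ℤ) * (Module.finrank A (component A gh ord i j) : ℤ)

/-- All components are free of finite rank, and for each `j` only finitely many of the components
`C_{ij}` are non-zero; so all the sums `∑_i (-1)^i rk_A C_{ij}` make sense. -/
def EulerWellDefined (A : Type) [CommRing A] {X : Type} (gh ord : X → ℤ) : Prop :=
  (∀ i j, Module.Free A (component A gh ord i j) ∧ Module.Finite A (component A gh ord i j)) ∧
    ∀ j, {i : ℤ | component A gh ord i j ≠ ⊥}.Finite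

section

variable {d n m : ℕ} {T : Matrix (Fin n) (Fin m) (DiffOp d)} {k : Fin n → ℤ} {θ : Fin m → ℤ}

/-- The component `C_{ij}` of the BRST complex `C`, the free graded commutative algebra over
`C^∞(ℝ^d, ℂ)` on all generators, in ghost number `i` and differential order `j`. -/
def componentC (G : GaugeStructure T k θ) (i j : ℤ) :=
  component (Smooth d) (Generator.gh (G := G)) Generator.order i j

/-- The Euler characteristic `χ_C(z) = ∑_{i,j} (-1)^i z^j rk C_{ij}`, as a power series; it is used
only when all orders are positive, so that there are no negative powers of `z`. -/
def eulerC (G : GaugeStructure T k θ) : PowerSeries ℂ :=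
  PowerSeries.mk fun j =>
    (eulerCoeff (Smooth d) (Generator.gh (G := G)) Generator.order (j : ℤ) : ℂ)

/-- The algebraic dual BRST complex `B` is the free graded commutative algebra over `P` on the dual
generators, whose bidegrees are opposite. This is the `P`-span of its monomials of bidegree
`(i, j)` in these generators. -/
def componentB (G : GaugeStructure T k θ) (i j : ℤ) :=
  component (DiffOp d) (fun g : Generator G => -g.gh) (fun g => -g.order) i j

/-- The series `∑_{i,j} (-1)^i z^j rk_P B_{ij}` as a power series in `w = z⁻¹`; it is used only
when all orders are positive, so that there are no positive powers of `z`. -/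
def eulerRankB (G : GaugeStructure T k θ) : PowerSeries ℂ :=
  PowerSeries.mk fun j =>
    (eulerCoeff (DiffOp d) (fun g : Generator G => -g.gh) (fun g => -g.order) (-(j : ℤ)) : ℂ)

end

/-- The Hilbert series `H_P(z) = ∑_N z^N dim P_N` of the graded ring `P`. -/
def hilbertP (d : ℕ) : PowerSeries ℂ :=
  PowerSeries.mk fun N =>
    (Module.finrank ℂ (MvPolynomial.homogeneousSubmodule (Fin d) ℂ N) : ℂ)

/-- The rational function `f` has the power series expansion `S` at zero. -/
def ExpandsTo (f : RatFunc ℂ) (S : PowerSeries ℂ) : Prop :=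
  (f.denom : PowerSeries ℂ) * S = (f.num : PowerSeries ℂ)

/-- The function `z ↦ f(z)` of a complex variable defined by a rational function. -/
def ratFun (f : RatFunc ℂ) (z : ℂ) : ℂ := f.eval (RingHom.id ℂ) z

/-- The function `z ↦ H_P(z) · f(1/z)`, where `h = H_P` as a rational function. It is the Euler
characteristic of `B` when `f(w)` is the sum of the series `eulerRankB`. -/
def eulerFunB (h f : RatFunc ℂ) (z : ℂ) : ℂ := ratFun h z * ratFun f z⁻¹

/-- `f` is holomorphic in a punctured neighbourhood of infinity, with residue `c` there. -/
def HasResidueAtInfinity (f : ℂ → ℂ) (c : ℂ) : Prop :=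
  ∃ R₀ : ℝ, 0 < R₀ ∧ DifferentiableOn ℂ f {z | R₀ < ‖z‖} ∧
    ∀ R : ℝ, R₀ < R → -(2 * Real.pi * Complex.I)⁻¹ * (∮ z in C(0, R), f z) = c

/-- `f` is holomorphic in a punctured neighbourhood of zero, with residue `c` there. -/
def HasResidueAtZero (f : ℂ → ℂ) (c : ℂ) : Prop :=
  ∃ r₀ : ℝ, 0 < r₀ ∧ DifferentiableOn ℂ f {z | 0 < ‖z‖ ∧ ‖z‖ < r₀} ∧
    ∀ r : ℝ, 0 < r → r < r₀ → (2 * Real.pi * Complex.I)⁻¹ * (∮ z in C(0, r), f z) = c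

end

end LinearGauge

open LinearGauge

namespace LinearGauge

noncomputable section

/-! ### Graded pieces and Hilbert functions -/

/-! Taylor jets at the origin are dual to operators: pair a vector v of operators with a field φ by
the value at 0 of ∑ v_i(∂)φ^i. Then dim p_N(S) is the codimension, among the operator vectors of
order at most N, of those that annihilate S. The annihilator of Σ is the row module im Tᵀ
(`jetAnn_solutions`), and that of Σ' is ker Rᵀ (`jetAnn_trivialSolutions`). So h_Σ − h_Σ' measures
the growth of M = ker Rᵀ / im Tᵀ.

Over the fraction field of P the dual sequence is exact at this place, so M is torsion and grows at
most like N^(d-2). The number 𝒩 is the coefficient of C(N+d-2, d-2), and every term o(N^(d-2)) may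
be dropped (`Negligible`). Jets are filtered by order while M is graded with basis degrees θ. The
discrepancy consists of shifts of the degree in torsion quotients, and these are negligible
(`negligible_HFsub_succ`, `negligible_hilbertFn_sub`).

The Hilbert function of M is an alternating sum over the generators of the BRST complex. The gauge
identities resolve ker Tᵀ exactly. The module im Rᵀ sits in the dual of the resolution of Coker T,
whose further homology consists of the groups Ext^i(Coker T, P) with i ≥ 2. These have codimension
at least 2 and are negligible (`negligible_HFsub_dual`). The reason is elementary: after inverting
all nonzero polynomials free of one chosen variable, P becomes a polynomial ring in one variable
over a field, a principal ideal domain, where the exact sequences split and dualize. So for every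
variable the homology is killed by a nonzero polynomial free of that variable, and counting standard
monomials gives O(N^(d-3)).

Hence the Hilbert function of M is ∑_g (-1)^gh(g) dim P_{N-order(g)} up to o(N^(d-2)). As M is
torsion, the sum of the signs vanishes, and the next coefficient is −∑_g (-1)^gh(g) order(g), which
is `dof` (`negligible_sum_hP`).

On the other side, counting monomials writes the Euler characteristic as the product of 1 − z^order
over odd generators divided by the same product over even ones (`mk_eulerCoeff`). Each factor
contributes its order to z (ln χ)' at infinity, so the limit is again `dof`. For B one substitutes
z⁻¹, and H_P = (1 − z)^(-d) contributes nothing at 0. -/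

/-- The homogeneous component of degree `e ∈ ℤ` of a polynomial. -/
def hcomp {d : ℕ} (e : ℤ) : DiffOp d →ₗ[ℂ] DiffOp d :=
  if 0 ≤ e then MvPolynomial.homogeneousComponent e.toNat else 0

theorem coeff_hcomp {d : ℕ} (e : ℤ) (p : DiffOp d) (α : Fin d →₀ ℕ) :
    (hcomp e p).coeff α = if (α.degree : ℤ) = e then p.coeff α else 0 := by
  unfold hcomp
  by_cases h : 0 ≤ e
  · rw [if_pos h, MvPolynomial.coeff_homogeneousComponent]
    congr 1
    exact propext (by omega)
  · rw [if_neg h, if_neg (by omega)]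
    simp

theorem isHomog_iff {d : ℕ} {p : DiffOp d} {e : ℤ} :
    IsHomog p e ↔ ∀ α, (α.degree : ℤ) ≠ e → p.coeff α = 0 := by
  unfold IsHomog
  refine forall_congr' fun α => ?_
  rw [MvPolynomial.mem_support_iff]
  tauto

theorem isHomog_hcomp {d : ℕ} (e : ℤ) (p : DiffOp d) : IsHomog (hcomp e p) e := by
  rw [isHomog_iff]
  intro α h
  rw [coeff_hcomp, if_neg h]

theorem hcomp_eq_self {d : ℕ} {p : DiffOp d} {e : ℤ} (h : IsHomog p e) : hcomp e p = p := by
  ext α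
  rw [coeff_hcomp]
  split_ifs with h1
  · rfl
  · exact (isHomog_iff.1 h α h1).symm

theorem IsHomog.zero {d : ℕ} (e : ℤ) : IsHomog (0 : DiffOp d) e := by
  simp [IsHomog]

theorem IsHomog.add {d : ℕ} {p q : DiffOp d} {e : ℤ} (hp : IsHomog p e) (hq : IsHomog q e) :
    IsHomog (p + q) e := by
  rw [isHomog_iff] at *
  intro α h
  rw [MvPolynomial.coeff_add, hp α h, hq α h, add_zero]

theorem IsHomog.smul {d : ℕ} {p : DiffOp d} {e : ℤ} (c : ℂ) (hp : IsHomog p e) :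
    IsHomog (c • p) e := by
  rw [isHomog_iff] at *
  intro α h
  rw [MvPolynomial.coeff_smul, hp α h, smul_zero]

theorem IsHomog.sum {d : ℕ} {ι : Type*} (s : Finset ι) {p : ι → DiffOp d} {e : ℤ}
    (h : ∀ i ∈ s, IsHomog (p i) e) : IsHomog (∑ i ∈ s, p i) e := by
  classical
  induction s using Finset.induction_on with
  | empty => simpa using IsHomog.zero e
  | insert a s ha ih =>
    rw [Finset.sum_insert ha]
    exact (h a (Finset.mem_insert_self a s)).add
      (ih fun i hi => h i (Finset.mem_insert_of_mem hi))

theorem IsHomog.mul {d : ℕ} {p q : DiffOp d} {e f : ℤ} (hp : IsHomog p e) (hq : IsHomog q f) :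
    IsHomog (p * q) (e + f) := by
  classical
  rw [isHomog_iff] at *
  intro α h
  rw [MvPolynomial.coeff_mul]
  refine Finset.sum_eq_zero fun x hx => ?_
  rw [Finset.HasAntidiagonal.mem_antidiagonal] at hx
  by_cases h1 : (x.1.degree : ℤ) = e
  · have h2 : (x.2.degree : ℤ) ≠ f := by
      intro h2
      apply h
      rw [← hx, map_add, ← h1, ← h2]
      push_cast
      rfl
    rw [hq _ h2, mul_zero]
  · rw [hp _ h1, zero_mul]

theorem isHomog_monomial {d : ℕ} (α : Fin d →₀ ℕ) (c : ℂ) :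
    IsHomog (MvPolynomial.monomial α c : DiffOp d) α.degree := by
  rw [isHomog_iff]
  intro β h
  rw [MvPolynomial.coeff_monomial, if_neg]
  rintro rfl
  exact h rfl

theorem hcomp_of_ne {d : ℕ} {p : DiffOp d} {e f : ℤ} (hp : IsHomog p e) (h : f ≠ e) :
    hcomp f p = 0 := by
  ext α
  rw [coeff_hcomp, MvPolynomial.coeff_zero]
  split_ifs with h1
  · exact isHomog_iff.1 hp α (by omega)
  · rfl

theorem hcomp_mul {d : ℕ} {p : DiffOp d} {e : ℤ} (hp : IsHomog p e) (f : ℤ) (q : DiffOp d) :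
    hcomp (e + f) (p * q) = p * hcomp f q := by
  induction q using MvPolynomial.induction_on' with
  | monomial α c =>
    have hm := isHomog_monomial α c
    by_cases h : f = α.degree
    · subst h
      rw [hcomp_eq_self (hp.mul hm), hcomp_eq_self hm]
    · rw [hcomp_of_ne hm h, mul_zero, hcomp_of_ne (hp.mul hm) (by omega)]
  | add q r hq hr => rw [mul_add, map_add, map_add, mul_add, hq, hr]

theorem sum_hcomp {d : ℕ} (p : DiffOp d) (s : Finset ℤ)
    (hs : ∀ α ∈ p.support, (α.degree : ℤ) ∈ s) : ∑ e ∈ s, hcomp e p = p := by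
  ext α
  rw [MvPolynomial.coeff_sum]
  simp only [coeff_hcomp, Finset.sum_ite_eq]
  split_ifs with h
  · rfl
  · symm
    rw [← MvPolynomial.notMem_support_iff]
    exact fun h1 => h (hs α h1)

/-! ### Graded free modules over P and their homogeneous submodules. -/

variable {d : ℕ}

/-- The vectors of total degree `D` in the graded free module with basis degrees `deg`. -/
def gradedPiece {q : ℕ} (deg : Fin q → ℤ) (D : ℤ) : Submodule ℂ (Fin q → DiffOp d) where
  carrier := {v | ∀ i, IsHomog (v i) (D - deg i)}
  zero_mem' := fun _ => IsHomog.zero _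
  add_mem' := fun ha hb i => (ha i).add (hb i)
  smul_mem' := fun c _ ha i => (ha i).smul c

/-- The component of degree `D` of a vector. -/
def gcomp {q : ℕ} (deg : Fin q → ℤ) (D : ℤ) :
    (Fin q → DiffOp d) →ₗ[ℂ] (Fin q → DiffOp d) :=
  LinearMap.pi fun i => hcomp (D - deg i) ∘ₗ LinearMap.proj i

theorem gcomp_apply {q : ℕ} (deg : Fin q → ℤ) (D : ℤ) (v : Fin q → DiffOp d) (i : Fin q) :
    gcomp deg D v i = hcomp (D - deg i) (v i) := rfl

theorem gcomp_mem {q : ℕ} (deg : Fin q → ℤ) (D : ℤ) (v : Fin q → DiffOp d) :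
    gcomp deg D v ∈ gradedPiece deg D := fun _ => isHomog_hcomp _ _

theorem gcomp_eq_self {q : ℕ} {deg : Fin q → ℤ} {D : ℤ} {v : Fin q → DiffOp d}
    (h : v ∈ gradedPiece deg D) : gcomp deg D v = v :=
  funext fun i => hcomp_eq_self (h i)

theorem gcomp_of_ne {q : ℕ} {deg : Fin q → ℤ} {D E : ℤ} {v : Fin q → DiffOp d}
    (h : v ∈ gradedPiece deg D) (hE : E ≠ D) : gcomp deg E v = 0 :=
  funext fun i => hcomp_of_ne (h i) (by omega)

/-- The degrees occurring in a vector. -/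
def degreeSet {q : ℕ} (deg : Fin q → ℤ) (v : Fin q → DiffOp d) : Finset ℤ :=
  Finset.univ.biUnion fun i => (v i).support.image fun α => (α.degree : ℤ) + deg i

theorem sum_gcomp_of_subset {q : ℕ} (deg : Fin q → ℤ) (v : Fin q → DiffOp d) {s : Finset ℤ}
    (hs : degreeSet deg v ⊆ s) : ∑ D ∈ s, gcomp deg D v = v := by
  funext i
  rw [Finset.sum_apply]
  simp only [gcomp_apply]
  have := sum_hcomp (v i) (s.image fun D => D - deg i) (by
    intro α hα
    refine Finset.mem_image.2 ⟨α.degree + deg i, hs ?_, by ring⟩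
    exact Finset.mem_biUnion.2 ⟨i, Finset.mem_univ _, Finset.mem_image_of_mem _ hα⟩)
  rwa [Finset.sum_image (fun a _ b _ h => by simpa using h)] at this

theorem sum_gcomp {q : ℕ} (deg : Fin q → ℤ) (v : Fin q → DiffOp d) :
    ∑ D ∈ degreeSet deg v, gcomp deg D v = v :=
  sum_gcomp_of_subset deg v (Finset.Subset.refl _)

/-- A submodule of a graded free module is homogeneous if it contains the components of all its
elements. -/
def IsHomogSub {q : ℕ} (deg : Fin q → ℤ) (U : Submodule (DiffOp d) (Fin q → DiffOp d)) : Prop :=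
  ∀ v ∈ U, ∀ D, gcomp deg D v ∈ U

/-- A matrix `A` is of degree zero as a map of graded free modules, from basis degrees `c` to basis
degrees `r`. -/
def IsGradedMap {p q : ℕ} (A : Matrix (Fin p) (Fin q) (DiffOp d)) (c : Fin q → ℤ)
    (r : Fin p → ℤ) : Prop :=
  ∀ a i, IsHomog (A a i) (c i - r a)

theorem IsGradedMap.gcomp_mulVec {p q : ℕ} {A : Matrix (Fin p) (Fin q) (DiffOp d)}
    {c : Fin q → ℤ} {r : Fin p → ℤ} (hA : IsGradedMap A c r) (D : ℤ) (v : Fin q → DiffOp d) :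
    gcomp r D (A.mulVecLin v) = A.mulVecLin (gcomp c D v) := by
  funext a
  simp only [gcomp_apply, Matrix.mulVecLin_apply, Matrix.mulVec, dotProduct, map_sum]
  refine Finset.sum_congr rfl fun i _ => ?_
  rw [← hcomp_mul (hA a i)]
  congr 2
  ring

theorem IsGradedMap.isHomogSub_ker {p q : ℕ} {A : Matrix (Fin p) (Fin q) (DiffOp d)}
    {c : Fin q → ℤ} {r : Fin p → ℤ} (hA : IsGradedMap A c r) :
    IsHomogSub c (LinearMap.ker A.mulVecLin) := by
  intro v hv D
  rw [LinearMap.mem_ker] at *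
  rw [← hA.gcomp_mulVec, hv, map_zero]

theorem IsGradedMap.isHomogSub_range {p q : ℕ} {A : Matrix (Fin p) (Fin q) (DiffOp d)}
    {c : Fin q → ℤ} {r : Fin p → ℤ} (hA : IsGradedMap A c r) :
    IsHomogSub r (LinearMap.range A.mulVecLin) := by
  rintro _ ⟨v, rfl⟩ D
  exact ⟨gcomp c D v, (hA.gcomp_mulVec D v).symm⟩

theorem IsHomogSub.inf {q : ℕ} {deg : Fin q → ℤ} {U V : Submodule (DiffOp d) (Fin q → DiffOp d)}
    (hU : IsHomogSub deg U) (hV : IsHomogSub deg V) : IsHomogSub deg (U ⊓ V) :=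
  fun v hv D => ⟨hU v hv.1 D, hV v hv.2 D⟩

theorem gcomp_smul {q : ℕ} (deg : Fin q → ℤ) {f : DiffOp d} {e : ℤ} (hf : IsHomog f e) (D : ℤ)
    (v : Fin q → DiffOp d) : gcomp deg (e + D) (f • v) = f • gcomp deg D v := by
  funext i
  rw [gcomp_apply, Pi.smul_apply, Pi.smul_apply, smul_eq_mul, smul_eq_mul, gcomp_apply,
    ← hcomp_mul hf]
  congr 2
  ring

theorem smul_mem_gradedPiece {q : ℕ} {deg : Fin q → ℤ} {f : DiffOp d} {e : ℤ}
    (hf : IsHomog f e) {D : ℤ} {v : Fin q → DiffOp d} (hv : v ∈ gradedPiece deg D) :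
    f • v ∈ gradedPiece deg (e + D) := by
  intro i
  have := hf.mul (hv i)
  rwa [← add_sub_assoc] at this

/-- The finite set of exponents of degree `e`. -/
def exponents (d : ℕ) (e : ℤ) : Finset (Fin d →₀ ℕ) :=
  if 0 ≤ e then Finset.finsuppAntidiag Finset.univ e.toNat else ∅

theorem mem_exponents {e : ℤ} {α : Fin d →₀ ℕ} : α ∈ exponents d e ↔ (α.degree : ℤ) = e := by
  unfold exponents
  have h : α.degree = Finset.univ.sum α := Finsupp.degree_eq_sum α
  split_ifs with h0
  · rw [Finset.mem_finsuppAntidiag, ← h]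
    simp only [Finset.subset_univ, and_true]
    omega
  · simp only [Finset.notMem_empty, false_iff]
    omega

instance finite_gradedPiece {q : ℕ} (deg : Fin q → ℤ) (D : ℤ) :
    FiniteDimensional ℂ (gradedPiece (d := d) deg D) := by
  let g : gradedPiece (d := d) deg D →ₗ[ℂ] ((i : Fin q) → exponents d (D - deg i) → ℂ) :=
    { toFun := fun v i α => (v.1 i).coeff α.1
      map_add' := fun _ _ => rfl
      map_smul' := fun _ _ => rfl }
  refine FiniteDimensional.of_injective g fun v w h => ?_
  apply Subtype.ext
  funext i
  ext α
  by_cases hα : (α.degree : ℤ) = D - deg i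
  · exact congrFun (congrFun h i) ⟨α, mem_exponents.2 hα⟩
  · rw [isHomog_iff.1 (v.2 i) α hα, isHomog_iff.1 (w.2 i) α hα]

/-- The number of monomials of degree `e`. -/
def hP (d : ℕ) (e : ℤ) : ℕ := (exponents d e).card

theorem finrank_gradedPiece {q : ℕ} (deg : Fin q → ℤ) (D : ℤ) :
    Module.finrank ℂ (gradedPiece (d := d) deg D) = ∑ i, hP d (D - deg i) := by
  let g : gradedPiece (d := d) deg D ≃ₗ[ℂ] ((i : Fin q) → exponents d (D - deg i) → ℂ) :=
    { toFun := fun v i α => (v.1 i).coeff α.1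
      map_add' := fun _ _ => rfl
      map_smul' := fun _ _ => rfl
      invFun := fun w => ⟨fun i => ∑ α : exponents d (D - deg i),
        MvPolynomial.monomial α.1 (w i α), fun i => IsHomog.sum _ fun α _ => by
          have := isHomog_monomial α.1 (w i α)
          rwa [mem_exponents.1 α.2] at this⟩
      left_inv := by
        intro v
        apply Subtype.ext
        funext i
        ext α
        simp only [MvPolynomial.coeff_sum, MvPolynomial.coeff_monomial]
        by_cases hα : α ∈ exponents d (D - deg i)
        · rw [Finset.sum_eq_single ⟨α, hα⟩]
          · simp
          · intro b _ hb
            rw [if_neg]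
            rintro rfl
            exact hb rfl
          · simp
        · rw [Finset.sum_eq_zero]
          · exact (isHomog_iff.1 (v.2 i) α (fun h => hα (mem_exponents.2 h))).symm
          · intro b _
            rw [if_neg]
            rintro rfl
            exact hα b.2
      right_inv := by
        intro w
        funext i α
        simp only [MvPolynomial.coeff_sum, MvPolynomial.coeff_monomial]
        rw [Finset.sum_eq_single α]
        · simp
        · intro b _ hb
          rw [if_neg]
          exact fun h => hb (Subtype.ext h)
        · simp }
  rw [g.finrank_eq, Module.finrank_pi_fintype]
  refine Finset.sum_congr rfl fun i _ => ?_
  rw [Module.finrank_fintype_fun_eq_card, Fintype.card_coe, hP]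

/-- The piece of degree `D` of a submodule. -/
def subPiece {q : ℕ} (deg : Fin q → ℤ) (U : Submodule (DiffOp d) (Fin q → DiffOp d)) (D : ℤ) :
    Submodule ℂ (Fin q → DiffOp d) :=
  U.restrictScalars ℂ ⊓ gradedPiece deg D

theorem mem_subPiece {q : ℕ} {deg : Fin q → ℤ} {U : Submodule (DiffOp d) (Fin q → DiffOp d)}
    {D : ℤ} {v : Fin q → DiffOp d} :
    v ∈ subPiece deg U D ↔ v ∈ U ∧ v ∈ gradedPiece deg D := Iff.rfl

instance finite_subPiece {q : ℕ} (deg : Fin q → ℤ)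
    (U : Submodule (DiffOp d) (Fin q → DiffOp d)) (D : ℤ) :
    FiniteDimensional ℂ (subPiece deg U D) :=
  Submodule.finiteDimensional_of_le (inf_le_right : _ ≤ gradedPiece deg D)

/-- The Hilbert function of a submodule of a graded free module. -/
def HF {q : ℕ} (deg : Fin q → ℤ) (U : Submodule (DiffOp d) (Fin q → DiffOp d)) (D : ℤ) : ℕ :=
  Module.finrank ℂ (subPiece deg U D)

theorem HF_top {q : ℕ} (deg : Fin q → ℤ) (D : ℤ) :
    HF (d := d) deg ⊤ D = ∑ i, hP d (D - deg i) := by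
  have h : subPiece (d := d) deg ⊤ D = gradedPiece deg D := top_inf_eq _
  rw [← finrank_gradedPiece, HF, h]

theorem HF_mono {q : ℕ} {deg : Fin q → ℤ} {U V : Submodule (DiffOp d) (Fin q → DiffOp d)}
    (h : U ≤ V) (D : ℤ) : HF deg U D ≤ HF deg V D :=
  Submodule.finrank_mono fun _ hv => ⟨h hv.1, hv.2⟩

theorem finrank_eq_map_add_inf_ker {V V' : Type*} [AddCommGroup V] [Module ℂ V] [AddCommGroup V']
    [Module ℂ V'] (f : V →ₗ[ℂ] V') (W : Submodule ℂ V) [FiniteDimensional ℂ W] :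
    Module.finrank ℂ W =
      Module.finrank ℂ (W.map f) + Module.finrank ℂ (W ⊓ LinearMap.ker f : Submodule ℂ V) := by
  have h := (f.domRestrict W).finrank_range_add_finrank_ker
  rw [LinearMap.range_domRestrict, LinearMap.ker_domRestrict] at h
  rw [← h]
  congr 1
  have e := Submodule.finrank_map_subtype_eq W ((LinearMap.ker f).comap W.subtype)
  rw [Submodule.map_comap_subtype] at e
  exact e.symm

/-- A map of degree zero commutes with taking components, so it carries the piece of degree `D` onto
the piece of degree `D` of its range; rank-nullity then applies degree by degree. -/
theorem HF_rank_nullity {p q : ℕ} {A : Matrix (Fin p) (Fin q) (DiffOp d)}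
    {c : Fin q → ℤ} {r : Fin p → ℤ} (hA : IsGradedMap A c r) (D : ℤ) :
    HF (d := d) c ⊤ D = HF c (LinearMap.ker A.mulVecLin) D +
      HF r (LinearMap.range A.mulVecLin) D := by
  have h1 : subPiece c ⊤ D ⊓ LinearMap.ker (A.mulVecLin.restrictScalars ℂ) =
      subPiece c (LinearMap.ker A.mulVecLin) D := by
    ext v
    exact ⟨fun h => ⟨h.2, h.1.2⟩, fun h => ⟨⟨Submodule.mem_top, h.2⟩, h.1⟩⟩
  have h2 : (subPiece c ⊤ D).map (A.mulVecLin.restrictScalars ℂ) =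
      subPiece r (LinearMap.range A.mulVecLin) D := by
    ext w
    constructor
    · rintro ⟨v, hv, rfl⟩
      refine ⟨⟨v, rfl⟩, ?_⟩
      have := gcomp_mem r D (A.mulVecLin v)
      rwa [hA.gcomp_mulVec, gcomp_eq_self hv.2] at this
    · rintro ⟨⟨v, rfl⟩, hw⟩
      refine ⟨gcomp c D v, ⟨Submodule.mem_top, gcomp_mem _ _ _⟩, ?_⟩
      have := hA.gcomp_mulVec D v
      rw [gcomp_eq_self hw] at this
      exact this.symm
  unfold HF
  rw [finrank_eq_map_add_inf_ker (A.mulVecLin.restrictScalars ℂ) (subPiece c ⊤ D), h1, h2,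
    add_comm]

/-- Multiplication by a homogeneous polynomial on the quotient of a homogeneous submodule `U` by
`V`. -/
theorem HF_mul_exact {q : ℕ} {deg : Fin q → ℤ} {U V K W : Submodule (DiffOp d) (Fin q → DiffOp d)}
    (hU : IsHomogSub deg U) (hV : IsHomogSub deg V) {f : DiffOp d} {e : ℤ}
    (hf : IsHomog f e) (hK : ∀ v, v ∈ K ↔ v ∈ U ∧ f • v ∈ V)
    (hW : ∀ v, v ∈ W ↔ ∃ u ∈ U, v - f • u ∈ V) (D : ℤ) :
    HF deg U D + HF deg V (e + D) = HF deg K D + HF deg W (e + D) := by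
  -- Here `K` is the kernel of multiplication by `f` from `U` to `U / V`, and `W` is `V + f U`. The
  -- image of `f • U_D` modulo `V_{e+D}` equals `W_{e+D} / V_{e+D}`, and its dimension is computed
  -- by rank-nullity from both descriptions.
  let mk := (subPiece deg V (e + D)).mkQ
  let mul : (Fin q → DiffOp d) →ₗ[ℂ] (Fin q → DiffOp d) :=
    (LinearMap.lsmul (DiffOp d) (Fin q → DiffOp d) f).restrictScalars ℂ
  have h1 := finrank_eq_map_add_inf_ker (mk ∘ₗ mul) (subPiece deg U D)
  have h2 := finrank_eq_map_add_inf_ker mk (subPiece deg W (e + D))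
  have h3 : (subPiece deg U D).map (mk ∘ₗ mul) = (subPiece deg W (e + D)).map mk := by
    ext w
    simp only [Submodule.mem_map]
    constructor
    · rintro ⟨u, hu, rfl⟩
      refine ⟨f • u, ⟨(hW _).2 ⟨u, hu.1, by simp⟩, smul_mem_gradedPiece hf hu.2⟩, rfl⟩
    · rintro ⟨v, ⟨hv, hvD⟩, rfl⟩
      obtain ⟨u, hu, huv⟩ := (hW v).1 hv
      refine ⟨gcomp deg D u, ⟨hU u hu D, gcomp_mem _ _ _⟩, ?_⟩
      symm
      rw [← sub_eq_zero, LinearMap.comp_apply, ← map_sub]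
      rw [Submodule.mkQ_apply, Submodule.Quotient.mk_eq_zero]
      have := hV _ huv (e + D)
      rw [map_sub, gcomp_smul deg hf, gcomp_eq_self hvD] at this
      exact ⟨this, Submodule.sub_mem _ hvD (smul_mem_gradedPiece hf (gcomp_mem _ _ _))⟩
  have h4 : subPiece deg U D ⊓ LinearMap.ker (mk ∘ₗ mul) = subPiece deg K D := by
    ext v
    rw [Submodule.mem_inf, LinearMap.mem_ker, LinearMap.comp_apply, Submodule.mkQ_apply,
      Submodule.Quotient.mk_eq_zero, mem_subPiece, mem_subPiece, mem_subPiece, hK]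
    constructor
    · rintro ⟨⟨a, b⟩, c, _⟩
      exact ⟨⟨a, c⟩, b⟩
    · rintro ⟨⟨a, c⟩, b⟩
      exact ⟨⟨a, b⟩, c, smul_mem_gradedPiece hf b⟩
  have h5 : subPiece deg W (e + D) ⊓ LinearMap.ker mk = subPiece deg V (e + D) := by
    rw [Submodule.ker_mkQ]
    refine inf_eq_right.2 fun v hv => ⟨(hW v).2 ⟨0, U.zero_mem, by simpa using hv.1⟩, hv.2⟩
  rw [h3, h4] at h1
  rw [h5] at h2
  unfold HF
  omega

/-! ### Submodules with the same Hilbert function up to lower order terms -/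

/-- The exponent of the leading monomial for the lexicographic order. -/
def lexDeg (f : DiffOp d) : Fin d →₀ ℕ := MonomialOrder.lex.degree f

/-- The exponents of degree `e` of monomials outside the monomial ideal generated by `E`. -/
def standardExponents {J : Type*} (E : J → Fin d →₀ ℕ) (e : ℤ) : Finset (Fin d →₀ ℕ) := by
  classical exact (exponents d e).filter fun α => ∀ j, ¬ E j ≤ α

theorem mem_standardExponents {J : Type*} {E : J → Fin d →₀ ℕ} {e : ℤ} {α : Fin d →₀ ℕ} :
    α ∈ standardExponents E e ↔ (α.degree : ℤ) = e ∧ ∀ j, ¬ E j ≤ α := by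
  classical
  rw [standardExponents, Finset.mem_filter, mem_exponents]

/-- Division with remainder: a monomial divisible by the leading monomial of some `F j` is
rewritten, modulo `V`, in smaller monomials of the same degree. -/
theorem monomial_smul_mem_sup_span {q : ℕ} {deg : Fin q → ℤ}
    {V : Submodule (DiffOp d) (Fin q → DiffOp d)} {J : Type*} {F : J → DiffOp d} {b : J → ℤ}
    (hF : ∀ j, IsHomog (F j) (b j)) (hF0 : ∀ j, F j ≠ 0) {u : Fin q → DiffOp d} {e : ℤ}
    (hu : u ∈ gradedPiece deg e) (hFu : ∀ j, F j • u ∈ V) (D : ℤ) (α : Fin d →₀ ℕ)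
    (hα : (α.degree : ℤ) = D - e) :
    (MvPolynomial.monomial α (1 : ℂ) : DiffOp d) • u ∈ subPiece deg V D ⊔
      Submodule.span ℂ ((fun β => (MvPolynomial.monomial β (1 : ℂ) : DiffOp d) • u) ''
        standardExponents (fun j => lexDeg (F j)) (D - e)) := by
  -- The induction runs over the well-founded lexicographic order, with `α` left free since the
  -- smaller monomials have other exponents.
  generalize ha : (MonomialOrder.lex (σ := Fin d)).toSyn α = a
  induction a using WellFoundedLT.induction generalizing α with
  | ind a ih =>
  by_cases hs : α ∈ standardExponents (fun j => lexDeg (F j)) (D - e)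
  · exact Submodule.mem_sup_right (Submodule.subset_span ⟨α, hs, rfl⟩)
  rw [mem_standardExponents] at hs
  push Not at hs
  obtain ⟨j, hj⟩ := hs hα
  set μ := lexDeg (F j) with hμ
  obtain ⟨γ, rfl⟩ := exists_add_of_le hj
  have hc : (F j).coeff μ ≠ 0 := MonomialOrder.lex.coeff_degree_ne_zero_iff.2 (hF0 j)
  have hμs : μ ∈ (F j).support := MvPolynomial.mem_support_iff.2 hc
  have hdeg : ∀ β ∈ (F j).support, ((β + γ).degree : ℤ) = D - e := by
    intro β hβ
    rw [← hα, map_add, map_add]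
    push_cast
    rw [hF j β hβ, hF j μ hμs]
  have hsum : (MvPolynomial.monomial γ (1 : ℂ) : DiffOp d) • (F j • u) =
      ∑ β ∈ (F j).support, (F j).coeff β • ((MvPolynomial.monomial (β + γ) (1 : ℂ) : DiffOp d) • u)
      := by
    rw [smul_smul]
    conv_lhs => rw [(F j).as_sum, Finset.mul_sum, Finset.sum_smul]
    refine Finset.sum_congr rfl fun β _ => ?_
    rw [MvPolynomial.monomial_mul, ← smul_assoc, MvPolynomial.smul_monomial, add_comm γ β]
    simp
  have hmem : (MvPolynomial.monomial γ (1 : ℂ) : DiffOp d) • (F j • u) ∈ subPiece deg V D := by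
    refine ⟨V.smul_mem _ (hFu j), ?_⟩
    have := smul_mem_gradedPiece (isHomog_monomial γ (1 : ℂ)) (smul_mem_gradedPiece (hF j) hu)
    have h2 : (γ.degree : ℤ) + (b j + e) = D := by
      have := hdeg μ hμs
      rw [map_add] at this
      push_cast at this
      rw [hF j μ hμs] at this
      linarith
    rwa [h2] at this
  rw [← Finset.add_sum_erase _ _ hμs] at hsum
  have hkey : (MvPolynomial.monomial (μ + γ) (1 : ℂ) : DiffOp d) • u = ((F j).coeff μ)⁻¹ •
      ((MvPolynomial.monomial γ (1 : ℂ) : DiffOp d) • (F j • u) -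
        ∑ β ∈ (F j).support.erase μ,
          (F j).coeff β • ((MvPolynomial.monomial (β + γ) (1 : ℂ) : DiffOp d) • u)) := by
    rw [hsum, add_sub_cancel_right, smul_smul, inv_mul_cancel₀ hc, one_smul]
  rw [hkey]
  refine Submodule.smul_mem _ _ (Submodule.sub_mem _ (Submodule.mem_sup_left hmem) ?_)
  refine Submodule.sum_mem _ fun β hβ => Submodule.smul_mem _ _ ?_
  rw [Finset.mem_erase] at hβ
  refine ih _ ?_ _ (hdeg β hβ.2) rfl
  rw [← ha, map_add, map_add]
  refine add_lt_add_left ?_ _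
  refine lt_of_le_of_ne (MonomialOrder.lex.le_degree hβ.2) fun h => hβ.1 ?_
  exact MonomialOrder.lex.toSyn.injective h

/-- A homogeneous submodule has finitely many homogeneous generators. -/
theorem IsHomogSub.exists_generators {q : ℕ} {deg : Fin q → ℤ}
    {U : Submodule (DiffOp d) (Fin q → DiffOp d)} (hU : IsHomogSub deg U) :
    ∃ s : Finset ((Fin q → DiffOp d) × ℤ), (∀ x ∈ s, x.1 ∈ U ∧ x.1 ∈ gradedPiece deg x.2) ∧
      U = Submodule.span (DiffOp d) (Prod.fst '' (s : Set ((Fin q → DiffOp d) × ℤ))) := by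
  classical
  obtain ⟨t, ht⟩ := IsNoetherian.noetherian U
  refine ⟨t.biUnion fun v => (degreeSet deg v).image fun D => (gcomp deg D v, D), ?_, ?_⟩
  · intro x hx
    simp only [Finset.mem_biUnion, Finset.mem_image] at hx
    obtain ⟨v, hv, D, _, rfl⟩ := hx
    exact ⟨hU v (ht ▸ Submodule.subset_span hv) D, gcomp_mem _ _ _⟩
  · apply le_antisymm
    · conv_lhs => rw [← ht]
      rw [Submodule.span_le]
      intro v hv
      rw [SetLike.mem_coe, ← sum_gcomp deg v]
      refine Submodule.sum_mem _ fun D hD => Submodule.subset_span ⟨(gcomp deg D v, D), ?_, rfl⟩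
      simp only [Finset.coe_biUnion, Set.mem_iUnion]
      exact ⟨v, hv, Finset.mem_coe.2 (Finset.mem_image_of_mem _ hD)⟩
    · rw [Submodule.span_le]
      rintro _ ⟨x, hx, rfl⟩
      simp only [Finset.coe_biUnion, Set.mem_iUnion, Finset.coe_image] at hx
      obtain ⟨v, hv, D, _, rfl⟩ := hx
      exact hU v (ht ▸ Submodule.subset_span hv) D

/-- In degree `D` only the multiples of a generator by monomials of the complementary degree
survive, so it suffices to test those. -/
theorem subPiece_span_le {q : ℕ} {deg : Fin q → ℤ} {s : Finset ((Fin q → DiffOp d) × ℤ)}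
    (hs : ∀ x ∈ s, x.1 ∈ gradedPiece deg x.2) (D : ℤ) {W : Submodule ℂ (Fin q → DiffOp d)}
    (hW : ∀ x ∈ s, ∀ α : Fin d →₀ ℕ, (α.degree : ℤ) = D - x.2 →
      (MvPolynomial.monomial α (1 : ℂ) : DiffOp d) • x.1 ∈ W) :
    subPiece deg (Submodule.span (DiffOp d) (Prod.fst '' (s : Set ((Fin q → DiffOp d) × ℤ)))) D
      ≤ W := by
  have key : ∀ v ∈ Submodule.span (DiffOp d) (Prod.fst '' (s : Set ((Fin q → DiffOp d) × ℤ))),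
      gcomp deg D v ∈ W := by
    intro v hv
    rw [Submodule.mem_span_image_finset_iff_exists_fun'] at hv
    obtain ⟨c, rfl⟩ := hv
    rw [map_sum]
    refine Submodule.sum_mem _ fun x hx => ?_
    change gcomp deg D (c x • x.1) ∈ W
    rw [(c x).as_sum, Finset.sum_smul, map_sum]
    refine Submodule.sum_mem _ fun α hα => ?_
    have hm := smul_mem_gradedPiece (isHomog_monomial α ((c x).coeff α)) (hs x hx)
    by_cases h : (α.degree : ℤ) = D - x.2
    · rw [h, sub_add_cancel] at hm
      rw [gcomp_eq_self hm]
      have := W.smul_mem ((c x).coeff α) (hW x hx α h)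
      rwa [← smul_assoc, MvPolynomial.smul_monomial, smul_eq_mul, mul_one] at this
    · rw [gcomp_of_ne hm (by omega)]
      exact W.zero_mem
  intro v hv
  rw [← gcomp_eq_self hv.2]
  exact key v hv.1

/-- A bound of the Hilbert function of a quotient by the number of standard monomials of its
annihilator. -/
theorem IsHomogSub.exists_HF_le {q : ℕ} {deg : Fin q → ℤ}
    {U V : Submodule (DiffOp d) (Fin q → DiffOp d)} (hU : IsHomogSub deg U)
    {J : Type*} {F : J → DiffOp d} {b : J → ℤ}
    (hF : ∀ j, IsHomog (F j) (b j)) (hF0 : ∀ j, F j ≠ 0) (hFU : ∀ j, ∀ u ∈ U, F j • u ∈ V) :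
    ∃ s : Finset ((Fin q → DiffOp d) × ℤ), ∀ D, HF deg U D ≤ HF deg V D +
      ∑ x ∈ s, (standardExponents (fun j => lexDeg (F j)) (D - x.2)).card := by
  classical
  obtain ⟨s, hs, hsU⟩ := hU.exists_generators
  refine ⟨s, fun D => ?_⟩
  let std : (Fin q → DiffOp d) × ℤ → Finset (Fin q → DiffOp d) := fun x =>
    (standardExponents (fun j => lexDeg (F j)) (D - x.2)).image
      fun β => (MvPolynomial.monomial β (1 : ℂ) : DiffOp d) • x.1
  -- Modulo `V`, the piece of `U` is spanned by the standard multiples of the finitely many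
  -- homogeneous generators, so the number of these bounds the excess.
  let W := subPiece deg V D ⊔ Submodule.span ℂ (s.biUnion std : Finset _)
  have h1 : subPiece deg U D ≤ W := by
    conv_lhs => rw [hsU]
    refine subPiece_span_le (fun x hx => (hs x hx).2) D fun x hx α hα => ?_
    refine (sup_le_sup_left (Submodule.span_mono ?_) _ :
      subPiece deg V D ⊔ Submodule.span ℂ _ ≤ subPiece deg V D ⊔ Submodule.span ℂ _)
      (monomial_smul_mem_sup_span hF hF0 (hs x hx).2 (fun j => hFU j _ (hs x hx).1) D α hα)
    intro w hw
    rw [Finset.mem_coe, Finset.mem_biUnion]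
    refine ⟨x, hx, ?_⟩
    rw [← Finset.mem_coe, Finset.coe_image]
    exact hw
  have : FiniteDimensional ℂ (Submodule.span ℂ (s.biUnion std : Set (Fin q → DiffOp d))) :=
    FiniteDimensional.span_finset ℂ _
  have h2 : HF deg U D ≤ Module.finrank ℂ W := Submodule.finrank_mono h1
  refine h2.trans ((Submodule.finrank_add_le_finrank_add_finrank _ _).trans ?_)
  refine Nat.add_le_add_left ((finrank_span_finset_le_card _).trans ?_) _
  refine Finset.card_biUnion_le.trans (Finset.sum_le_sum fun x _ => Finset.card_image_le)

/-- Monomials with bounded exponents for the variables in `T`. -/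
theorem card_filter_exponents_mul_le (T : Finset (Fin d)) {k : Fin d} (hk : k ∉ T) (c N : ℕ) :
    ((exponents d N).filter fun α => ∀ i ∈ T, α i < c).card * (N + 1) ^ (T.card + 1) ≤
      c ^ T.card * (N + 1) ^ d := by
  classical
  -- The coordinate at `k` is erased, because the total degree recovers it. Coordinates in `T` take
  -- fewer than `c + 1` values and the others at most `N + 1`.
  let b : Fin d → ℕ := fun i => if i = k then 1 else if i ∈ T then c else N + 1
  have h1 : ((exponents d N).filter fun α => ∀ i ∈ T, α i < c).card ≤
      (Fintype.piFinset fun i => Finset.range (b i)).card := by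
    refine Finset.card_le_card_of_injOn (fun α => Function.update (⇑α) k 0) ?_ ?_
    · intro α hα
      simp only [Finset.coe_filter, Set.mem_ofPred_eq, mem_exponents] at hα
      simp only [Finset.mem_coe, Fintype.mem_piFinset, Finset.mem_range]
      intro i
      by_cases hi : i = k
      · subst hi
        simp [b]
      · rw [Function.update_of_ne hi]
        simp only [b, if_neg hi]
        split_ifs with hT
        · exact hα.2 i hT
        · have := Finsupp.le_degree i α
          omega
    · intro α hα β hβ h
      simp only [Finset.coe_filter, Set.mem_ofPred_eq, mem_exponents] at hα hβ
      have hne : ∀ i, i ≠ k → α i = β i := by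
        intro i hi
        have := congrFun h i
        simpa [hi] using this
      have hdeg : α.degree = β.degree := by omega
      rw [Finsupp.degree_eq_sum, Finsupp.degree_eq_sum,
        ← Finset.add_sum_erase _ _ (Finset.mem_univ k),
        ← Finset.add_sum_erase _ (fun i => β i) (Finset.mem_univ k),
        Finset.sum_congr rfl fun i hi => hne i (Finset.ne_of_mem_erase hi)] at hdeg
      have hk := Nat.add_right_cancel hdeg
      ext i
      by_cases hi : i = k
      · subst hi
        omega
      · exact hne i hi
  have h2 : (∏ i, b i) * (N + 1) ^ (T.card + 1) = c ^ T.card * (N + 1) ^ d := by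
    have h3 : ∀ i, b i * (if i ∈ insert k T then N + 1 else 1) =
        (if i ∈ T then c else 1) * (N + 1) := by
      intro i
      by_cases hi : i = k
      · subst hi
        simp [b, hk]
      · by_cases hT : i ∈ T <;> simp [b, hi, hT]
    have h4 := Finset.prod_congr (s₁ := Finset.univ) rfl fun i _ => h3 i
    rw [Finset.prod_mul_distrib, Finset.prod_mul_distrib, Finset.prod_ite_mem,
      Finset.prod_ite_mem] at h4
    simpa [Finset.card_insert_of_notMem hk] using h4
  rw [← h2]
  refine Nat.mul_le_mul_right _ (h1.trans (le_of_eq ?_))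
  rw [Fintype.card_piFinset]
  simp

open Filter Asymptotics

/-! ### Growth of order less than `N ^ (d - 2)` -/

/-- `f N = o(N ^ (d - 2))`. -/
def Negligible (d : ℕ) (f : ℕ → ℝ) : Prop :=
  f =o[atTop] fun N : ℕ => ((N : ℝ) + 1) ^ (d - 2)

theorem Negligible.add {f g : ℕ → ℝ} (hf : Negligible d f) (hg : Negligible d g) :
    Negligible d fun N => f N + g N := IsLittleO.add hf hg

theorem Negligible.sub {f g : ℕ → ℝ} (hf : Negligible d f) (hg : Negligible d g) :
    Negligible d fun N => f N - g N := IsLittleO.sub hf hg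

theorem Negligible.const_mul {f : ℕ → ℝ} (hf : Negligible d f) (c : ℝ) :
    Negligible d fun N => c * f N := IsLittleO.const_mul_left hf c

theorem Negligible.zero : Negligible d fun _ => 0 := isLittleO_zero _ _

theorem Negligible.sum {ι : Type*} {s : Finset ι} {f : ι → ℕ → ℝ}
    (h : ∀ i ∈ s, Negligible d (f i)) : Negligible d fun N => ∑ i ∈ s, f i N :=
  IsLittleO.fun_sum h

theorem isBigO_pow_shift (k t : ℕ) :
    (fun N : ℕ => (((N + t : ℕ) : ℝ) + 1) ^ k) =O[atTop] fun N : ℕ => ((N : ℝ) + 1) ^ k := by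
  refine IsBigO.pow (IsBigO.of_bound (1 + t) (Eventually.of_forall fun N => ?_)) k
  rw [Real.norm_of_nonneg (by positivity), Real.norm_of_nonneg (by positivity)]
  push_cast
  have : (0 : ℝ) ≤ N * t := by positivity
  nlinarith

theorem Negligible.shift {f : ℕ → ℝ} (hf : Negligible d f) (t : ℕ) :
    Negligible d fun N => f (N + t) :=
  (hf.comp_tendsto (tendsto_add_atTop_nat t)).trans_isBigO (isBigO_pow_shift _ t)

theorem Negligible.telescope {f : ℕ → ℝ} (hf : Negligible d fun N => f (N + 1) - f N) (t : ℕ) :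
    Negligible d fun N => f (N + t) - f N := by
  induction t with
  | zero => simpa using Negligible.zero
  | succ t ih =>
    refine ((hf.shift t).add ih).congr_left fun N => ?_
    rw [← add_assoc]
    ring

theorem Negligible.of_abs_le {f g : ℕ → ℝ} (hg : Negligible d g) (h : ∀ N, |f N| ≤ g N) :
    Negligible d f :=
  IsBigO.trans_isLittleO (IsBigO.of_norm_le h) hg

/-! ### Counting standard monomials -/

/-- A standard exponent has two distinct bounded coordinates: `E 0` bounds some coordinate `i`, and
`E i`, which does not involve `i`, bounds another one. As the degree is fixed, `d - 3` coordinates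
remain free. The extra factor `N + 1` on the left avoids the exponent `d - 3`, which is meaningless
for `d = 2`. -/
theorem exists_card_standardExponents_le (hd : 2 ≤ d) {E : Fin d → Fin d →₀ ℕ}
    (hE : ∀ k, E k k = 0) : ∃ C N₀ : ℕ, ∀ N ≥ N₀,
      (standardExponents E N).card * (N + 1) ≤ C * (N + 1) ^ (d - 2) := by
  classical
  set c : ℕ := ∑ j, (E j).degree with hc
  have hEc : ∀ j i, E j i ≤ c := fun j i => (Finsupp.le_degree i _).trans
    (Finset.single_le_sum (f := fun j => (E j).degree) (fun _ _ => Nat.zero_le _)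
      (Finset.mem_univ j))
  have hsub : ∀ N : ℕ, standardExponents E N ⊆ (Finset.univ : Finset (Fin d)).offDiag.biUnion
      fun x => (exponents d N).filter fun α => ∀ i ∈ ({x.1, x.2} : Finset (Fin d)), α i < c := by
    intro N α hα
    rw [mem_standardExponents] at hα
    have hex : ∀ j, ∃ i, α i < E j i := by
      intro j
      have := hα.2 j
      rw [Finsupp.le_def] at this
      push Not at this
      exact this
    obtain ⟨i, hi⟩ := hex ⟨0, by omega⟩
    obtain ⟨i', hi'⟩ := hex i
    have hne : i ≠ i' := by
      rintro rfl
      rw [hE] at hi'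
      omega
    rw [Finset.mem_biUnion]
    refine ⟨(i, i'), by simpa using hne, ?_⟩
    rw [Finset.mem_filter, mem_exponents]
    refine ⟨hα.1, fun l hl => ?_⟩
    rw [Finset.mem_insert, Finset.mem_singleton] at hl
    rcases hl with rfl | rfl
    · exact hi.trans_le (hEc _ _)
    · exact hi'.trans_le (hEc _ _)
  have hone : ∀ N ≥ 2 * c, ∀ x ∈ (Finset.univ : Finset (Fin d)).offDiag,
      ((exponents d N).filter fun α => ∀ i ∈ ({x.1, x.2} : Finset (Fin d)), α i < c).card *
        (N + 1) ^ 3 ≤ c ^ 2 * (N + 1) ^ d := by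
    intro N hN x hx
    have hx' : x.1 ≠ x.2 := by simpa using hx
    by_cases hk : ∃ k, k ∉ ({x.1, x.2} : Finset (Fin d))
    · obtain ⟨k, hk⟩ := hk
      have := card_filter_exponents_mul_le _ hk c N
      rwa [Finset.card_pair hx'] at this
    -- Here the two bounded coordinates are all the coordinates, so the degree is less than `2 * c`
    -- and nothing is left for `N ≥ 2 * c`.
    · push Not at hk
      rw [Finset.filter_false_of_mem]
      · simp
      · intro α hα h
        rw [mem_exponents, Finsupp.degree_eq_sum] at hα
        have huniv : (Finset.univ : Finset (Fin d)) = {x.1, x.2} :=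
          (Finset.eq_univ_iff_forall.2 hk).symm
        rw [huniv, Finset.sum_pair hx'] at hα
        have h1 := h x.1 (by simp)
        have h2 := h x.2 (by simp)
        push_cast at hα
        omega
  refine ⟨(Finset.univ : Finset (Fin d)).offDiag.card * c ^ 2, 2 * c, fun N hN => ?_⟩
  have h1 := (Finset.card_le_card (hsub N)).trans Finset.card_biUnion_le
  have h2 : (standardExponents E N).card * (N + 1) ^ 3 ≤
      (Finset.univ : Finset (Fin d)).offDiag.card * c ^ 2 * (N + 1) ^ d := by
    refine (Nat.mul_le_mul_right _ h1).trans ?_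
    rw [Finset.sum_mul, mul_assoc, ← smul_eq_mul (a := Finset.card _)]
    exact Finset.sum_le_card_nsmul _ _ _ (hone N hN)
  obtain ⟨k, rfl⟩ := Nat.exists_eq_add_of_le hd
  rw [Nat.add_sub_cancel_left]
  rw [pow_succ' _ 2, pow_add _ 2, ← mul_assoc, ← mul_assoc, mul_right_comm _ (_ ^ 2)] at h2
  exact Nat.le_of_mul_le_mul_right h2 (by positivity)

/-- A single leading exponent already bounds one coordinate, for one of `d` choices of it. With the
degree fixed, `d - 2` coordinates remain free. -/
theorem exists_card_standardExponents_le_of_nonempty (hd : 2 ≤ d) {J : Type*} [Nonempty J]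
    (E : J → Fin d →₀ ℕ) :
    ∃ C : ℕ, ∀ N : ℕ, (standardExponents E N).card ≤ C * (N + 1) ^ (d - 2) := by
  classical
  obtain ⟨j⟩ := ‹Nonempty J›
  set c : ℕ := (E j).degree with hc
  have hsub : ∀ N : ℕ, standardExponents E N ⊆ (Finset.univ : Finset (Fin d)).biUnion
      fun x => (exponents d N).filter fun α => ∀ i ∈ ({x} : Finset (Fin d)), α i < c := by
    intro N α hα
    rw [mem_standardExponents] at hα
    have := hα.2 j
    rw [Finsupp.le_def] at this
    push Not at this
    obtain ⟨i, hi⟩ := this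
    rw [Finset.mem_biUnion]
    refine ⟨i, Finset.mem_univ _, ?_⟩
    rw [Finset.mem_filter, mem_exponents]
    refine ⟨hα.1, fun l hl => ?_⟩
    rw [Finset.mem_singleton] at hl
    subst hl
    exact hi.trans_le (Finsupp.le_degree _ _)
  have hone : ∀ N : ℕ, ∀ x ∈ (Finset.univ : Finset (Fin d)),
      ((exponents d N).filter fun α => ∀ i ∈ ({x} : Finset (Fin d)), α i < c).card *
        (N + 1) ^ 2 ≤ c * (N + 1) ^ d := by
    intro N x _
    have : Nontrivial (Fin d) := Fin.nontrivial_iff_two_le.2 hd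
    obtain ⟨k, hk⟩ := exists_ne x
    simpa using card_filter_exponents_mul_le {x} (by simpa using hk) c N
  refine ⟨d * c, fun N => ?_⟩
  have h1 := (Finset.card_le_card (hsub N)).trans Finset.card_biUnion_le
  have h2 : (standardExponents E N).card * (N + 1) ^ 2 ≤ d * c * (N + 1) ^ d := by
    refine (Nat.mul_le_mul_right _ h1).trans ?_
    rw [Finset.sum_mul, mul_assoc]
    refine (Finset.sum_le_card_nsmul _ _ _ (hone N)).trans ?_
    simp
  obtain ⟨k, rfl⟩ := Nat.exists_eq_add_of_le hd
  rw [Nat.add_sub_cancel_left]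
  rw [pow_add _ 2, mul_left_comm, mul_comm (_ ^ 2)] at h2
  exact Nat.le_of_mul_le_mul_right h2 (by positivity)

theorem standardExponents_of_neg {J : Type*} {E : J → Fin d →₀ ℕ} {e : ℤ} (he : e < 0) :
    standardExponents E e = ∅ := by
  refine Finset.eq_empty_of_forall_notMem fun α hα => ?_
  have := (mem_standardExponents.1 hα).1
  omega

/-- The growth is not affected by a shift of the degree. -/
theorem pow_shift_bounds (D e : ℤ) {N n : ℕ} (hD : D = N) (hn : D - e = n) :
    n + 1 ≤ (e.natAbs + 1) * (N + 1) ∧ N + 1 ≤ (e.natAbs + 1) * (n + 1) := by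
  constructor
  · have : n ≤ N + e.natAbs := by omega
    nlinarith [Nat.zero_le (e.natAbs * N)]
  · have : N ≤ n + e.natAbs := by omega
    nlinarith [Nat.zero_le (e.natAbs * n)]

theorem negligible_card_standardExponents (hd : 2 ≤ d) {E : Fin d → Fin d →₀ ℕ}
    (hE : ∀ k, E k k = 0) (e : ℤ) :
    Negligible d fun N => ((standardExponents E ((N : ℤ) - e)).card : ℝ) := by
  obtain ⟨C, N₀, h⟩ := exists_card_standardExponents_le hd hE
  set K := e.natAbs + 1 with hK
  have hb : ∀ N ≥ N₀ + e.natAbs, (standardExponents E ((N : ℤ) - e)).card * (N + 1) ≤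
      K * C * K ^ (d - 2) * (N + 1) ^ (d - 2) := by
    intro N hN
    obtain ⟨n, hn⟩ := Int.eq_ofNat_of_zero_le (show 0 ≤ (N : ℤ) - e by omega)
    obtain ⟨h1, h2⟩ := pow_shift_bounds (N : ℤ) e rfl hn
    rw [hn]
    calc _ ≤ (standardExponents E n).card * (K * (n + 1)) := Nat.mul_le_mul_left _ h2
      _ = K * ((standardExponents E n).card * (n + 1)) := by ring
      _ ≤ K * (C * (n + 1) ^ (d - 2)) := Nat.mul_le_mul_left _ (h n (by omega))
      _ ≤ K * (C * (K * (N + 1)) ^ (d - 2)) := by gcongr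
      _ = _ := by rw [mul_pow]; ring
  have h1 : (fun N : ℕ => ((standardExponents E ((N : ℤ) - e)).card : ℝ)) =O[atTop]
      fun N : ℕ => ((N : ℝ) + 1) ^ (d - 2) / ((N : ℝ) + 1) := by
    refine IsBigO.of_bound (K * C * K ^ (d - 2) : ℕ)
      (eventually_atTop.2 ⟨N₀ + e.natAbs, fun N hN => ?_⟩)
    rw [Real.norm_of_nonneg (by positivity), Real.norm_of_nonneg (by positivity),
      ← mul_div_assoc, le_div_iff₀ (by positivity)]
    exact_mod_cast hb N hN
  refine h1.trans_isLittleO ?_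
  refine IsLittleO.congr_left (f₁ := fun N : ℕ => ((N : ℝ) + 1) ^ (d - 2) * (1 / ((N : ℝ) + 1)))
    ?_ fun N => by ring
  have h2 : (fun N : ℕ => 1 / ((N : ℝ) + 1)) =o[atTop] fun _ : ℕ => (1 : ℝ) :=
    (isLittleO_one_iff ℝ).2 tendsto_one_div_add_atTop_nhds_zero_nat
  simpa using (isBigO_refl (fun N : ℕ => ((N : ℝ) + 1) ^ (d - 2)) atTop).mul_isLittleO h2

theorem isBigO_card_standardExponents (hd : 2 ≤ d) {J : Type*} [Nonempty J]
    (E : J → Fin d →₀ ℕ) (e : ℤ) :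
    (fun N : ℕ => ((standardExponents E ((N : ℤ) - e)).card : ℝ)) =O[atTop]
      fun N : ℕ => ((N : ℝ) + 1) ^ (d - 2) := by
  obtain ⟨C, h⟩ := exists_card_standardExponents_le_of_nonempty hd E
  set K := e.natAbs + 1 with hK
  refine IsBigO.of_bound (C * K ^ (d - 2) : ℕ) (Eventually.of_forall fun N => ?_)
  rw [Real.norm_of_nonneg (by positivity), Real.norm_of_nonneg (by positivity)]
  by_cases hN : (N : ℤ) - e < 0
  · rw [standardExponents_of_neg hN]
    simp only [Finset.card_empty, Nat.cast_zero]
    positivity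
  · obtain ⟨n, hn⟩ := Int.eq_ofNat_of_zero_le (not_lt.1 hN)
    obtain ⟨h1, -⟩ := pow_shift_bounds (N : ℤ) e rfl hn
    rw [hn]
    have : (standardExponents E n).card ≤ C * K ^ (d - 2) * (N + 1) ^ (d - 2) := by
      calc _ ≤ C * (n + 1) ^ (d - 2) := h n
        _ ≤ C * (K * (N + 1)) ^ (d - 2) := by gcongr
        _ = _ := by rw [mul_pow]; ring
    exact_mod_cast this

/-- The difference of the Hilbert functions of `U` and `V`. -/
def HFsub {q : ℕ} (deg : Fin q → ℤ) (U V : Submodule (DiffOp d) (Fin q → DiffOp d)) (D : ℤ) : ℝ :=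
  (HF deg U D : ℝ) - HF deg V D

theorem HFsub_nonneg {q : ℕ} {deg : Fin q → ℤ} {U V : Submodule (DiffOp d) (Fin q → DiffOp d)}
    (h : V ≤ U) (D : ℤ) : 0 ≤ HFsub deg U V D :=
  sub_nonneg.2 (Nat.cast_le.2 (HF_mono h D))

/-- This is the criterion for `U / V` to have codimension at least two: for each variable the
annihilator contains a form whose leading monomial avoids it. -/
theorem negligible_HFsub (hd : 2 ≤ d) {q : ℕ} {deg : Fin q → ℤ}
    {U V : Submodule (DiffOp d) (Fin q → DiffOp d)} (hU : IsHomogSub deg U) (hVU : V ≤ U)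
    (h : ∀ k, ∃ (f : DiffOp d) (e : ℤ), IsHomog f e ∧ f ≠ 0 ∧ (∀ u ∈ U, f • u ∈ V) ∧ lexDeg f k = 0) :
    Negligible d fun N => HFsub deg U V N := by
  choose F e hF hF0 hFU hFk using h
  obtain ⟨s, hs⟩ := hU.exists_HF_le hF hF0 hFU
  refine Negligible.of_abs_le (g := fun N : ℕ => ∑ x ∈ s,
    ((standardExponents (fun j => lexDeg (F j)) ((N : ℤ) - x.2)).card : ℝ)) ?_ fun N => ?_
  · exact Negligible.sum fun x _ => negligible_card_standardExponents hd hFk x.2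
  · rw [abs_of_nonneg (HFsub_nonneg hVU _), HFsub, sub_le_iff_le_add']
    exact_mod_cast hs N

/-- One nonzero annihilator means codimension at least one, which costs one power of `N` compared
with a free module. -/
theorem isBigO_HFsub (hd : 2 ≤ d) {q : ℕ} {deg : Fin q → ℤ}
    {U V : Submodule (DiffOp d) (Fin q → DiffOp d)} (hU : IsHomogSub deg U) (hVU : V ≤ U)
    {f : DiffOp d} {e : ℤ} (hf : IsHomog f e) (hf0 : f ≠ 0) (hfU : ∀ u ∈ U, f • u ∈ V) :
    (fun N : ℕ => HFsub deg U V N) =O[atTop] fun N : ℕ => ((N : ℝ) + 1) ^ (d - 2) := by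
  obtain ⟨s, hs⟩ := hU.exists_HF_le (J := Unit) (F := fun _ => f) (fun _ => hf) (fun _ => hf0)
    (fun _ => hfU)
  refine IsBigO.trans (g := fun N : ℕ => ∑ x ∈ s,
    ((standardExponents (fun _ : Unit => lexDeg f) ((N : ℤ) - x.2)).card : ℝ)) ?_ ?_
  · refine IsBigO.of_norm_le fun N => ?_
    rw [Real.norm_of_nonneg (HFsub_nonneg hVU _), HFsub, sub_le_iff_le_add']
    exact_mod_cast hs N
  · exact IsBigO.fun_sum fun (x : (Fin q → DiffOp d) × ℤ) _ => isBigO_card_standardExponents hd _ x.2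

/-! ### Torsion quotients: shift of the degree -/

theorem lexDeg_apply_eq_zero {f : DiffOp d} {k : Fin d} (hf0 : f ≠ 0)
    (hf : f ∈ MvPolynomial.supported ℂ {i | i ≠ k}) : lexDeg f k = 0 := by
  by_contra h
  rw [MvPolynomial.mem_supported] at hf
  have : k ∈ f.vars := (MvPolynomial.mem_vars_iff_mem_support k).2
    ⟨lexDeg f, MonomialOrder.lex.degree_mem_support hf0, Finsupp.mem_support_iff.2 h⟩
  exact hf this rfl

theorem IsHomog.isHomogeneous {f : DiffOp d} {e : ℤ} (hf : IsHomog f e) (hf0 : f ≠ 0) :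
    f.IsHomogeneous e.toNat ∧ 0 ≤ e := by
  have h0 : 0 ≤ e := by
    obtain ⟨α, hα⟩ := MvPolynomial.support_nonempty.2 hf0
    have := hf α hα
    omega
  refine ⟨fun α hα => ?_, h0⟩
  have := hf α (MvPolynomial.mem_support_iff.2 hα)
  rw [Finsupp.degree_eq_weight_one] at this
  have h2 : ((Finsupp.weight 1 α : ℕ) : ℤ) = e := this
  change Finsupp.weight 1 α = _
  rw [← h2, Int.toNat_natCast]

theorem isHomog_of_isHomogeneous {f : DiffOp d} {n : ℕ} (hf : f.IsHomogeneous n) :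
    IsHomog f n := by
  intro α hα
  rw [Finsupp.degree_eq_weight_one]
  exact_mod_cast hf (MvPolynomial.mem_support_iff.1 hα)

/-! ### Restriction to a hyperplane. -/

/-- The substitution `X 0 ↦ c * X 1`. -/
def hyperplaneSubst {k : ℕ} (c : ℂ) : DiffOp (k + 2) →ₐ[ℂ] DiffOp (k + 2) :=
  MvPolynomial.aeval fun i => if i = 0 then MvPolynomial.C c * MvPolynomial.X 1
    else MvPolynomial.X i

/-- A point with `x 1 ≠ 0` lies on the hyperplane with `c = x 0 / x 1`. If all restrictions
vanished, `f * X 1` would vanish at every point and hence be zero; the factor `X 1` takes care of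
the points where the quotient is not available. -/
theorem exists_hyperplaneSubst_ne_zero {k : ℕ} {f : DiffOp (k + 2)} (hf : f ≠ 0) :
    ∃ c, hyperplaneSubst c f ≠ 0 := by
  by_contra! h
  refine mul_ne_zero hf (MvPolynomial.X_ne_zero (1 : Fin (k + 2))) (MvPolynomial.funext fun x => ?_)
  rw [map_mul, MvPolynomial.eval_X, map_zero]
  by_cases hx : x 1 = 0
  · rw [hx, mul_zero]
  · have h1 := congrArg (MvPolynomial.eval x) (h (x 0 / x 1))
    rw [map_zero] at h1
    have h2 : MvPolynomial.eval x (hyperplaneSubst (x 0 / x 1) f) = MvPolynomial.eval x f := by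
      have : (MvPolynomial.aeval x).comp (hyperplaneSubst (x 0 / x 1)) =
          (MvPolynomial.aeval x : DiffOp (k + 2) →ₐ[ℂ] ℂ) := by
        refine MvPolynomial.algHom_ext fun i => ?_
        rw [AlgHom.comp_apply, hyperplaneSubst, MvPolynomial.aeval_X]
        split_ifs with hi
        · subst hi
          simp [hx]
        · rfl
      have := DFunLike.congr_fun this f
      simpa [MvPolynomial.aeval_eq_eval] using this
    rw [← h2, h1, zero_mul]

theorem hyperplaneSubst_mem_supported {k : ℕ} (c : ℂ) (f : DiffOp (k + 2)) :
    hyperplaneSubst c f ∈ MvPolynomial.supported ℂ {i | i ≠ (0 : Fin (k + 2))} := by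
  induction f using MvPolynomial.induction_on with
  | C a =>
    rw [← MvPolynomial.algebraMap_eq, AlgHom.commutes]
    exact Subalgebra.algebraMap_mem _ _
  | add p q hp hq =>
    rw [map_add]
    exact add_mem hp hq
  | mul_X p i hp =>
    rw [map_mul]
    refine mul_mem hp ?_
    rw [hyperplaneSubst, MvPolynomial.aeval_X]
    split_ifs with hi
    · rw [← MvPolynomial.algebraMap_eq]
      exact mul_mem (Subalgebra.algebraMap_mem _ _) (MvPolynomial.X_mem_supported.2 (by simp))
    · exact MvPolynomial.X_mem_supported.2 hi

/-- The linear form `X 0 - c * X 1`. -/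
def linForm {k : ℕ} (c : ℂ) : DiffOp (k + 2) :=
  MvPolynomial.X 0 - MvPolynomial.C c * MvPolynomial.X 1

/-- Modulo the linear form the substitution fixes all variables. So a vector killed by both `f` and
the linear form is killed by the restricted polynomial, which is free of `X 0`. -/
theorem sub_hyperplaneSubst_mem {k : ℕ} (c : ℂ) (f : DiffOp (k + 2)) :
    f - hyperplaneSubst c f ∈ Ideal.span {linForm (k := k) c} := by
  rw [← Ideal.Quotient.mk_eq_mk_iff_sub_mem]
  have : (Ideal.Quotient.mkₐ ℂ (Ideal.span {linForm (k := k) c})).comp (hyperplaneSubst c) =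
      Ideal.Quotient.mkₐ ℂ (Ideal.span {linForm (k := k) c}) := by
    refine MvPolynomial.algHom_ext fun i => ?_
    rw [AlgHom.comp_apply, hyperplaneSubst, MvPolynomial.aeval_X]
    split_ifs with hi
    · subst hi
      symm
      exact (Ideal.Quotient.mk_eq_mk_iff_sub_mem _ _).2 (Ideal.subset_span rfl)
    · rfl
  exact (DFunLike.congr_fun this f).symm

theorem isHomog_linForm {k : ℕ} (c : ℂ) : IsHomog (linForm (k := k) c) 1 :=
  isHomog_of_isHomogeneous (n := 1) ((MvPolynomial.isHomogeneous_X _ _).sub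
    (MvPolynomial.isHomogeneous_C_mul_X _ _))

theorem linForm_ne_zero {k : ℕ} (c : ℂ) : linForm (k := k) c ≠ 0 := by
  intro h
  have := congrArg (MvPolynomial.coeff (Finsupp.single 0 1)) h
  rw [linForm, MvPolynomial.coeff_sub, MvPolynomial.coeff_C_mul, MvPolynomial.coeff_X,
    MvPolynomial.coeff_X, if_pos rfl, if_neg] at this
  · simp at this
  · simp [Finsupp.single_left_inj]

theorem lexDeg_linForm {k : ℕ} (c : ℂ) :
    lexDeg (linForm (k := k) c) = Finsupp.single 0 1 := by
  unfold lexDeg linForm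
  rw [MonomialOrder.degree_sub_of_lt, MonomialOrder.degree_X]
  rw [← MvPolynomial.smul_eq_C_mul]
  refine lt_of_le_of_lt MonomialOrder.degree_smul_le ?_
  rw [MonomialOrder.degree_X, MonomialOrder.degree_X, MonomialOrder.lex_lt_iff]
  exact Finsupp.Lex.single_lt_iff.2 (by simp)

/-- The Hilbert function of a torsion quotient `U / V` is almost invariant under shifts of the
degree. -/
theorem negligible_HFsub_succ (hd : 2 ≤ d) {q : ℕ} {deg : Fin q → ℤ}
    {U V : Submodule (DiffOp d) (Fin q → DiffOp d)} (hU : IsHomogSub deg U)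
    (hV : IsHomogSub deg V) (hVU : V ≤ U)
    {f : DiffOp d} {e : ℤ} (hf : IsHomog f e) (hf0 : f ≠ 0) (hfU : ∀ u ∈ U, f • u ∈ V) :
    Negligible d fun N => HFsub deg U V ((N + 1 : ℕ) : ℤ) - HFsub deg U V N := by
  obtain ⟨k, rfl⟩ := Nat.exists_eq_add_of_le' hd
  -- The linear form `l` is chosen so that `f` stays nonzero on the hyperplane `l = 0`.
  -- Multiplication by `l` from degree `N` to degree `N + 1` of `U / V` then has kernel `K / V` and
  -- cokernel `U / W`, both of codimension at least two.
  obtain ⟨c, hc⟩ := exists_hyperplaneSubst_ne_zero hf0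
  set l := linForm (k := k) c with hl
  let K : Submodule (DiffOp (k + 2)) (Fin q → DiffOp (k + 2)) :=
    U ⊓ V.comap (LinearMap.lsmul _ _ l)
  let W : Submodule (DiffOp (k + 2)) (Fin q → DiffOp (k + 2)) :=
    V ⊔ U.map (LinearMap.lsmul _ _ l)
  have hK : ∀ v, v ∈ K ↔ v ∈ U ∧ l • v ∈ V := fun v => Iff.rfl
  have hW : ∀ v, v ∈ W ↔ ∃ u ∈ U, v - l • u ∈ V := by
    intro v
    rw [Submodule.mem_sup]
    constructor
    · rintro ⟨y, hy, _, ⟨u, hu, rfl⟩, rfl⟩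
      exact ⟨u, hu, by simpa using hy⟩
    · rintro ⟨u, hu, h⟩
      exact ⟨_, h, l • u, ⟨u, hu, rfl⟩, sub_add_cancel _ _⟩
  have hlh := isHomog_linForm (k := k) c
  have hKh : IsHomogSub deg K := fun v hv D => by
    rw [hK] at *
    refine ⟨hU v hv.1 D, ?_⟩
    rw [← gcomp_smul deg hlh]
    exact hV _ hv.2 _
  have hann : ∀ {u : Fin q → DiffOp (k + 2)}, f • u ∈ V → l • u ∈ V →
      hyperplaneSubst c f • u ∈ V := by
    intro u h1 h2
    obtain ⟨g, hg⟩ := Ideal.mem_span_singleton'.1 (sub_hyperplaneSubst_mem c f)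
    have : hyperplaneSubst c f = f - g * l := by rw [hg]; ring
    rw [this, sub_smul, mul_smul]
    exact V.sub_mem h1 (V.smul_mem _ h2)
  have hhom : IsHomog (hyperplaneSubst c f) e := by
    obtain ⟨h1, h2⟩ := hf.isHomogeneous hf0
    have h3 : (hyperplaneSubst c f).IsHomogeneous (1 * e.toNat) := by
      refine h1.aeval _ fun i => ?_
      split_ifs
      · exact MvPolynomial.isHomogeneous_C_mul_X _ _
      · exact MvPolynomial.isHomogeneous_X _ _
    have h4 := isHomog_of_isHomogeneous h3
    rwa [one_mul, Int.toNat_of_nonneg h2] at h4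
  have hsupp := hyperplaneSubst_mem_supported c f
  have hVW : V ≤ W := le_sup_left
  have hWU : W ≤ U := by
    refine sup_le hVU ?_
    rintro _ ⟨u, hu, rfl⟩
    exact U.smul_mem _ hu
  -- Two annihilators suffice: the restriction of `f` does not involve the variable 0, and the
  -- leading monomial `X 0` of `l` does not involve any other variable.
  have hker : Negligible (k + 2) fun N => HFsub deg K V N := by
    refine negligible_HFsub hd hKh (fun v hv => ⟨hVU hv, V.smul_mem _ hv⟩) fun i => ?_
    by_cases hi : i = 0
    · subst hi
      exact ⟨_, e, hhom, hc, fun u hu => hann (hfU u hu.1) hu.2, lexDeg_apply_eq_zero hc hsupp⟩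
    · refine ⟨l, 1, hlh, linForm_ne_zero c, fun u hu => hu.2, ?_⟩
      rw [hl, lexDeg_linForm]
      simp [hi]
  have hcoker : Negligible (k + 2) fun N => HFsub deg U W N := by
    refine negligible_HFsub hd hU hWU fun i => ?_
    have hlU : ∀ u ∈ U, l • u ∈ W := fun u hu => (hW _).2 ⟨u, hu, by simp⟩
    by_cases hi : i = 0
    · subst hi
      refine ⟨_, e, hhom, hc, fun u hu => ?_, lexDeg_apply_eq_zero hc hsupp⟩
      obtain ⟨g, hg⟩ := Ideal.mem_span_singleton'.1 (sub_hyperplaneSubst_mem c f)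
      have : hyperplaneSubst c f = f - g * l := by rw [hg]; ring
      rw [this, sub_smul, mul_smul]
      exact W.sub_mem (hVW (hfU u hu)) (W.smul_mem _ (hlU u hu))
    · refine ⟨l, 1, hlh, linForm_ne_zero c, hlU, ?_⟩
      rw [hl, lexDeg_linForm]
      simp [hi]
  -- The change of dimension under multiplication by `l` is the dimension of the cokernel in degree
  -- `N + 1` minus that of the kernel in degree `N`.
  refine ((hcoker.shift 1).sub hker).congr_left fun N => ?_
  have := HF_mul_exact hU hV hlh hK hW N
  have h2 : ((N + 1 : ℕ) : ℤ) = 1 + (N : ℤ) := by push_cast; ring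
  rw [h2]
  unfold HFsub
  have : (HF deg U N : ℝ) + HF deg V (1 + N) = HF deg K N + HF deg W (1 + N) := by
    exact_mod_cast this
  linarith

/-! ### Exactness of dual complexes up to torsion -/

/-- The functional `v` vanishes on `ker B`, so it factors through the range of `B`. The retraction
`π` extends it to the whole free module, and the coefficients of the extension form `w`. -/
theorem exists_mulVec_transpose_of_retract {R : Type*} [CommRing R] {b c : ℕ}
    (B : Matrix (Fin c) (Fin b) R)
    (hπ : ∃ π : (Fin c → R) →ₗ[R] (Fin c → R),
      (∀ x, π x ∈ LinearMap.range B.mulVecLin) ∧ ∀ x ∈ LinearMap.range B.mulVecLin, π x = x)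
    (v : Fin b → R) (hv : ∀ y, B.mulVec y = 0 → v ⬝ᵥ y = 0) :
    ∃ w, B.transpose.mulVec w = v := by
  obtain ⟨π, hπ1, hπ2⟩ := hπ
  let φ : (Fin b → R) →ₗ[R] R := ∑ i, v i • LinearMap.proj i
  have hφ : ∀ y, φ y = v ⬝ᵥ y := fun y => by simp [φ, dotProduct]
  let ψ : LinearMap.range B.mulVecLin →ₗ[R] R :=
    (LinearMap.ker B.mulVecLin).liftQ φ (fun y hy => by
      rw [LinearMap.mem_ker, hφ]
      exact hv y hy) ∘ₗ B.mulVecLin.quotKerEquivRange.symm.toLinearMap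
  have hψ : ∀ y, ψ ⟨B.mulVecLin y, y, rfl⟩ = v ⬝ᵥ y := by
    intro y
    rw [← hφ]
    have : B.mulVecLin.quotKerEquivRange.symm ⟨B.mulVecLin y, y, rfl⟩ = Submodule.Quotient.mk y := by
      rw [LinearEquiv.symm_apply_eq]
      exact Subtype.ext (LinearMap.quotKerEquivRange_apply_mk _ _).symm
    simp only [ψ, LinearMap.comp_apply, LinearEquiv.coe_coe, this, Submodule.liftQ_apply]
  let χ : (Fin c → R) →ₗ[R] R := ψ ∘ₗ π.codRestrict _ hπ1
  refine ⟨fun i => χ (Pi.single i 1), ?_⟩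
  funext i
  have h1 : χ (B.mulVecLin (Pi.single i 1)) = v i := by
    have h2 : π.codRestrict _ hπ1 (B.mulVecLin (Pi.single i 1)) =
        ⟨B.mulVecLin (Pi.single i 1), _, rfl⟩ := Subtype.ext (hπ2 _ ⟨_, rfl⟩)
    change ψ (π.codRestrict _ hπ1 (B.mulVecLin (Pi.single i 1))) = _
    rw [h2, hψ]
    simp
  have h3 : B.mulVecLin (Pi.single i 1) = ∑ k, B k i • Pi.single k (1 : R) := by
    rw [Matrix.mulVecLin_apply, Matrix.mulVec_single_one]
    exact pi_eq_sum_univ' _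
  rw [← h1, h3, map_sum]
  simp only [Matrix.mulVec, dotProduct, Matrix.transpose_apply, map_smul, smul_eq_mul]

/-- Over a principal ideal domain the range of `A` is a submodule of a free module, hence
projective. So `A` splits onto its range, and its kernel, which is the range of `B`, is a direct
summand. -/
theorem exists_retract_of_exact {R : Type*} [CommRing R] [IsDomain R] [IsPrincipalIdealRing R]
    {a b c : ℕ} {A : Matrix (Fin a) (Fin c) R} {B : Matrix (Fin c) (Fin b) R}
    (h : LinearMap.range B.mulVecLin = LinearMap.ker A.mulVecLin) :
    ∃ π : (Fin c → R) →ₗ[R] (Fin c → R),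
      (∀ x, π x ∈ LinearMap.range B.mulVecLin) ∧ ∀ x ∈ LinearMap.range B.mulVecLin, π x = x := by
  obtain ⟨s, hs⟩ := Module.projective_lifting_property A.mulVecLin.rangeRestrict LinearMap.id
    A.mulVecLin.surjective_rangeRestrict
  refine ⟨LinearMap.id - s ∘ₗ A.mulVecLin.rangeRestrict, fun x => ?_, fun x hx => ?_⟩
  · rw [h, LinearMap.mem_ker, LinearMap.sub_apply, map_sub, LinearMap.id_apply, sub_eq_zero]
    have := congrArg Subtype.val (LinearMap.congr_fun hs (A.mulVecLin.rangeRestrict x))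
    exact this.symm
  · rw [h, LinearMap.mem_ker] at hx
    have : A.mulVecLin.rangeRestrict x = 0 := Subtype.ext hx
    simp [this]

theorem exists_retract_of_field {K : Type*} [Field K] {b c : ℕ} (B : Matrix (Fin c) (Fin b) K) :
    ∃ π : (Fin c → K) →ₗ[K] (Fin c → K),
      (∀ x, π x ∈ LinearMap.range B.mulVecLin) ∧ ∀ x ∈ LinearMap.range B.mulVecLin, π x = x := by
  obtain ⟨g, hg⟩ := (LinearMap.range B.mulVecLin).subtype.exists_leftInverse_of_injective
    (Submodule.ker_subtype _)
  exact ⟨(LinearMap.range B.mulVecLin).subtype ∘ₗ g, fun x => (g x).2,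
    fun x hx => congrArg Subtype.val (LinearMap.congr_fun hg ⟨x, hx⟩)⟩

section localization

variable {R K : Type*} [CommRing R] [CommRing K] [Algebra R K]

theorem exists_common_denominator (M : Submonoid R) [IsLocalization M K]
    {b : ℕ} (y : Fin b → K) :
    ∃ s ∈ M, ∃ y₀ : Fin b → R, algebraMap R K ∘ y₀ = algebraMap R K s • y := by
  obtain ⟨s, hs⟩ := IsLocalization.exist_integer_multiples_of_finite M y
  choose y₀ hy₀ using hs
  refine ⟨s, s.2, y₀, funext fun i => ?_⟩
  rw [Function.comp_apply, hy₀, Pi.smul_apply, smul_eq_mul, Algebra.smul_def]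

theorem map_mulVec_algebraMap {b c : ℕ} (B : Matrix (Fin c) (Fin b) R) (y : Fin b → R) :
    (B.map (algebraMap R K)).mulVec (algebraMap R K ∘ y) = algebraMap R K ∘ B.mulVec y := by
  funext i
  exact (RingHom.map_mulVec (algebraMap R K) B y i).symm

/-- Localization preserves exactness: a vector in the localized kernel is multiplied by a common
denominator, lifted before localizing, and divided again. -/
theorem range_map_eq_ker_map (M : Submonoid R) [IsLocalization M K]
    (hinj : Function.Injective (algebraMap R K)) {a b c : ℕ}
    {A : Matrix (Fin a) (Fin c) R} {B : Matrix (Fin c) (Fin b) R}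
    (h : LinearMap.range B.mulVecLin = LinearMap.ker A.mulVecLin) :
    LinearMap.range (B.map (algebraMap R K)).mulVecLin =
      LinearMap.ker (A.map (algebraMap R K)).mulVecLin := by
  apply le_antisymm
  · rintro _ ⟨z, rfl⟩
    have hAB : A * B = 0 := by
      refine Matrix.ext_of_mulVec_single fun i => ?_
      rw [← Matrix.mulVec_mulVec, Matrix.zero_mulVec]
      have : B.mulVecLin (Pi.single i 1) ∈ LinearMap.ker A.mulVecLin := h ▸ ⟨_, rfl⟩
      exact this
    rw [LinearMap.mem_ker, Matrix.mulVecLin_apply, Matrix.mulVecLin_apply, Matrix.mulVec_mulVec,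
      ← Matrix.map_mul, hAB]
    simp
  · intro y hy
    rw [LinearMap.mem_ker, Matrix.mulVecLin_apply] at hy
    obtain ⟨s, hs, y₀, hy₀⟩ := exists_common_denominator M y
    have h1 : y₀ ∈ LinearMap.range B.mulVecLin := by
      rw [h, LinearMap.mem_ker, Matrix.mulVecLin_apply]
      refine hinj.comp_left (?_ : algebraMap R K ∘ _ = algebraMap R K ∘ _)
      rw [← map_mulVec_algebraMap, hy₀, Matrix.mulVec_smul, hy, smul_zero]
      ext
      simp
    obtain ⟨z, rfl⟩ := h1
    obtain ⟨u, hu⟩ := IsLocalization.map_units K (⟨s, hs⟩ : M)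
    refine ⟨(↑u⁻¹ : K) • (algebraMap R K ∘ z), ?_⟩
    rw [map_smul, Matrix.mulVecLin_apply, map_mulVec_algebraMap, ← Matrix.mulVecLin_apply, hy₀]
    rw [← hu, smul_smul, Units.inv_mul, one_smul]

/-- If the range of `B` becomes a direct summand after localization, the dual equation is solved
there, and clearing the denominators of the solution produces `s`. -/
theorem exists_smul_eq_mulVec_transpose (M : Submonoid R) [IsLocalization M K]
    (hinj : Function.Injective (algebraMap R K)) {b c : ℕ}
    {B : Matrix (Fin c) (Fin b) R}
    (hπ : ∃ π : (Fin c → K) →ₗ[K] (Fin c → K),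
      (∀ x, π x ∈ LinearMap.range (B.map (algebraMap R K)).mulVecLin) ∧
        ∀ x ∈ LinearMap.range (B.map (algebraMap R K)).mulVecLin, π x = x)
    (v : Fin b → R) (hv : ∀ y, B.mulVec y = 0 → v ⬝ᵥ y = 0) :
    ∃ s ∈ M, s • v ∈ LinearMap.range B.transpose.mulVecLin := by
  have hv' : ∀ y, (B.map (algebraMap R K)).mulVec y = 0 → (algebraMap R K ∘ v) ⬝ᵥ y = 0 := by
    intro y hy
    obtain ⟨s, hs, y₀, hy₀⟩ := exists_common_denominator M y
    have h1 : B.mulVec y₀ = 0 := by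
      refine hinj.comp_left (?_ : algebraMap R K ∘ _ = algebraMap R K ∘ _)
      rw [← map_mulVec_algebraMap, hy₀, Matrix.mulVec_smul, hy, smul_zero]
      ext
      simp
    have h2 := congrArg (algebraMap R K) (hv y₀ h1)
    rw [RingHom.map_dotProduct, hy₀, dotProduct_smul, map_zero] at h2
    exact (IsLocalization.map_units K (⟨s, hs⟩ : M)).mul_right_eq_zero.1 h2
  obtain ⟨w, hw⟩ := exists_mulVec_transpose_of_retract _ hπ _ hv'
  obtain ⟨s, hs, w₀, hw₀⟩ := exists_common_denominator M w
  refine ⟨s, hs, w₀, hinj.comp_left ?_⟩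
  change algebraMap R K ∘ (B.transpose.mulVec w₀) = algebraMap R K ∘ (s • v)
  rw [← map_mulVec_algebraMap, hw₀, Matrix.mulVec_smul, Matrix.transpose_map, hw]
  ext i
  simp

/-- Since `U` is finitely generated, the product of the denominators of its generators serves all of
`U`. -/
theorem exists_smul_le_range_transpose (M : Submonoid R) [IsLocalization M K] [IsNoetherianRing R]
    (hinj : Function.Injective (algebraMap R K)) {b c : ℕ}
    {B : Matrix (Fin c) (Fin b) R}
    (hπ : ∃ π : (Fin c → K) →ₗ[K] (Fin c → K),
      (∀ x, π x ∈ LinearMap.range (B.map (algebraMap R K)).mulVecLin) ∧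
        ∀ x ∈ LinearMap.range (B.map (algebraMap R K)).mulVecLin, π x = x)
    {U : Submodule R (Fin b → R)} (hU : ∀ v ∈ U, ∀ y, B.mulVec y = 0 → v ⬝ᵥ y = 0) :
    ∃ s ∈ M, ∀ v ∈ U, s • v ∈ LinearMap.range B.transpose.mulVecLin := by
  classical
  obtain ⟨t, rfl⟩ := IsNoetherian.noetherian U
  have h1 : ∀ v : t, ∃ s ∈ M, s • (v.1 : Fin b → R) ∈ LinearMap.range B.transpose.mulVecLin := fun v =>
    exists_smul_eq_mulVec_transpose (K := K) M hinj hπ v.1 (hU v.1 (Submodule.subset_span v.2))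
  choose s hsM hs using h1
  refine ⟨∏ v, s v, Submonoid.prod_mem _ fun v _ => hsM v, fun v hv => ?_⟩
  have h2 : Submodule.span R (t : Set (Fin b → R)) ≤
      (LinearMap.range B.transpose.mulVecLin).comap (LinearMap.lsmul R (Fin b → R) (∏ v, s v)) := by
    rw [Submodule.span_le]
    intro x hx
    obtain ⟨r, hr⟩ := Finset.dvd_prod_of_mem s (Finset.mem_univ (⟨x, hx⟩ : t))
    change (∏ v, s v) • x ∈ LinearMap.range B.transpose.mulVecLin
    rw [hr, mul_comm, mul_smul]
    exact Submodule.smul_mem _ r (hs ⟨x, hx⟩)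
  exact h2 hv

end localization

/-! ### Inverting the polynomials free of one variable. -/

/-- The polynomial ring as polynomials in one of the variables. -/
def polyEquiv (j : Fin d) :
    DiffOp d ≃ₐ[ℂ] Polynomial (MvPolynomial {i : Fin d // i ≠ j} ℂ) :=
  (MvPolynomial.renameEquiv ℂ (Equiv.optionSubtypeNe j).symm).trans
    (MvPolynomial.optionEquivLeft ℂ {i : Fin d // i ≠ j})

theorem polyEquiv_symm_C (j : Fin d) (a : MvPolynomial {i : Fin d // i ≠ j} ℂ) :
    (polyEquiv j).symm (Polynomial.C a) = MvPolynomial.rename Subtype.val a := by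
  rw [AlgEquiv.symm_apply_eq]
  induction a using MvPolynomial.induction_on with
  | C a =>
    rw [MvPolynomial.rename_C]
    simp [polyEquiv]
  | add p q hp hq => rw [map_add, map_add, hp, hq, map_add]
  | mul_X p i hp =>
    rw [map_mul, map_mul, hp, map_mul]
    congr 1
    simp [polyEquiv, Equiv.optionSubtypeNe_symm_of_ne i.2]

/-- With `F` the field of rational functions in the other variables, inverting the nonzero
polynomials free of the variable `j` turns the ring into `F[X]`. This is a principal ideal domain,
so exactness at one place suffices for the retraction, and the denominators are free of the variable
`j`. -/
theorem exists_supported_smul_le_range_transpose_aux (j : Fin d) (F : Type) [Field F]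
    [Algebra (MvPolynomial {i : Fin d // i ≠ j} ℂ) F]
    [IsFractionRing (MvPolynomial {i : Fin d // i ≠ j} ℂ) F] {a b c : ℕ}
    {A : Matrix (Fin a) (Fin c) (DiffOp d)} {B : Matrix (Fin c) (Fin b) (DiffOp d)}
    (h : LinearMap.range B.mulVecLin = LinearMap.ker A.mulVecLin)
    {U : Submodule (DiffOp d) (Fin b → DiffOp d)}
    (hU : ∀ v ∈ U, ∀ y, B.mulVec y = 0 → v ⬝ᵥ y = 0) :
    ∃ s ∈ MvPolynomial.supported ℂ {i | i ≠ j}, s ≠ 0 ∧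
      ∀ v ∈ U, s • v ∈ LinearMap.range B.transpose.mulVecLin := by
  let A₀ := MvPolynomial {i : Fin d // i ≠ j} ℂ
  let N : Submonoid (Polynomial A₀) := (nonZeroDivisors A₀).map Polynomial.C
  let e : Polynomial A₀ ≃+* DiffOp d := (polyEquiv j).symm.toRingEquiv
  let _ : Algebra (Polynomial A₀) (Polynomial F) := Polynomial.algebra A₀ F
  have _ : IsLocalization N (Polynomial F) := Polynomial.isLocalization (nonZeroDivisors A₀) F
  let _ : Algebra (DiffOp d) (Polynomial F) := ((algebraMap (Polynomial A₀) (Polynomial F)).comp e.symm.toRingHom).toAlgebra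
  have _ : IsLocalization (N.map e) (Polynomial F) := IsLocalization.isLocalization_of_base_ringEquiv N (Polynomial F) e
  have hM : ∀ s ∈ N.map e, s ∈ MvPolynomial.supported ℂ {i | i ≠ j} ∧ s ≠ 0 := by
    rintro _ ⟨_, ⟨a, ha, rfl⟩, rfl⟩
    constructor
    · rw [MvPolynomial.supported_eq_range_rename]
      exact ⟨a, (polyEquiv_symm_C j a).symm⟩
    · refine (map_ne_zero_iff e e.injective).2 ?_
      rw [Ne, Polynomial.C_eq_zero]
      exact nonZeroDivisors.ne_zero ha
  have hinj : Function.Injective (algebraMap (DiffOp d) (Polynomial F)) := by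
    refine IsLocalization.injective (Polynomial F) (M := N.map e) fun s hs => ?_
    exact mem_nonZeroDivisors_of_ne_zero (hM s hs).2
  obtain ⟨s, hs, hsU⟩ := exists_smul_le_range_transpose (N.map e) hinj
    (exists_retract_of_exact (R := Polynomial F) (range_map_eq_ker_map (N.map e) hinj h)) hU
  exact ⟨s, (hM s hs).1, (hM s hs).2, hsU⟩

/-- Dual exactness in codimension one: if `range B = ker A`, then the functionals that vanish on
`ker B` are in the range of `Bᵀ` up to a polynomial which does not involve the variable `j`. -/
theorem exists_supported_smul_le_range_transpose (j : Fin d) {a b c : ℕ}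
    {A : Matrix (Fin a) (Fin c) (DiffOp d)} {B : Matrix (Fin c) (Fin b) (DiffOp d)}
    (h : LinearMap.range B.mulVecLin = LinearMap.ker A.mulVecLin)
    {U : Submodule (DiffOp d) (Fin b → DiffOp d)}
    (hU : ∀ v ∈ U, ∀ y, B.mulVec y = 0 → v ⬝ᵥ y = 0) :
    ∃ s ∈ MvPolynomial.supported ℂ {i | i ≠ j}, s ≠ 0 ∧
      ∀ v ∈ U, s • v ∈ LinearMap.range B.transpose.mulVecLin :=
  exists_supported_smul_le_range_transpose_aux j
    (FractionRing (MvPolynomial {i : Fin d // i ≠ j} ℂ)) h hU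

/-- The same argument over the fraction field: every subspace is a direct summand, so no matrix to
the left of `B` is needed, but nothing is known about the variables occurring in `s`. -/
theorem exists_ne_zero_smul_le_range_transpose {b c : ℕ}
    {B : Matrix (Fin c) (Fin b) (DiffOp d)} {U : Submodule (DiffOp d) (Fin b → DiffOp d)}
    (hU : ∀ v ∈ U, ∀ y, B.mulVec y = 0 → v ⬝ᵥ y = 0) :
    ∃ s : DiffOp d, s ≠ 0 ∧ ∀ v ∈ U, s • v ∈ LinearMap.range B.transpose.mulVecLin := by
  obtain ⟨s, hs, hsU⟩ := exists_smul_le_range_transpose (K := FractionRing (DiffOp d))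
    (nonZeroDivisors (DiffOp d)) (IsFractionRing.injective _ _) (exists_retract_of_field _) hU
  exact ⟨s, nonZeroDivisors.ne_zero hs, hsU⟩

/-- The homogeneous components of an annihilator are annihilators. -/
theorem hcomp_smul_mem {q : ℕ} {deg : Fin q → ℤ}
    {U V : Submodule (DiffOp d) (Fin q → DiffOp d)} (hU : IsHomogSub deg U)
    (hV : IsHomogSub deg V) {s : DiffOp d} (h : ∀ u ∈ U, s • u ∈ V) (e : ℤ) :
    ∀ u ∈ U, hcomp e s • u ∈ V := by
  have key : ∀ D, ∀ u ∈ U, u ∈ gradedPiece deg D → hcomp e s • u ∈ V := by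
    intro D u hu huD
    have h1 := hV _ (h u hu) (e + D)
    have h2 : gcomp deg (e + D) (s • u) = hcomp e s • u := by
      funext i
      rw [gcomp_apply, Pi.smul_apply, Pi.smul_apply, smul_eq_mul, smul_eq_mul, mul_comm s,
        mul_comm (hcomp e s), ← hcomp_mul (huD i)]
      congr 2
      ring
    rwa [h2] at h1
  intro u hu
  rw [← sum_gcomp deg u, Finset.smul_sum]
  exact V.sum_mem fun D _ => key D _ (hU u hu D) (gcomp_mem _ _ _)

theorem exists_hcomp_ne_zero {s : DiffOp d} (hs : s ≠ 0) : ∃ e, hcomp e s ≠ 0 := by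
  obtain ⟨α, hα⟩ := MvPolynomial.support_nonempty.2 hs
  refine ⟨α.degree, fun h => ?_⟩
  have := coeff_hcomp α.degree s α
  rw [h, if_pos rfl] at this
  exact MvPolynomial.mem_support_iff.1 hα this.symm

theorem hcomp_mem_supported {s : DiffOp d} {S : Set (Fin d)}
    (hs : s ∈ MvPolynomial.supported ℂ S) (e : ℤ) : hcomp e s ∈ MvPolynomial.supported ℂ S := by
  rw [MvPolynomial.mem_supported] at *
  intro i hi
  obtain ⟨α, hα, hαi⟩ := (MvPolynomial.mem_vars_iff_mem_support i).1 hi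
  refine hs ((MvPolynomial.mem_vars_iff_mem_support i).2 ⟨α, ?_, hαi⟩)
  rw [MvPolynomial.mem_support_iff, coeff_hcomp] at hα
  rw [MvPolynomial.mem_support_iff]
  intro h
  simp [h] at hα

theorem range_transpose_le_ker_transpose {R : Type*} [CommRing R] {b c b' : ℕ}
    {B : Matrix (Fin c) (Fin b) R} {C : Matrix (Fin b) (Fin b') R}
    (h : LinearMap.range C.mulVecLin ≤ LinearMap.ker B.mulVecLin) :
    LinearMap.range B.transpose.mulVecLin ≤ LinearMap.ker C.transpose.mulVecLin := by
  have hBC : B * C = 0 := by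
    refine Matrix.ext_of_mulVec_single fun i => ?_
    rw [← Matrix.mulVec_mulVec, Matrix.zero_mulVec]
    exact h ⟨Pi.single i 1, rfl⟩
  rintro _ ⟨w, rfl⟩
  rw [LinearMap.mem_ker, Matrix.mulVecLin_apply, Matrix.mulVecLin_apply, Matrix.mulVec_mulVec,
    ← Matrix.transpose_mul, hBC, Matrix.transpose_zero, Matrix.zero_mulVec]

/-- In a complex `Bᵀ`, `Cᵀ` dual to an exact sequence, the homology is negligible. -/
theorem negligible_HFsub_dual (hd : 2 ≤ d) {a b c b' : ℕ}
    {A : Matrix (Fin a) (Fin c) (DiffOp d)} {B : Matrix (Fin c) (Fin b) (DiffOp d)}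
    {C : Matrix (Fin b) (Fin b') (DiffOp d)}
    (hAB : LinearMap.range B.mulVecLin = LinearMap.ker A.mulVecLin)
    (hBC : LinearMap.range C.mulVecLin = LinearMap.ker B.mulVecLin)
    {deg : Fin b → ℤ} (hU : IsHomogSub deg (LinearMap.ker C.transpose.mulVecLin))
    (hV : IsHomogSub deg (LinearMap.range B.transpose.mulVecLin)) :
    Negligible d fun N => HFsub deg (LinearMap.ker C.transpose.mulVecLin)
      (LinearMap.range B.transpose.mulVecLin) N := by
  have hdot : ∀ v ∈ LinearMap.ker C.transpose.mulVecLin, ∀ y, B.mulVec y = 0 → v ⬝ᵥ y = 0 := by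
    intro v hv y hy
    obtain ⟨z, rfl⟩ : y ∈ LinearMap.range C.mulVecLin := hBC ▸ hy
    rw [Matrix.mulVecLin_apply, Matrix.dotProduct_mulVec, ← Matrix.mulVec_transpose]
    rw [LinearMap.mem_ker, Matrix.mulVecLin_apply] at hv
    rw [hv, zero_dotProduct]
  have hVU : LinearMap.range B.transpose.mulVecLin ≤ LinearMap.ker C.transpose.mulVecLin :=
    range_transpose_le_ker_transpose hBC.le
  refine negligible_HFsub hd hU hVU fun j => ?_
  -- The denominator need not be homogeneous. Any nonzero component of it is still an annihilator
  -- and still free of the variable `j`, and so is its leading monomial.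
  obtain ⟨s, hs, hs0, hsU⟩ := exists_supported_smul_le_range_transpose j hAB hdot
  obtain ⟨e, he⟩ := exists_hcomp_ne_zero hs0
  exact ⟨hcomp e s, e, isHomog_hcomp e s, he, hcomp_smul_mem hU hV hsU e,
    lexDeg_apply_eq_zero he (hcomp_mem_supported hs e)⟩

/-! ### Asymptotics of binomial coefficients -/

theorem hP_natCast (k N : ℕ) : hP (k + 1) N = (N + k).choose k := by
  unfold hP exponents
  rw [if_pos (by positivity), Int.toNat_natCast, Finset.card_finsuppAntidiag_nat_eq_choose]
  rw [Finset.card_univ, Fintype.card_fin]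
  have : k + 1 + N - 1 = N + k := by omega
  rw [this, Nat.choose_symm_add]

theorem hP_of_neg {e : ℤ} (he : e < 0) : hP d e = 0 := by
  rw [hP, exponents, if_neg (by omega), Finset.card_empty]

/-- The number of monomials of degree `N` in `d - 1` variables. -/
def binomB (d N : ℕ) : ℝ := (N + (d - 2)).choose (d - 2)

theorem binomB_pos (d N : ℕ) : 0 < binomB d N :=
  Nat.cast_pos.2 (Nat.choose_pos (by omega))

theorem pow_le_factorial_mul_choose (k N : ℕ) :
    ((N : ℝ) + 1) ^ k ≤ k.factorial * (N + k).choose k := by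
  have := Nat.pow_succ_le_ascFactorial (N + 1) k
  rw [Nat.ascFactorial_eq_factorial_mul_choose] at this
  exact_mod_cast this

theorem isBigO_pow_binomB (d : ℕ) :
    (fun N : ℕ => ((N : ℝ) + 1) ^ (d - 2)) =O[atTop] binomB d := by
  refine IsBigO.of_bound (d - 2).factorial (Eventually.of_forall fun N => ?_)
  rw [Real.norm_of_nonneg (by positivity), Real.norm_of_nonneg (binomB_pos d N).le]
  exact pow_le_factorial_mul_choose _ _

theorem isBigO_binomB_pow (d : ℕ) :
    binomB d =O[atTop] fun N : ℕ => ((N : ℝ) + 1) ^ (d - 2) := by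
  have h : ∀ N, binomB d N ≤ (((N + (d - 2) : ℕ) : ℝ) + 1) ^ (d - 2) := by
    intro N
    have h1 := Nat.choose_le_pow (N + (d - 2)) (d - 2)
    have h2 : (N + (d - 2)) ^ (d - 2) ≤ (N + (d - 2) + 1) ^ (d - 2) :=
      Nat.pow_le_pow_left (Nat.le_succ _) _
    unfold binomB
    exact_mod_cast h1.trans h2
  refine IsBigO.trans (IsBigO.of_norm_le fun N => ?_) (isBigO_pow_shift (d - 2) (d - 2))
  rw [Real.norm_of_nonneg (binomB_pos d N).le]
  exact h N

/-- The quotient of consecutive values is 1 + (d-2)/(N+1), so the difference is smaller than the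
binomial coefficient by a factor of order 1/N. -/
theorem negligible_binomB_succ (d : ℕ) :
    Negligible d fun N => binomB d (N + 1) - binomB d N := by
  have h : ∀ N : ℕ, binomB d N * ((d - 2 : ℕ) * (1 / ((N : ℝ) + 1))) =
      binomB d (N + 1) - binomB d N := by
    intro N
    have h1 := Nat.choose_mul_succ_eq (N + (d - 2)) (d - 2)
    have h2 : N + (d - 2) + 1 - (d - 2) = N + 1 := by omega
    rw [h2] at h1
    have h3 : binomB d N * ((N : ℝ) + (d - 2 : ℕ) + 1) = binomB d (N + 1) * ((N : ℝ) + 1) := by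
      unfold binomB
      rw [add_right_comm N 1]
      exact_mod_cast h1
    field_simp
    linarith
  have h2 : (fun N : ℕ => ((d - 2 : ℕ) : ℝ) * (1 / ((N : ℝ) + 1))) =o[atTop] fun _ : ℕ => (1 : ℝ) :=
    ((isLittleO_one_iff ℝ).2 tendsto_one_div_add_atTop_nhds_zero_nat).const_mul_left _
  have h3 := (isBigO_binomB_pow d).mul_isLittleO h2
  simp only [mul_one] at h3
  exact h3.congr_left h

theorem Negligible.congr {f g : ℕ → ℝ} (hf : Negligible d f) (h : f =ᶠ[atTop] g) :
    Negligible d g := IsLittleO.congr' hf h EventuallyEq.rfl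

theorem Negligible.unshift {f : ℕ → ℝ} (hf : Negligible d f) (t : ℕ) :
    Negligible d fun N => f (N - t) := by
  refine (hf.comp_tendsto (tendsto_sub_atTop_nat t)).trans_isBigO ?_
  refine IsBigO.of_norm_le fun N => ?_
  rw [Function.comp_apply, Real.norm_of_nonneg (by positivity)]
  gcongr
  exact Nat.sub_le N t

/-- Pascal's rule. For `N = 0` the subtracted term is zero, as there are no monomials of degree -1.
-/
theorem hP_sub_hP_pred (k N : ℕ) : (hP (k + 2) N : ℝ) - hP (k + 2) ((N : ℤ) - 1) =
    binomB (k + 2) N := by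
  unfold binomB
  rw [hP_natCast, Nat.add_sub_cancel]
  cases N with
  | zero => simp [hP_of_neg]
  | succ N =>
    have h : ((N + 1 : ℕ) : ℤ) - 1 = (N : ℤ) := by push_cast; ring
    rw [h, hP_natCast]
    have := Nat.choose_succ_succ (N + 1 + k) k
    have h2 : N + 1 + (k + 1) = (N + 1 + k).succ := by omega
    have h3 : N + (k + 1) = N + 1 + k := by omega
    rw [h2, this, h3]
    push_cast
    ring

/-- The difference is a sum of `t` values `binomB d (N - s)` with `s < t`, and each of them differs
negligibly from `binomB d N`. -/
theorem negligible_hP_sub (hd : 2 ≤ d) (t : ℕ) :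
    Negligible d fun N => (hP d N : ℝ) - hP d ((N : ℤ) - t) - t * binomB d N := by
  obtain ⟨k, rfl⟩ := Nat.exists_eq_add_of_le' hd
  induction t with
  | zero => simpa using Negligible.zero
  | succ t ih =>
    have h1 := ((negligible_binomB_succ (k + 2)).telescope t).unshift t
    refine (ih.sub h1).congr ?_
    filter_upwards [eventually_ge_atTop t] with N hN
    have h2 := hP_sub_hP_pred k (N - t)
    rw [Nat.cast_sub hN] at h2
    have h3 : (N : ℤ) - ((t + 1 : ℕ) : ℤ) = (N : ℤ) - t - 1 := by push_cast; ring
    rw [h3, Nat.sub_add_cancel hN, ← h2]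
    push_cast
    ring

/-- If an alternating sum of Hilbert functions of free modules of rank one grows slowly, its
leading coefficient is given by the sum of the degrees. -/
theorem negligible_sum_hP (hd : 2 ≤ d) {ι : Type*} (s : Finset ι) (ε : ι → ℝ) (o : ι → ℕ)
    {x : ℕ → ℝ} (hx : x =O[atTop] fun N : ℕ => ((N : ℝ) + 1) ^ (d - 2))
    (h : Negligible d fun N => x N - ∑ g ∈ s, ε g * hP d ((N : ℤ) - o g)) :
    Negligible d fun N => x N - (-∑ g ∈ s, ε g * o g) * binomB d N := by
  have h1 : Negligible d fun N => x N - ((∑ g ∈ s, ε g) * hP d N -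
      (∑ g ∈ s, ε g * o g) * binomB d N) := by
    have h2 : Negligible d fun N => ∑ g ∈ s,
        ε g * ((hP d N : ℝ) - hP d ((N : ℤ) - o g) - o g * binomB d N) :=
      Negligible.sum fun g _ => (negligible_hP_sub hd (o g)).const_mul _
    refine (h.sub h2).congr (Eventually.of_forall fun N => ?_)
    simp only [mul_sub, Finset.sum_sub_distrib, Finset.sum_mul, ← mul_assoc]
    ring
  -- Otherwise `hP d N`, which grows at least like a multiple of `N ^ (d - 1)`, would be O(N ^ (d -
  -- 2)), because `x` and the second term are.
  have h3 : ∑ g ∈ s, ε g = 0 := by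
    by_contra hne
    have h4 : (fun N : ℕ => (∑ g ∈ s, ε g) * (hP d N : ℝ)) =O[atTop]
        fun N : ℕ => ((N : ℝ) + 1) ^ (d - 2) := by
      have h5 := (hx.sub (IsLittleO.isBigO h1)).add
        ((isBigO_binomB_pow d).const_mul_left (∑ g ∈ s, ε g * o g))
      refine h5.congr_left fun N => ?_
      ring
    have h6 : (fun N : ℕ => (hP d N : ℝ)) =O[atTop] fun N : ℕ => ((N : ℝ) + 1) ^ (d - 2) :=
      (isBigO_const_mul_left_iff hne).1 h4
    have h7 : (fun N : ℕ => ((N : ℝ) + 1) ^ (d - 1)) =O[atTop] fun N : ℕ => (hP d N : ℝ) := by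
      obtain ⟨k, rfl⟩ := Nat.exists_eq_add_of_le' (show 1 ≤ d by omega)
      refine IsBigO.of_bound (k.factorial) (Eventually.of_forall fun N => ?_)
      rw [Real.norm_of_nonneg (by positivity), Real.norm_of_nonneg (by positivity), hP_natCast]
      exact pow_le_factorial_mul_choose k N
    have h8 : (fun N : ℕ => ((N : ℝ) + 1) ^ (d - 2)) =o[atTop]
        fun N : ℕ => ((N : ℝ) + 1) ^ (d - 1) :=
      (isLittleO_pow_pow_atTop_of_lt (𝕜 := ℝ) (show d - 2 < d - 1 by omega)).comp_tendsto
        (tendsto_atTop_add_const_right _ 1 tendsto_natCast_atTop_atTop)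
    have h9 := (h7.trans h6).trans_isLittleO h8
    exact isLittleO_irrefl (Frequently.of_forall fun N => by positivity) h9
  refine h1.congr (Eventually.of_forall fun N => ?_)
  simp only [h3, zero_mul]
  ring

theorem tendsto_degreeOfFreedom (hd : 2 ≤ d) {h : ℕ → ℝ} {ν : ℝ}
    (hh : Negligible d fun N => h N - ν * binomB d N) :
    Tendsto (fun N : ℕ => 1 / ((d : ℝ) - 1) * ((N : ℝ) * h N / ((N + d - 1).choose N : ℝ)))
      atTop (𝓝 ν) := by
  have h1 : Tendsto (fun N => (h N - ν * binomB d N) / binomB d N) atTop (𝓝 0) :=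
    (IsLittleO.trans_isBigO hh (isBigO_pow_binomB d)).tendsto_div_nhds_zero
  have h2 : Tendsto (fun N => h N / binomB d N) atTop (𝓝 ν) := by
    have := h1.add_const ν
    rw [zero_add] at this
    refine this.congr fun N => ?_
    have := (binomB_pos d N).ne'
    field_simp
    ring
  obtain ⟨k, rfl⟩ := Nat.exists_eq_add_of_le' hd
  have h3 : Tendsto (fun N : ℕ => (N : ℝ) / ((N : ℝ) + ((k : ℝ) + 1))) atTop (𝓝 1) :=
    tendsto_natCast_div_add_atTop _
  have h4 := h2.mul h3
  rw [mul_one] at h4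
  refine h4.congr fun N => ?_
  -- With `d = k + 2`, the normalization in the definition of 𝒩 equals that by `binomB` up to the
  -- factor N / (N + d - 1), which tends to 1.
  have h5 : ((N + (k + 2) - 1).choose N : ℝ) * (k + 1) = binomB (k + 2) N * (N + (k + 1)) := by
    have h6 : N + (k + 2) - 1 = N + k + 1 := by omega
    have h7 : (N + k + 1).choose N = (N + k + 1).choose (k + 1) := by
      rw [add_assoc, Nat.choose_symm_add]
    have h8 := Nat.add_one_mul_choose_eq (N + k) k
    rw [h6, h7]
    unfold binomB
    rw [Nat.add_sub_cancel]
    have h9 : ((N + k + 1).choose (k + 1) * (k + 1) : ℕ) = (N + k).choose k * (N + (k + 1)) := by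
      rw [← h8, mul_comm, add_assoc]
    exact_mod_cast h9
  have hB := (binomB_pos (k + 2) N).ne'
  have h6 : ((N + (k + 2) - 1).choose N : ℝ) = binomB (k + 2) N * (N + (k + 1)) / (k + 1) := by
    rw [← h5]
    field_simp
  rw [h6]
  have : ((k + 2 : ℕ) : ℝ) - 1 = k + 1 := by push_cast; ring
  rw [this]
  have h10 : (N : ℝ) + (k + 1) ≠ 0 := by positivity
  field_simp

/-! ### Hilbert functions of the resolutions -/

theorem alternating_sum_of_add {R : Type*} [CommRing R] {g F : ℕ → R}
    (h : ∀ s, g s + g (s + 1) = F s) (K : ℕ) :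
    g 0 = ∑ s ∈ Finset.range K, (-1) ^ s * F s + (-1) ^ K * g K := by
  induction K with
  | zero => simp
  | succ K ih => rw [ih, Finset.sum_range_succ, ← h K]; ring

theorem HF_eq_zero_of_rank {q : ℕ} (hq : q = 0) (deg : Fin q → ℤ)
    (U : Submodule (DiffOp d) (Fin q → DiffOp d)) (D : ℤ) : HF deg U D = 0 := by
  subst hq
  exact Module.finrank_zero_of_subsingleton

namespace SyzygyTower

variable {p q : ℕ} {A : Matrix (Fin p) (Fin q) (DiffOp d)} {deg : Fin q → ℤ}
  (R : SyzygyTower A deg)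

/-- The Hilbert function of the free module at stage `s`, with degrees given by the orders. -/
def freeHF (s : ℕ) (D : ℤ) : ℝ := ∑ α, (hP d (D - R.ord s α) : ℝ)

/-- The Hilbert function of the dual of the free module at stage `s`. -/
def dualHF (s : ℕ) (D : ℤ) : ℝ := ∑ α, (hP d (D - -R.ord s α) : ℝ)

theorem isGradedMap_map0 : IsGradedMap R.map0 (R.ord 0) deg := R.homog0

theorem isGradedMap_map (s : ℕ) : IsGradedMap (R.map s) (R.ord (s + 1)) (R.ord s) := R.homog s

theorem isGradedMap_map0_transpose :
    IsGradedMap R.map0.transpose (fun i => -deg i) (fun α => -R.ord 0 α) := fun α i => by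
  have := R.homog0 i α
  rwa [show R.ord 0 α - deg i = -deg i - -R.ord 0 α by ring] at this

theorem isGradedMap_map_transpose (s : ℕ) :
    IsGradedMap (R.map s).transpose (fun α => -R.ord s α) (fun α => -R.ord (s + 1) α) :=
  fun β α => by
  have := R.homog s α β
  rwa [show R.ord (s + 1) β - R.ord s α = -R.ord s α - -R.ord (s + 1) β by ring] at this

/-- Exactness identifies the kernel at each stage with the range of the next map, so rank-nullity
gives a telescoping alternating sum. -/
theorem HF_ker {K : ℕ} (hK : ∀ s, K ≤ s → R.rank s = 0) (D : ℤ) :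
    (HF deg (LinearMap.ker A.mulVecLin) D : ℝ) =
      ∑ s ∈ Finset.range K, (-1) ^ s * R.freeHF s D := by
  let g : ℕ → ℝ
    | 0 => HF deg (LinearMap.range R.map0.mulVecLin) D
    | s + 1 => HF (R.ord s) (LinearMap.range (R.map s).mulVecLin) D
  have hg : ∀ s, g s + g (s + 1) = R.freeHF s D := by
    intro s
    have hfree : R.freeHF s D = (HF (d := d) (R.ord s) ⊤ D : ℝ) := by
      rw [HF_top, freeHF]
      push_cast
      rfl
    rw [hfree]
    cases s with
    | zero =>
      rw [HF_rank_nullity R.isGradedMap_map0, ← R.exact1, add_comm]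
      push_cast
      rfl
    | succ s =>
      rw [HF_rank_nullity (R.isGradedMap_map s), ← R.exact s, add_comm]
      push_cast
      rfl
  -- The remainder `g (K + 1)` is the Hilbert function of a submodule of the free module of stage
  -- `K`, which has rank zero. The extra summand `freeHF K` vanishes for the same reason.
  have h0 := alternating_sum_of_add hg (K + 1)
  have hgK : g (K + 1) = 0 := by
    change ((HF (R.ord K) _ D : ℕ) : ℝ) = 0
    rw [HF_eq_zero_of_rank (hK K le_rfl), Nat.cast_zero]
  have hFK : R.freeHF K D = 0 := by
    have := hK K le_rfl
    have : IsEmpty (Fin (R.rank K)) := by rw [this]; infer_instance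
    rw [freeHF, Finset.univ_eq_empty, Finset.sum_empty]
  rw [← R.exact0]
  change g 0 = _
  rw [h0, hgK, Finset.sum_range_succ, hFK]
  ring

/-- The dual complex is not exact, but its homology at each stage is negligible, so the alternating
sum of the exact case still holds up to negligible terms. -/
theorem negligible_HF_range_map0_transpose (hd : 2 ≤ d) {K : ℕ}
    (hK : ∀ s, K ≤ s → R.rank s = 0) :
    Negligible d fun N => (HF (fun α => -R.ord 0 α)
      (LinearMap.range R.map0.transpose.mulVecLin) N : ℝ) -
        ∑ s ∈ Finset.range K, (-1) ^ s * R.dualHF s N := by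
  let g : ℕ → ℕ → ℝ
    | 0, N => HF (fun α => -R.ord 0 α) (LinearMap.range R.map0.transpose.mulVecLin) N
    | s + 1, N => HF (fun α => -R.ord (s + 1) α) (LinearMap.range (R.map s).transpose.mulVecLin) N
  have hsmall : ∀ s, Negligible d fun N => R.dualHF s N - (g s N + g (s + 1) N) := by
    intro s
    have hfree : ∀ N : ℕ,
        R.dualHF s N = (HF (d := d) (fun α => -R.ord s α) ⊤ (N : ℤ) : ℝ) := by
      intro N
      rw [HF_top, dualHF]
      push_cast
      rfl
    cases s with
    | zero =>
      refine (negligible_HFsub_dual hd R.exact0 R.exact1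
        (R.isGradedMap_map_transpose 0).isHomogSub_ker
        R.isGradedMap_map0_transpose.isHomogSub_range).congr (Eventually.of_forall fun N => ?_)
      simp only [hfree]
      rw [HF_rank_nullity (R.isGradedMap_map_transpose 0), HFsub]
      simp only [g]
      push_cast
      ring
    | succ s =>
      -- The codimension argument needs the range of `R.map s` to be a kernel. The matrix providing
      -- this is `map0` for `s = 0` and the previous map otherwise.
      have hex : ∃ (a : ℕ) (A' : Matrix (Fin a) (Fin (R.rank s)) (DiffOp d)),
          LinearMap.range (R.map s).mulVecLin = LinearMap.ker A'.mulVecLin := by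
        cases s with
        | zero => exact ⟨_, _, R.exact1⟩
        | succ s => exact ⟨_, _, R.exact s⟩
      obtain ⟨a, A', hA'⟩ := hex
      refine (negligible_HFsub_dual hd hA' (R.exact s)
        (R.isGradedMap_map_transpose (s + 1)).isHomogSub_ker
        (R.isGradedMap_map_transpose s).isHomogSub_range).congr (Eventually.of_forall fun N => ?_)
      simp only [hfree]
      rw [HF_rank_nullity (R.isGradedMap_map_transpose (s + 1)), HFsub]
      simp only [g]
      push_cast
      ring
  have h0 : ∀ N, g 0 N = ∑ s ∈ Finset.range K, (-1) ^ s * (g s N + g (s + 1) N) := by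
    intro N
    have := alternating_sum_of_add (g := fun s => g s N) (fun s => rfl) K
    have hgK : g K N = 0 := by
      cases K with
      | zero =>
        change ((HF _ _ (N : ℤ) : ℕ) : ℝ) = 0
        rw [HF_eq_zero_of_rank (hK 0 le_rfl), Nat.cast_zero]
      | succ K =>
        change ((HF _ _ (N : ℤ) : ℕ) : ℝ) = 0
        rw [HF_eq_zero_of_rank (hK (K + 1) le_rfl), Nat.cast_zero]
    rw [this, hgK, mul_zero, add_zero]
  have h1 : Negligible d fun N => ∑ s ∈ Finset.range K,
      (-((-1) ^ s)) * (R.dualHF s N - (g s N + g (s + 1) N)) :=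
    Negligible.sum fun s _ => (hsmall s).const_mul _
  refine h1.congr (Eventually.of_forall fun N => ?_)
  change _ = g 0 N - _
  rw [h0 N]
  simp only [neg_mul, mul_sub, Finset.sum_neg_distrib, Finset.sum_sub_distrib]
  ring

end SyzygyTower

/-! ### The module of physical degrees of freedom -/

section

variable {n m : ℕ} {T : Matrix (Fin n) (Fin m) (DiffOp d)} {k : Fin n → ℤ} {θ : Fin m → ℤ}

/-- The operators that vanish on all trivial solutions. -/
def trivialAnn (G : GaugeStructure T k θ) : Submodule (DiffOp d) (Fin m → DiffOp d) :=
  LinearMap.ker G.sym.map0.transpose.mulVecLin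

/-- The operators that vanish on all solutions. -/
def solutionAnn (T : Matrix (Fin n) (Fin m) (DiffOp d)) :
    Submodule (DiffOp d) (Fin m → DiffOp d) :=
  LinearMap.range T.transpose.mulVecLin

theorem solutionAnn_le_trivialAnn (G : GaugeStructure T k θ) : solutionAnn T ≤ trivialAnn G :=
  range_transpose_le_ker_transpose G.sym.exact0.le

theorem isGradedMap_sym_map0_transpose (G : GaugeStructure T k θ) :
    IsGradedMap G.sym.map0.transpose θ (fun α => -G.sym.ord 0 α) := by
  simpa using G.sym.isGradedMap_map0_transpose

theorem isHomogSub_trivialAnn (G : GaugeStructure T k θ) : IsHomogSub θ (trivialAnn G) :=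
  (isGradedMap_sym_map0_transpose G).isHomogSub_ker

/-- The degree `k a - θ i` of an entry is the one required of a map from basis degrees `k` to basis
degrees `θ`, so it is the transpose that is graded with these signs. -/
theorem isGradedMap_transpose (hT : IsHomogMatrix T k θ) : IsGradedMap T.transpose k θ :=
  fun i a => hT a i

theorem isHomogSub_solutionAnn (hT : IsHomogMatrix T k θ) : IsHomogSub θ (solutionAnn T) :=
  (isGradedMap_transpose hT).isHomogSub_range

/-- The columns of `map0` generate the kernel of `T`, so elements of `trivialAnn G` vanish on `ker
T` and lie in the row space of `T` over the fraction field. Hence the module of physical degrees of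
freedom is torsion. -/
theorem exists_smul_trivialAnn_le (hT : IsHomogMatrix T k θ) (G : GaugeStructure T k θ) :
    ∃ (f : DiffOp d) (e : ℤ), IsHomog f e ∧ f ≠ 0 ∧ ∀ u ∈ trivialAnn G, f • u ∈ solutionAnn T := by
  have hdot : ∀ v ∈ trivialAnn G, ∀ y, T.mulVec y = 0 → v ⬝ᵥ y = 0 := by
    intro v hv y hy
    obtain ⟨z, rfl⟩ : y ∈ LinearMap.range G.sym.map0.mulVecLin := G.sym.exact0 ▸ hy
    rw [Matrix.mulVecLin_apply, Matrix.dotProduct_mulVec, ← Matrix.mulVec_transpose]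
    rw [trivialAnn, LinearMap.mem_ker, Matrix.mulVecLin_apply] at hv
    rw [hv, zero_dotProduct]
  obtain ⟨s, hs, hsU⟩ := exists_ne_zero_smul_le_range_transpose hdot
  obtain ⟨e, he⟩ := exists_hcomp_ne_zero hs
  exact ⟨hcomp e s, e, isHomog_hcomp e s, he,
    hcomp_smul_mem (isHomogSub_trivialAnn G) (isHomogSub_solutionAnn hT) hsU e⟩

/-! ### The alternating sum over the generators. -/

/-- The generators of the BRST complex, as a sum type. -/
def generatorEquiv (G : GaugeStructure T k θ) :
    Generator G ≃ Fin m ⊕ Fin n ⊕ (Σ s, Fin (G.sym.rank s)) ⊕ (Σ s, Fin (G.ident.rank s)) where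
  toFun
    | .field i => .inl i
    | .antifield a => .inr (.inl a)
    | .ghost s α => .inr (.inr (.inl ⟨s, α⟩))
    | .antighost s A => .inr (.inr (.inr ⟨s, A⟩))
  invFun
    | .inl i => .field i
    | .inr (.inl a) => .antifield a
    | .inr (.inr (.inl x)) => .ghost x.1 x.2
    | .inr (.inr (.inr x)) => .antighost x.1 x.2
  left_inv g := by cases g <;> rfl
  right_inv x := by rcases x with i | a | x | x <;> rfl

/-- The generators up to stage `K`. -/
def generatorFinset (G : GaugeStructure T k θ) (K : ℕ) : Finset (Generator G) :=
  (Finset.disjSum (Finset.univ : Finset (Fin m)) (Finset.disjSum (Finset.univ : Finset (Fin n))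
    (Finset.disjSum ((Finset.range K).sigma fun _ => Finset.univ)
      ((Finset.range K).sigma fun _ => Finset.univ)))).map (generatorEquiv G).symm.toEmbedding

theorem sum_generatorFinset (G : GaugeStructure T k θ) (K : ℕ) (f : Generator G → ℝ) :
    ∑ g ∈ generatorFinset G K, f g = ∑ i, f (.field i) + (∑ a, f (.antifield a) +
      (∑ s ∈ Finset.range K, ∑ α, f (.ghost s α) +
        ∑ s ∈ Finset.range K, ∑ A, f (.antighost s A))) := by
  rw [generatorFinset, Finset.sum_map, Finset.sum_disjSum, Finset.sum_disjSum,
    Finset.sum_disjSum, Finset.sum_sigma, Finset.sum_sigma]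
  rfl

theorem mem_generatorFinset (G : GaugeStructure T k θ) {K : ℕ}
    (hK : ∀ s, K ≤ s → G.sym.rank s = 0 ∧ G.ident.rank s = 0) (g : Generator G) :
    g ∈ generatorFinset G K := by
  rw [generatorFinset, Finset.mem_map_equiv, Equiv.symm_symm]
  cases g with
  | field i => simp [generatorEquiv]
  | antifield a => simp [generatorEquiv]
  | ghost s α =>
    have : s < K := by
      by_contra h
      have h1 := (hK s (by omega)).1
      have h2 := α.2
      omega
    simpa [generatorEquiv] using this
  | antighost s A =>
    have : s < K := by
      by_contra h
      have h1 := (hK s (by omega)).2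
      have h2 := A.2
      omega
    simpa [generatorEquiv] using this

theorem exists_rank_eq_zero (G : GaugeStructure T k θ) :
    ∃ K, ∀ s, K ≤ s → G.sym.rank s = 0 ∧ G.ident.rank s = 0 := by
  obtain ⟨K₁, h1⟩ := G.sym.finite
  obtain ⟨K₂, h2⟩ := G.ident.finite
  exact ⟨max K₁ K₂, fun s hs => ⟨h1 s (le_of_max_le_left hs), h2 s (le_of_max_le_right hs)⟩⟩

instance finite_generator (G : GaugeStructure T k θ) : Finite (Generator G) := by
  obtain ⟨K, hK⟩ := exists_rank_eq_zero G
  exact @Finite.of_fintype _ ⟨generatorFinset G K, mem_generatorFinset G hK⟩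

instance fintypeGenerator (G : GaugeStructure T k θ) : Fintype (Generator G) := Fintype.ofFinite _

/-- The sign `(-1) ^ gh`. -/
def parity (e : ℤ) : ℝ := ((e.negOnePow : ℤ) : ℝ)

/-- The degree of freedom as an alternating sum of the orders of the generators. -/
def dof (G : GaugeStructure T k θ) : ℝ := -∑ g : Generator G, parity g.gh * g.order

/-- Rank-nullity for the transposes of `map0` and `T` leaves four terms: the free modules on fields
and equations, the exact resolution of the kernel by antighosts, and the dual resolution by ghosts.
Only the last one is known merely up to negligible terms. -/
theorem negligible_HFsub_sub_sum (hd : 2 ≤ d) (hT : IsHomogMatrix T k θ)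
    (G : GaugeStructure T k θ) :
    Negligible d fun N => HFsub θ (trivialAnn G) (solutionAnn T) N -
      ∑ g : Generator G, parity g.gh * hP d ((N : ℤ) - g.order) := by
  obtain ⟨K, hK⟩ := exists_rank_eq_zero G
  have huniv : (Finset.univ : Finset (Generator G)) = generatorFinset G K :=
    (Finset.eq_univ_of_forall (mem_generatorFinset G hK)).symm
  refine ((G.sym.negligible_HF_range_map0_transpose hd fun s hs => (hK s hs).1).const_mul
    (-1)).congr (Eventually.of_forall fun N => ?_)
  have h1 := HF_rank_nullity (isGradedMap_sym_map0_transpose G) N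
  have h2 := HF_rank_nullity (isGradedMap_transpose hT) N
  have h3 := G.ident.HF_ker (fun s hs => (hK s hs).2) N
  have h4 : (HF (d := d) θ ⊤ (N : ℤ) : ℝ) = HF θ (trivialAnn G) N +
      HF (fun α => -G.sym.ord 0 α) (LinearMap.range G.sym.map0.transpose.mulVecLin) N := by
    exact_mod_cast h1
  have h5 : (HF (d := d) k ⊤ (N : ℤ) : ℝ) = HF k (LinearMap.ker T.transpose.mulVecLin) N +
      HF θ (solutionAnn T) N := by
    exact_mod_cast h2
  rw [HF_top] at h4 h5
  push_cast at h4 h5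
  beta_reduce
  rw [huniv, sum_generatorFinset]
  have e1 : ∀ s : ℕ, parity ((s : ℤ) + 1) = -(-1) ^ s := by
    intro s
    have := Int.cast_negOnePow_natCast ℝ (s + 1)
    push_cast at this
    rw [parity, this, pow_succ]
    ring
  have e2 : ∀ s : ℕ, parity (-((s : ℤ) + 2)) = (-1) ^ s := by
    intro s
    have := Int.cast_negOnePow_natCast ℝ (s + 2)
    push_cast at this
    rw [parity, Int.negOnePow_neg, this, pow_add]
    ring
  have e3 : parity 0 = 1 := by simp [parity]
  have e4 : parity (-1) = -1 := by simp [parity]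
  simp only [Generator.gh, Generator.order, e1, e2, e3, e4, ← Finset.mul_sum]
  simp only [SyzygyTower.dualHF, SyzygyTower.freeHF, HFsub] at h3 ⊢
  simp only [neg_mul, Finset.sum_neg_distrib]
  linarith

/-- Torsion gives the bound O(N ^ (d - 2)) needed to extract the leading coefficient. Positivity of
the orders allows them to be treated as natural numbers. -/
theorem negligible_HFsub_sub_dof (hd : 2 ≤ d) (hT : IsHomogMatrix T k θ)
    (G : GaugeStructure T k θ) (hpos : ∀ g : Generator G, 0 < g.order) :
    Negligible d fun N => HFsub θ (trivialAnn G) (solutionAnn T) N - dof G * binomB d N := by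
  obtain ⟨f, e, hf, hf0, hfU⟩ := exists_smul_trivialAnn_le hT G
  have hx := isBigO_HFsub hd (isHomogSub_trivialAnn G) (solutionAnn_le_trivialAnn G) hf hf0 hfU
  have ho : ∀ g : Generator G, ((g.order.toNat : ℕ) : ℤ) = g.order := fun g =>
    Int.toNat_of_nonneg (hpos g).le
  have h := negligible_sum_hP hd Finset.univ (fun g : Generator G => parity g.gh)
    (fun g => g.order.toNat) hx (by
      simp only [ho]
      exact negligible_HFsub_sub_sum hd hT G)
  have h2 : dof G = -∑ g : Generator G, parity g.gh * (g.order.toNat : ℝ) := by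
    unfold dof
    congr 1
    refine Finset.sum_congr rfl fun g _ => ?_
    rw [← Int.cast_natCast (R := ℝ), ho]
  rw [h2]
  exact h

end

/-! ### The action of differential operators -/

theorem partialD_apply (i : Fin d) (f : Smooth d) (x : Fin d → ℝ) :
    (partialD i f).1 x = fderiv ℝ f.1 x (Pi.single i 1) := rfl

theorem partialD_commute (i j : Fin d) : Commute (partialD (d := d) i) (partialD j) := by
  have key : ∀ (i j : Fin d) (f : Smooth d) (x : Fin d → ℝ), (partialD i (partialD j f)).1 x =
      fderiv ℝ (fderiv ℝ f.1) x (Pi.single i 1) (Pi.single j 1) := by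
    intro i j f x
    have h1 : DifferentiableAt ℝ (fderiv ℝ f.1) x :=
      (f.contDiff.fderiv_right (m := 1) (by norm_cast)).differentiable (by simp) x
    change fderiv ℝ (fun y => fderiv ℝ f.1 y (Pi.single j 1)) x (Pi.single i 1) = _
    rw [fderiv_clm_apply h1 (differentiableAt_const _)]
    simp
  refine LinearMap.ext fun f => Subtype.ext (funext fun x => ?_)
  change (partialD i (partialD j f)).1 x = (partialD j (partialD i f)).1 x
  rw [key, key]
  exact (f.contDiff.contDiffAt.isSymmSndFDerivAt
    (by rw [minSmoothness_of_isRCLikeNormedField]; exact WithTop.coe_le_coe.2 (le_top : (2 : ℕ∞) ≤ ⊤))) _ _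

theorem commute_pow_list_prod {M ι : Type*} [Monoid M] {D : ι → M}
    (hD : ∀ i j, Commute (D i) (D j)) (i : ι) (n : ℕ) (a : ι → ℕ) (l : List ι) :
    Commute (D i ^ n) (l.map fun i => D i ^ a i).prod := by
  refine Commute.list_prod_right _ _ fun y hy => ?_
  obtain ⟨j, _, rfl⟩ := List.mem_map.1 hy
  exact (hD i j).pow_pow _ _

theorem list_prod_pow_add {M ι : Type*} [Monoid M] {D : ι → M}
    (hD : ∀ i j, Commute (D i) (D j)) (a b : ι → ℕ) (l : List ι) :
    (l.map fun i => D i ^ (a i + b i)).prod =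
      (l.map fun i => D i ^ a i).prod * (l.map fun i => D i ^ b i).prod := by
  induction l with
  | nil => simp
  | cons i l ih =>
    rw [List.map_cons, List.prod_cons, ih, pow_add, List.map_cons, List.prod_cons, List.map_cons,
      List.prod_cons, mul_assoc, mul_assoc, ← mul_assoc (D i ^ b i),
      (commute_pow_list_prod hD i (b i) a l).eq, mul_assoc]

theorem multiD_add (α β : Fin d → ℕ) : multiD (α + β) = multiD α * multiD β :=
  list_prod_pow_add partialD_commute α β _

theorem opAct_eq_sum (p : DiffOp d) {s : Finset (Fin d →₀ ℕ)} (hs : p.support ⊆ s) :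
    opAct p = ∑ α ∈ s, p.coeff α • multiD (fun i => α i) := by
  refine Finset.sum_subset hs fun α _ hα => ?_
  rw [MvPolynomial.notMem_support_iff.1 hα, zero_smul]

theorem opAct_add (p q : DiffOp d) : opAct (p + q) = opAct p + opAct q := by
  classical
  rw [opAct_eq_sum (p + q) MvPolynomial.support_add, opAct_eq_sum p Finset.subset_union_left,
    opAct_eq_sum q Finset.subset_union_right, ← Finset.sum_add_distrib]
  refine Finset.sum_congr rfl fun α _ => ?_
  rw [MvPolynomial.coeff_add, add_smul]

theorem opAct_zero : opAct (0 : DiffOp d) = 0 := by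
  simp [opAct]

theorem opAct_monomial (α : Fin d →₀ ℕ) (c : ℂ) :
    opAct (MvPolynomial.monomial α c : DiffOp d) = c • multiD (fun i => α i) := by
  rw [opAct_eq_sum _ MvPolynomial.support_monomial_subset, Finset.sum_singleton,
    MvPolynomial.coeff_monomial, if_pos rfl]

theorem opAct_smul (c : ℂ) (p : DiffOp d) : opAct (c • p) = c • opAct p := by
  rw [opAct_eq_sum (c • p) MvPolynomial.support_smul, opAct, Finset.smul_sum]
  refine Finset.sum_congr rfl fun α _ => ?_
  rw [MvPolynomial.coeff_smul, smul_assoc]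

theorem opAct_sum {ι : Type*} (s : Finset ι) (p : ι → DiffOp d) :
    opAct (∑ i ∈ s, p i) = ∑ i ∈ s, opAct (p i) := by
  classical
  induction s using Finset.induction_on with
  | empty => simp [opAct_zero]
  | insert a s ha ih => rw [Finset.sum_insert ha, Finset.sum_insert ha, opAct_add, ih]

theorem opAct_mul (p q : DiffOp d) : opAct (p * q) = opAct p * opAct q := by
  induction p using MvPolynomial.induction_on' with
  | monomial α c =>
    induction q using MvPolynomial.induction_on' with
    | monomial β e =>
      rw [MvPolynomial.monomial_mul, opAct_monomial, opAct_monomial, opAct_monomial,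
        smul_mul_smul_comm, ← multiD_add]
      rfl
    | add q r hq hr => rw [mul_add, opAct_add, opAct_add, mul_add, hq, hr]
  | add p r hp hr => rw [add_mul, opAct_add, opAct_add, add_mul, hp, hr]

/-! ### Polynomial functions -/

/-- The coordinate functions. -/
def coordFun (i : Fin d) : Smooth d :=
  ⟨fun x => (x i : ℂ), show ContDiff ℝ ∞ fun x : Fin d → ℝ => (x i : ℂ) from
    Complex.ofRealCLM.contDiff.comp (contDiff_apply ℝ ℝ i)⟩

/-- Polynomials as smooth functions. -/
def polyFun : DiffOp d →ₐ[ℂ] Smooth d := MvPolynomial.aeval coordFun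

theorem partialD_mul (i : Fin d) (f g : Smooth d) :
    partialD i (f * g) = partialD i f * g + f * partialD i g := by
  refine Subtype.ext (funext fun x => ?_)
  have hf : DifferentiableAt ℝ f.1 x := f.contDiff.differentiable (by simp) x
  have hg : DifferentiableAt ℝ g.1 x := g.contDiff.differentiable (by simp) x
  change fderiv ℝ (f.1 * g.1) x _ = fderiv ℝ f.1 x _ * g.1 x + f.1 x * fderiv ℝ g.1 x _
  rw [fderiv_mul hf hg]
  simp only [add_apply, smul_apply, smul_eq_mul]
  ring

theorem partialD_coordFun (i j : Fin d) :
    partialD i (coordFun j) = if i = j then 1 else 0 := by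
  refine Subtype.ext (funext fun x => ?_)
  have h : (coordFun j).1 = ⇑(Complex.ofRealCLM ∘L ContinuousLinearMap.proj (R := ℝ) j) := rfl
  rw [partialD_apply, h, ContinuousLinearMap.fderiv]
  rw [ContinuousLinearMap.comp_apply, ContinuousLinearMap.proj_apply, Pi.single_apply]
  by_cases hij : i = j
  · rw [if_pos hij, if_pos hij.symm]
    simp
  · rw [if_neg hij, if_neg (Ne.symm hij)]
    simp

theorem partialD_polyFun (i : Fin d) (p : DiffOp d) :
    partialD i (polyFun p) = polyFun (MvPolynomial.pderiv i p) := by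
  induction p using MvPolynomial.induction_on with
  | C a =>
    rw [MvPolynomial.pderiv_C, map_zero, ← MvPolynomial.algebraMap_eq, AlgHom.commutes]
    refine Subtype.ext (funext fun x => ?_)
    change fderiv ℝ (fun _ => a) x _ = 0
    simp
  | add p q hp hq => simp only [map_add, hp, hq]
  | mul_X p j hp =>
    rw [map_mul, partialD_mul, hp, Derivation.leibniz, map_add, smul_eq_mul, smul_eq_mul, map_mul,
      map_mul, MvPolynomial.pderiv_X, polyFun, MvPolynomial.aeval_X, partialD_coordFun]
    rw [Pi.single_apply]
    by_cases hij : i = j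
    · subst hij
      simp only [if_true, map_one]
      ring
    · rw [if_neg hij, if_neg (Ne.symm hij), map_zero]
      ring

/-- Iterated formal derivatives of a polynomial. -/
def polyD (l : List (Fin d)) (α : Fin d → ℕ) : Module.End ℂ (DiffOp d) :=
  (l.map fun i => ((MvPolynomial.pderiv i : Derivation ℂ (DiffOp d) (DiffOp d)) :
    Module.End ℂ (DiffOp d)) ^ α i).prod

theorem polyD_cons (i : Fin d) (l : List (Fin d)) (α : Fin d → ℕ) (p : DiffOp d) :
    polyD (i :: l) α p = (((MvPolynomial.pderiv i : Derivation ℂ (DiffOp d) (DiffOp d)) :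
      Module.End ℂ (DiffOp d)) ^ α i) (polyD l α p) := by
  rw [polyD, List.map_cons, List.prod_cons]
  rfl

theorem partialD_pow_polyFun (i : Fin d) (n : ℕ) (p : DiffOp d) :
    (partialD i ^ n) (polyFun p) =
      polyFun ((((MvPolynomial.pderiv i : Derivation ℂ (DiffOp d) (DiffOp d)) :
        Module.End ℂ (DiffOp d)) ^ n) p) := by
  induction n with
  | zero => simp
  | succ n ih =>
    rw [pow_succ', pow_succ', Module.End.mul_apply, ih, partialD_polyFun]
    rfl

theorem multiD_polyFun (α : Fin d → ℕ) (p : DiffOp d) :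
    multiD α (polyFun p) = polyFun (polyD (List.finRange d) α p) := by
  unfold multiD
  induction List.finRange d with
  | nil => simp [polyD]
  | cons i l ih =>
    rw [List.map_cons, List.prod_cons, Module.End.mul_apply, ih, partialD_pow_polyFun, polyD_cons]

theorem coeff_pderiv_pow (i : Fin d) (n : ℕ) (p : DiffOp d) (γ : Fin d →₀ ℕ) :
    ((((MvPolynomial.pderiv i : Derivation ℂ (DiffOp d) (DiffOp d)) :
      Module.End ℂ (DiffOp d)) ^ n) p).coeff γ =
      ((γ i + n).descFactorial n : ℂ) * p.coeff (γ + Finsupp.single i n) := by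
  induction n generalizing γ with
  | zero => simp
  | succ n ih =>
    rw [pow_succ', Module.End.mul_apply]
    change MvPolynomial.coeff γ (MvPolynomial.pderiv i _) = _
    rw [MvPolynomial.coeff_pderiv, ih, add_assoc, ← Finsupp.single_add, add_comm 1 n]
    have h : (γ + Finsupp.single i 1 : Fin d →₀ ℕ) i + n = γ i + (n + 1) := by
      rw [Finsupp.add_apply, Finsupp.single_eq_same]
      ring
    rw [h, Nat.descFactorial_succ]
    have h2 : γ i + (n + 1) - n = γ i + 1 := by omega
    rw [h2]
    push_cast
    ring

theorem coeff_polyD {l : List (Fin d)} (hl : l.Nodup) (α : Fin d → ℕ) (p : DiffOp d)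
    (γ : Fin d →₀ ℕ) : (polyD l α p).coeff γ =
      (l.map fun i => ((γ i + α i).descFactorial (α i) : ℂ)).prod *
        p.coeff (γ + (l.map fun i => Finsupp.single i (α i)).sum) := by
  induction l generalizing γ with
  | nil => simp [polyD]
  | cons i l ih =>
    rw [List.nodup_cons] at hl
    rw [polyD_cons, coeff_pderiv_pow, ih hl.2, List.map_cons, List.prod_cons, List.map_cons,
      List.sum_cons, mul_assoc, add_assoc]
    congr 3
    refine List.map_congr_left fun j hj => ?_
    have : j ≠ i := fun h => hl.1 (h ▸ hj)
    rw [Finsupp.add_apply, Finsupp.single_eq_of_ne this, add_zero]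

theorem coeff_zero_polyD (α : Fin d →₀ ℕ) (p : DiffOp d) :
    (polyD (List.finRange d) α p).coeff 0 = (∏ i, ((α i).factorial : ℂ)) * p.coeff α := by
  rw [coeff_polyD (List.nodup_finRange d)]
  congr 1
  · simp only [Finsupp.coe_zero, Pi.zero_apply, zero_add, Nat.descFactorial_self]
    rw [← List.ofFn_eq_map, List.prod_ofFn]
  · rw [← List.ofFn_eq_map, List.sum_ofFn, zero_add, Finsupp.univ_sum_single]

theorem polyFun_apply_zero (p : DiffOp d) : (polyFun p).1 0 = p.coeff 0 := by
  induction p using MvPolynomial.induction_on with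
  | C a =>
    rw [← MvPolynomial.algebraMap_eq, AlgHom.commutes, MvPolynomial.algebraMap_eq]
    simp
  | add p q hp hq =>
    rw [map_add, MvPolynomial.coeff_add, ← hp, ← hq]
    rfl
  | mul_X p i hp =>
    rw [map_mul, polyFun, MvPolynomial.aeval_X]
    change _ * (((0 : Fin d → ℝ) i : ℝ) : ℂ) = _
    simp [← MvPolynomial.constantCoeff_eq]

theorem multiD_polyFun_zero (α : Fin d →₀ ℕ) (p : DiffOp d) :
    (multiD (fun i => α i) (polyFun p)).1 0 = (∏ i, ((α i).factorial : ℂ)) * p.coeff α := by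
  rw [multiD_polyFun, polyFun_apply_zero, coeff_zero_polyD]

theorem prod_factorial_ne_zero (α : Fin d → ℕ) : (∏ i, ((α i).factorial : ℂ)) ≠ 0 :=
  Finset.prod_ne_zero_iff.2 fun _ _ => Nat.cast_ne_zero.2 (Nat.factorial_ne_zero _)

theorem opAct_polyFun_mem_range (p q : DiffOp d) : opAct p (polyFun q) ∈ polyFun.range := by
  rw [opAct, LinearMap.sum_apply]
  refine sum_mem fun α _ => ?_
  rw [LinearMap.smul_apply, multiD_polyFun]
  exact Subalgebra.smul_mem _ (AlgHom.mem_range_self _ _) _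

/-! ### Annihilators of spaces of solutions -/

/-- The value at the origin of `∑ i, v i (∂) φ i`. -/
def pairing {m : ℕ} (φ : Fin m → Smooth d) : (Fin m → DiffOp d) →ₗ[ℂ] ℂ where
  toFun v := ∑ i, (opAct (v i) (φ i)).1 0
  map_add' v w := by
    rw [← Finset.sum_add_distrib]
    refine Finset.sum_congr rfl fun i _ => ?_
    rw [Pi.add_apply, opAct_add]
    rfl
  map_smul' c v := by
    rw [RingHom.id_apply, Finset.smul_sum]
    refine Finset.sum_congr rfl fun i _ => ?_
    rw [Pi.smul_apply, opAct_smul]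
    rfl

theorem pairing_apply {m : ℕ} (φ : Fin m → Smooth d) (v : Fin m → DiffOp d) :
    pairing φ v = ∑ i, (opAct (v i) (φ i)).1 0 := rfl

/-- The operators whose values at the origin vanish on a space of functions. -/
def jetAnn {m : ℕ} (S : Submodule ℂ (Fin m → Smooth d)) : Submodule ℂ (Fin m → DiffOp d) where
  carrier := {v | ∀ φ ∈ S, pairing φ v = 0}
  zero_mem' := fun _ _ => map_zero _
  add_mem' := fun ha hb φ h => by rw [map_add, ha φ h, hb φ h, add_zero]
  smul_mem' := fun c _ ha φ h => by rw [map_smul, ha φ h, smul_zero]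

theorem evalZero_sum {ι : Type*} (s : Finset ι) (f : ι → Smooth d) :
    (∑ i ∈ s, f i).1 0 = ∑ i ∈ s, (f i).1 0 := by
  rw [AddSubmonoidClass.coe_finsetSum, Finset.sum_apply]

/-- Adjointness of a matrix of operators and its transpose. -/
theorem pairing_transpose_mulVec {p q : ℕ} (A : Matrix (Fin p) (Fin q) (DiffOp d))
    (w : Fin p → DiffOp d) (φ : Fin q → Smooth d) :
    pairing φ (A.transpose.mulVec w) = pairing (fun a => ∑ i, opAct (A a i) (φ i)) w := by
  rw [pairing_apply, pairing_apply]
  simp only [Matrix.mulVec, dotProduct, opAct_sum, map_sum, LinearMap.sum_apply, evalZero_sum,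
    Matrix.transpose_apply]
  rw [Finset.sum_comm]
  refine Finset.sum_congr rfl fun a _ => Finset.sum_congr rfl fun i _ => ?_
  rw [mul_comm, opAct_mul]
  rfl

theorem opAct_polyFun_zero (p q : DiffOp d) :
    (opAct p (polyFun q)).1 0 = ∑ α ∈ p.support, p.coeff α * ((∏ i, ((α i).factorial : ℂ)) *
      q.coeff α) := by
  rw [opAct, LinearMap.sum_apply, evalZero_sum]
  refine Finset.sum_congr rfl fun α _ => ?_
  rw [← multiD_polyFun_zero]
  rfl

theorem opAct_monomial_polyFun_zero (α : Fin d →₀ ℕ) (q : DiffOp d) :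
    (opAct (MvPolynomial.monomial α 1) (polyFun q)).1 0 = (∏ i, ((α i).factorial : ℂ)) *
      q.coeff α := by
  rw [opAct_monomial, one_smul, multiD_polyFun_zero]

/-- A polynomial is determined by its derivatives at the origin. A general smooth function is not,
which is why the separating solutions are constructed as polynomials. -/
theorem polyFun_eq_zero {f : Smooth d} (hf : f ∈ (polyFun (d := d)).range)
    (h : ∀ p : DiffOp d, (opAct p f).1 0 = 0) : f = 0 := by
  obtain ⟨q, rfl⟩ := hf
  have : q = 0 := by
    ext α
    have h1 := h (MvPolynomial.monomial α 1)
    change (opAct (MvPolynomial.monomial α 1) (polyFun q)).1 0 = 0 at h1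
    rw [opAct_monomial_polyFun_zero] at h1
    exact (mul_eq_zero.1 h1).resolve_left (prod_factorial_ne_zero _)
  rw [this]
  exact map_zero polyFun

theorem eq_zero_of_opAct_zero {p : DiffOp d} (h : ∀ ε : Smooth d, (opAct p ε).1 0 = 0) :
    p = 0 := by
  ext α
  have h1 := h (polyFun (MvPolynomial.monomial α 1))
  rw [opAct_polyFun_zero, Finset.sum_eq_single α] at h1
  · rw [MvPolynomial.coeff_monomial, if_pos rfl, mul_one] at h1
    exact (mul_eq_zero.1 h1).resolve_right (prod_factorial_ne_zero _)
  · intro β _ hβ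
    rw [MvPolynomial.coeff_monomial, if_neg (Ne.symm hβ), mul_zero, mul_zero]
  · intro hα
    rw [MvPolynomial.notMem_support_iff.1 hα, zero_mul]

/-- A functional of finite degree is represented by a polynomial field. -/
theorem exists_pairing_eq {m : ℕ} (deg : Fin m → ℤ) (D : ℤ) (f : (Fin m → DiffOp d) →ₗ[ℂ] ℂ) :
    ∃ q : Fin m → DiffOp d, pairing (fun i => polyFun (q i)) = f ∘ₗ gcomp deg D := by
  -- The coefficients are the values of `f` on the monomial basis. The factor 1/α! cancels the α!
  -- produced by applying ∂^α and evaluating at the origin.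
  refine ⟨fun i => ∑ α ∈ exponents d (D - deg i), MvPolynomial.monomial α
    ((∏ j, ((α j).factorial : ℂ))⁻¹ * f (Pi.single i (MvPolynomial.monomial α 1))), ?_⟩
  refine LinearMap.pi_ext' fun i => (MvPolynomial.basisMonomials (Fin d) ℂ).ext fun α => ?_
  rw [MvPolynomial.coe_basisMonomials]
  simp only [LinearMap.comp_apply, LinearMap.single_apply]
  rw [pairing_apply, Finset.sum_eq_single i]
  · rw [Pi.single_eq_same, opAct_monomial_polyFun_zero, MvPolynomial.coeff_sum]
    simp only [MvPolynomial.coeff_monomial, Finset.sum_ite_eq', mem_exponents]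
    have hmem : (Pi.single i (MvPolynomial.monomial α (1 : ℂ)) : Fin m → DiffOp d) ∈
        gradedPiece deg (α.degree + deg i) := by
      intro j
      by_cases hj : j = i
      · subst hj
        rw [Pi.single_eq_same, add_sub_cancel_right]
        exact isHomog_monomial α 1
      · rw [Pi.single_eq_of_ne hj]
        exact IsHomog.zero _
    split_ifs with h
    · rw [mul_inv_cancel_left₀ (prod_factorial_ne_zero _), gcomp_eq_self]
      rwa [h, sub_add_cancel] at hmem
    · rw [mul_zero, gcomp_of_ne hmem (by omega), map_zero]
  · intro j _ hj
    rw [Pi.single_eq_of_ne hj, opAct_zero]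
    rfl
  · simp

section

variable {n m : ℕ} {T : Matrix (Fin n) (Fin m) (DiffOp d)} {k : Fin n → ℤ} {θ : Fin m → ℤ}

theorem mem_solutions {φ : Fin m → Smooth d} :
    φ ∈ solutions T ↔ ∀ a, ∑ i, opAct (T a i) (φ i) = 0 := by
  rw [solutions, Submodule.mem_iInf]
  refine forall_congr' fun a => ?_
  rw [LinearMap.mem_ker, LinearMap.sum_apply]
  rfl

/-- If `v` were outside the row module, so would be one of its components, by homogeneity. A
functional on that degree separating it from the row module is the pairing with a polynomial field;
since this field annihilates all rows, it is a solution, and it does not pair to zero with `v`. -/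
theorem jetAnn_solutions (hT : IsHomogMatrix T k θ) :
    jetAnn (solutions T) = (solutionAnn T).restrictScalars ℂ := by
  apply le_antisymm
  · intro v hv
    by_contra hvV
    have hV := isHomogSub_solutionAnn hT
    have hD : ∃ D, gcomp θ D v ∉ solutionAnn T := by
      by_contra! h
      refine hvV ?_
      change v ∈ solutionAnn T
      rw [← sum_gcomp θ v]
      exact Submodule.sum_mem _ fun D _ => h D
    obtain ⟨D, hD⟩ := hD
    obtain ⟨f, hf, hfV⟩ := Submodule.exists_le_ker_of_notMem
      (p := subPiece θ (solutionAnn T) D) (fun h => hD h.1)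
    obtain ⟨q, hq⟩ := exists_pairing_eq θ D f
    have hVf : ∀ w ∈ solutionAnn T, pairing (fun i => polyFun (q i)) w = 0 := by
      intro w hw
      rw [hq]
      exact hfV ⟨hV w hw D, gcomp_mem _ _ _⟩
    -- The row module contains `p` times each row of `T`, so every derivative at 0 of the left side
    -- of every equation vanishes. The left side is polynomial, hence zero.
    have hsol : (fun i => polyFun (q i)) ∈ solutions T := by
      rw [mem_solutions]
      intro a
      refine polyFun_eq_zero (sum_mem fun i _ => opAct_polyFun_mem_range _ _) fun p => ?_
      have h1 := hVf (T.transpose.mulVec (Pi.single a p)) ⟨_, rfl⟩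
      rw [pairing_transpose_mulVec, pairing_apply, Finset.sum_eq_single a] at h1
      · rwa [Pi.single_eq_same] at h1
      · intro b _ hb
        rw [Pi.single_eq_of_ne hb, opAct_zero]
        rfl
      · simp
    have := hv _ hsol
    rw [hq] at this
    exact hf this
  · rintro _ ⟨w, rfl⟩ φ hφ
    rw [mem_solutions] at hφ
    rw [Matrix.mulVecLin_apply, pairing_transpose_mulVec, pairing_apply]
    refine Finset.sum_eq_zero fun a _ => ?_
    rw [hφ a, map_zero]
    rfl

/-- The composite operators are the entries of `T.mulVec R`, and an operator that kills all smooth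
functions is zero, as monomials detect its coefficients. -/
theorem isGaugeSymmetry_iff {R : Fin m → DiffOp d} :
    IsGaugeSymmetry T R ↔ T.mulVec R = 0 := by
  have h : ∀ (ε : Smooth d) a, ∑ i, opAct (T a i) (opAct (R i) ε) = opAct (T.mulVec R a) ε := by
    intro ε a
    rw [Matrix.mulVec, dotProduct, opAct_sum, LinearMap.sum_apply]
    refine Finset.sum_congr rfl fun i _ => ?_
    rw [opAct_mul]
    rfl
  constructor
  · intro hR
    funext a
    refine eq_zero_of_opAct_zero fun ε => ?_
    rw [← h, mem_solutions.1 (hR ε) a]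
    rfl
  · intro hR ε
    rw [mem_solutions]
    intro a
    rw [h, hR, Pi.zero_apply, opAct_zero]
    rfl

/-- Every gauge symmetry is a combination of the columns of `map0`. Pairing with R(∂)ε is the value
at 0 of the operator v · R applied to `ε`, so `v` annihilates all these fields exactly when v · R =
0 for the generating columns. -/
theorem jetAnn_trivialSolutions (G : GaugeStructure T k θ) :
    jetAnn (trivialSolutions T) = (trivialAnn G).restrictScalars ℂ := by
  ext v
  constructor
  · intro hv
    change G.sym.map0.transpose.mulVec v = 0
    funext α
    refine eq_zero_of_opAct_zero fun ε => ?_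
    have hR : IsGaugeSymmetry T (fun i => G.sym.map0 i α) := by
      rw [isGaugeSymmetry_iff]
      have h1 : G.sym.map0.mulVecLin (Pi.single α 1) ∈ LinearMap.ker T.mulVecLin :=
        G.sym.exact0 ▸ ⟨_, rfl⟩
      rw [LinearMap.mem_ker, Matrix.mulVecLin_apply, Matrix.mulVecLin_apply,
        Matrix.mulVec_single_one] at h1
      exact h1
    have h1 := hv _ (Submodule.subset_span ⟨_, hR, ε, rfl⟩)
    rw [pairing_apply] at h1
    rw [Matrix.mulVec, dotProduct, opAct_sum, LinearMap.sum_apply, evalZero_sum, ← h1]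
    refine Finset.sum_congr rfl fun i _ => ?_
    rw [Matrix.transpose_apply, mul_comm, opAct_mul]
    rfl
  · intro hv φ hφ
    have hv' : G.sym.map0.transpose.mulVec v = 0 := hv
    refine Submodule.span_induction (p := fun φ _ => pairing φ v = 0) ?_ ?_ ?_ ?_ hφ
    · rintro _ ⟨R, hR, ε, rfl⟩
      rw [isGaugeSymmetry_iff] at hR
      obtain ⟨z, rfl⟩ : R ∈ LinearMap.range G.sym.map0.mulVecLin := G.sym.exact0 ▸ hR
      have h1 : v ⬝ᵥ G.sym.map0.mulVec z = 0 := by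
        rw [Matrix.dotProduct_mulVec, ← Matrix.mulVec_transpose, hv', zero_dotProduct]
      have h2 : pairing (fun i => opAct (G.sym.map0.mulVecLin z i) ε) v =
          (opAct (v ⬝ᵥ G.sym.map0.mulVec z) ε).1 0 := by
        rw [pairing_apply, dotProduct, opAct_sum, LinearMap.sum_apply, evalZero_sum]
        refine Finset.sum_congr rfl fun i _ => ?_
        rw [opAct_mul]
        rfl
      rw [h2, h1, opAct_zero]
      rfl
    · rw [pairing_apply]
      refine Finset.sum_eq_zero fun i _ => ?_
      rw [Pi.zero_apply, map_zero]
      rfl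
    · intro φ ψ _ _ h1 h2
      rw [pairing_apply] at *
      simp only [Pi.add_apply, map_add]
      rw [← add_zero (0 : ℂ)]
      nth_rewrite 1 [← h1]
      rw [← h2, ← Finset.sum_add_distrib]
      rfl
    · intro c φ _ h1
      rw [pairing_apply] at *
      simp only [Pi.smul_apply, map_smul]
      calc _ = c * ∑ i, (opAct (v i) (φ i)).1 0 := by
            rw [Finset.mul_sum]
            rfl
        _ = 0 := by rw [h1, mul_zero]

end

/-! ### Dimensions of spaces of jets -/

/-- Vectors of operators of order at most `N`. -/
def orderLE (d m N : ℕ) : Submodule ℂ (Fin m → DiffOp d) where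
  carrier := {v | ∀ i, ∀ α : Fin d →₀ ℕ, N < α.degree → (v i).coeff α = 0}
  zero_mem' := fun _ _ _ => rfl
  add_mem' := fun ha hb i α h => by
    rw [Pi.add_apply, MvPolynomial.coeff_add, ha i α h, hb i α h, add_zero]
  smul_mem' := fun c _ ha i α h => by
    rw [Pi.smul_apply, MvPolynomial.coeff_smul, ha i α h, smul_zero]

/-- The multi-indices occurring in the Taylor polynomial. -/
def multiIndices (d N : ℕ) : Finset (Fin d → ℕ) :=
  (Fintype.piFinset fun _ : Fin d => Finset.range (N + 1)).filter fun α => ∑ i, α i ≤ N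

theorem mem_multiIndices {N : ℕ} {α : Fin d → ℕ} : α ∈ multiIndices d N ↔ ∑ i, α i ≤ N := by
  rw [multiIndices, Finset.mem_filter, Fintype.mem_piFinset, and_iff_right_iff_imp]
  intro h i
  rw [Finset.mem_range]
  have := Finset.single_le_sum (f := α) (fun _ _ => Nat.zero_le _) (Finset.mem_univ i)
  omega

/-- Vectors of polynomials with given coefficients. -/
def ofCoeffs (d m N : ℕ) : (Fin m × multiIndices d N → ℂ) →ₗ[ℂ] (Fin m → DiffOp d) where
  toFun c i := ∑ α : multiIndices d N,
    MvPolynomial.monomial (Finsupp.equivFunOnFinite.symm α.1) (c (i, α))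
  map_add' c e := by
    funext i
    rw [Pi.add_apply, ← Finset.sum_add_distrib]
    exact Finset.sum_congr rfl fun α _ => by rw [Pi.add_apply, map_add]
  map_smul' r c := by
    funext i
    rw [RingHom.id_apply, Pi.smul_apply, Finset.smul_sum]
    exact Finset.sum_congr rfl fun α _ => by rw [Pi.smul_apply, map_smul]

theorem coeff_ofCoeffs {m N : ℕ} (c : Fin m × multiIndices d N → ℂ) (i : Fin m)
    (α : multiIndices d N) :
    (ofCoeffs d m N c i).coeff (Finsupp.equivFunOnFinite.symm α.1) = c (i, α) := by
  change MvPolynomial.coeff _ (∑ β : multiIndices d N, _) = _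
  rw [MvPolynomial.coeff_sum, Finset.sum_eq_single α]
  · rw [MvPolynomial.coeff_monomial, if_pos rfl]
  · intro β _ hβ
    rw [MvPolynomial.coeff_monomial, if_neg]
    exact fun h => hβ (Subtype.ext (Finsupp.equivFunOnFinite.symm.injective h))
  · simp

theorem ofCoeffs_injective (d m N : ℕ) : Function.Injective (ofCoeffs d m N) := by
  intro c e h
  funext x
  rw [← coeff_ofCoeffs c x.1 x.2, h, coeff_ofCoeffs]

theorem range_ofCoeffs (d m N : ℕ) : LinearMap.range (ofCoeffs d m N) = orderLE d m N := by
  apply le_antisymm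
  · rintro _ ⟨c, rfl⟩ i α hα
    change MvPolynomial.coeff _ (∑ β : multiIndices d N, _) = _
    rw [MvPolynomial.coeff_sum]
    refine Finset.sum_eq_zero fun β _ => ?_
    rw [MvPolynomial.coeff_monomial, if_neg]
    rintro rfl
    rw [Finsupp.degree_eq_sum] at hα
    exact absurd (mem_multiIndices.1 β.2) (not_le.2 hα)
  · intro v hv
    refine ⟨fun x => (v x.1).coeff (Finsupp.equivFunOnFinite.symm x.2.1), ?_⟩
    funext i
    ext α
    by_cases hα : α.degree ≤ N
    · have hm : ⇑α ∈ multiIndices d N := by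
        rwa [mem_multiIndices, ← Finsupp.degree_eq_sum]
      have := coeff_ofCoeffs (fun x : Fin m × multiIndices d N =>
        (v x.1).coeff (Finsupp.equivFunOnFinite.symm x.2.1)) i ⟨⇑α, hm⟩
      simpa using this
    · rw [hv i α (by omega)]
      change MvPolynomial.coeff _ (∑ β : multiIndices d N, _) = _
      rw [MvPolynomial.coeff_sum]
      refine Finset.sum_eq_zero fun β _ => ?_
      rw [MvPolynomial.coeff_monomial, if_neg]
      rintro rfl
      rw [Finsupp.degree_eq_sum] at hα
      exact hα (mem_multiIndices.1 β.2)

/-- The derivatives at the origin up to order `N`. -/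
def jet (d m N : ℕ) : (Fin m → Smooth d) →ₗ[ℂ] (Fin m × multiIndices d N → ℂ) where
  toFun φ x := (multiD x.2.1 (φ x.1)).1 0
  map_add' φ ψ := by
    funext x
    rw [Pi.add_apply, map_add]
    rfl
  map_smul' c φ := by
    funext x
    rw [Pi.smul_apply, map_smul]
    rfl

theorem pairing_ofCoeffs {m N : ℕ} (φ : Fin m → Smooth d) (c : Fin m × multiIndices d N → ℂ) :
    pairing φ (ofCoeffs d m N c) = c ⬝ᵥ jet d m N φ := by
  rw [pairing_apply, dotProduct, Fintype.sum_prod_type]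
  refine Finset.sum_congr rfl fun i _ => ?_
  change (opAct (∑ β : multiIndices d N, _) (φ i)).1 0 = _
  rw [opAct_sum, LinearMap.sum_apply, evalZero_sum]
  refine Finset.sum_congr rfl fun α _ => ?_
  rw [opAct_monomial]
  rfl

/-- Taylor coefficients are derivatives at the origin rescaled by nonzero factorials, which does not
change dimensions. -/
theorem jetDim_eq_finrank_map_jet {m : ℕ} (S : Submodule ℂ (Fin m → Smooth d)) (N : ℕ) :
    jetDim S N = Module.finrank ℂ (S.map (jet d m N)) := by
  let r : (Fin m × multiIndices d N → ℂ) →ₗ[ℂ] (Fin m × multiIndices d N → ℂ) :=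
    LinearMap.pi fun x => ((∏ i, ((x.2.1 i).factorial : ℂ))⁻¹) • LinearMap.proj x
  have hr : Function.Injective r := by
    intro c e h
    funext x
    have := congrFun h x
    exact mul_left_cancel₀ (inv_ne_zero (prod_factorial_ne_zero x.2.1)) this
  have h1 : LinearMap.compLeft (taylor d N) (Fin m) = ofCoeffs d m N ∘ₗ r ∘ₗ jet d m N := by
    refine LinearMap.ext fun φ => funext fun i => ?_
    exact (Finset.sum_coe_sort (multiIndices d N) fun α =>
      (MvPolynomial.monomial (Finsupp.equivFunOnFinite.symm α)
        ((∏ i, ((α i).factorial : ℂ))⁻¹ * (multiD α (φ i)).1 0) : DiffOp d)).symm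
  rw [jetDim, h1, Submodule.map_comp, Submodule.map_comp]
  have hfin : FiniteDimensional ℂ (S.map (jet d m N)) :=
    FiniteDimensional.finiteDimensional_submodule _
  have h2 := finrank_eq_map_add_inf_ker (ofCoeffs d m N ∘ₗ r) (S.map (jet d m N))
  rw [LinearMap.ker_eq_bot.2 (((ofCoeffs_injective d m N).comp hr :
    Function.Injective (ofCoeffs d m N ∘ₗ r))), inf_bot_eq, finrank_bot, add_zero,
    Submodule.map_comp] at h2
  exact h2.symm

theorem finrank_add_finrank_orthogonal_dotProduct {K : Type*} [Fintype K]
    (X : Submodule ℂ (K → ℂ)) (Y : Submodule ℂ (K → ℂ))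
    (hY : ∀ c, c ∈ Y ↔ ∀ x ∈ X, c ⬝ᵥ x = 0) :
    Module.finrank ℂ X + Module.finrank ℂ Y = Fintype.card K := by
  classical
  have h1 := Subspace.finrank_add_finrank_dualAnnihilator_eq X
  rw [Module.finrank_fintype_fun_eq_card] at h1
  rw [← h1]
  congr 1
  have h2 : Y.map (dotProductEquiv ℂ K).toLinearMap = X.dualAnnihilator := by
    ext f
    rw [Submodule.mem_dualAnnihilator]
    constructor
    · rintro ⟨c, hc, rfl⟩ x hx
      exact (hY c).1 hc x hx
    · intro hf
      refine ⟨(dotProductEquiv ℂ K).symm f, (hY _).2 fun x hx => ?_, by simp⟩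
      rw [← hf x hx]
      exact LinearMap.congr_fun ((dotProductEquiv ℂ K).apply_symm_apply f) x
  rw [← h2]
  exact ((dotProductEquiv ℂ K).finrank_map_eq Y).symm

/-- The dimension of the space of jets is complementary to that of its annihilator. -/
theorem jetDim_add_finrank_jetAnn {m : ℕ} (S : Submodule ℂ (Fin m → Smooth d)) (N : ℕ) :
    jetDim S N + Module.finrank ℂ (jetAnn S ⊓ orderLE d m N : Submodule ℂ (Fin m → DiffOp d)) =
      Fintype.card (Fin m × multiIndices d N) := by
  rw [jetDim_eq_finrank_map_jet]
  rw [← finrank_add_finrank_orthogonal_dotProduct (S.map (jet d m N))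
    ((jetAnn S).comap (ofCoeffs d m N))]
  · congr 1
    have h2 := finrank_eq_map_add_inf_ker (ofCoeffs d m N) ((jetAnn S).comap (ofCoeffs d m N))
    rw [LinearMap.ker_eq_bot.2 (ofCoeffs_injective d m N), inf_bot_eq, finrank_bot, add_zero,
      Submodule.map_comap_eq, range_ofCoeffs, inf_comm] at h2
    exact h2.symm
  · intro c
    constructor
    · rintro hc _ ⟨φ, hφ, rfl⟩
      rw [← pairing_ofCoeffs]
      exact hc φ hφ
    · intro hc φ hφ
      rw [pairing_ofCoeffs]
      exact hc _ ⟨φ, hφ, rfl⟩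

/-! ### Decomposition by degree -/

/-- The vectors supported on the basis elements of degree at least `t`. -/
def degreeGE (d : ℕ) {q : ℕ} (deg : Fin q → ℤ) (t : ℤ) :
    Submodule (DiffOp d) (Fin q → DiffOp d) where
  carrier := {v | ∀ i, deg i < t → v i = 0}
  zero_mem' := fun _ _ => rfl
  add_mem' := fun ha hb i h => by rw [Pi.add_apply, ha i h, hb i h, add_zero]
  smul_mem' := fun c _ ha i h => by rw [Pi.smul_apply, ha i h, smul_zero]

theorem isHomogSub_degreeGE {q : ℕ} (deg : Fin q → ℤ) (t : ℤ) :
    IsHomogSub deg (degreeGE d deg t) := fun v hv D i hi => by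
  rw [gcomp_apply, hv i hi, map_zero]

/-- In total degree `D` the entry at `i` is homogeneous of degree `D - deg i`, so the bound `N` on
the order says exactly that the entries with `deg i < D - N` vanish. This translates the filtration
by order into the grading. -/
theorem mem_degreeGE_iff_of_mem_gradedPiece {q N : ℕ} {deg : Fin q → ℤ} {D : ℤ}
    {v : Fin q → DiffOp d} (hv : v ∈ gradedPiece deg D) :
    v ∈ degreeGE d deg (D - N) ↔ v ∈ orderLE d q N := by
  constructor
  · intro h i α hα
    by_cases hi : deg i < D - N
    · rw [h i hi]
      rfl
    · exact isHomog_iff.1 (hv i) α (by omega)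
  · intro h i hi
    ext α
    by_cases hα : (α.degree : ℤ) = D - deg i
    · exact h i α (by omega)
    · exact isHomog_iff.1 (hv i) α hα

theorem finrank_inf_orderLE {q : ℕ} {deg : Fin q → ℤ}
    {U : Submodule (DiffOp d) (Fin q → DiffOp d)} (hU : IsHomogSub deg U) (N : ℕ)
    {s : Finset ℤ} (hs : ∀ i : Fin q, ∀ e : ℕ, e ≤ N → (e : ℤ) + deg i ∈ s) :
    Module.finrank ℂ (U.restrictScalars ℂ ⊓ orderLE d q N : Submodule ℂ (Fin q → DiffOp d)) =
      ∑ D ∈ s, HF deg (U ⊓ degreeGE d deg (D - N)) D := by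
  have hcomp : ∀ v ∈ orderLE d q N, ∀ D, gcomp deg D v ∈ orderLE d q N := by
    intro v hv D i α hα
    rw [gcomp_apply, coeff_hcomp, hv i α hα, ite_self]
  let Φ : (U.restrictScalars ℂ ⊓ orderLE d q N : Submodule ℂ (Fin q → DiffOp d)) ≃ₗ[ℂ]
      ((D : s) → subPiece deg (U ⊓ degreeGE d deg (D - N)) D) :=
    { toFun := fun v D => ⟨gcomp deg D v.1, ⟨hU _ v.2.1 D,
        (mem_degreeGE_iff_of_mem_gradedPiece (gcomp_mem _ _ _)).2 (hcomp _ v.2.2 D)⟩,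
        gcomp_mem _ _ _⟩
      map_add' := fun v w => by
        funext D
        exact Subtype.ext (map_add (gcomp deg D) v.1 w.1)
      map_smul' := fun c v => by
        funext D
        exact Subtype.ext (map_smul (gcomp deg D) c v.1)
      invFun := fun w => ⟨∑ D : s, (w D).1, Submodule.sum_mem _ fun D _ => ⟨(w D).2.1.1,
        (mem_degreeGE_iff_of_mem_gradedPiece (w D).2.2).1 (w D).2.1.2⟩⟩
      left_inv := fun v => by
        apply Subtype.ext
        change ∑ D : s, gcomp deg D v.1 = v.1
        rw [Finset.sum_coe_sort s fun D => gcomp deg D v.1]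
        refine sum_gcomp_of_subset deg v.1 fun D hD => ?_
        rw [degreeSet, Finset.mem_biUnion] at hD
        obtain ⟨i, _, hD⟩ := hD
        obtain ⟨α, hα, rfl⟩ := Finset.mem_image.1 hD
        refine hs i _ ?_
        by_contra h
        exact MvPolynomial.mem_support_iff.1 hα (v.2.2 i α (by omega))
      right_inv := fun w => by
        funext E
        apply Subtype.ext
        change gcomp deg E (∑ D : s, (w D).1) = (w E).1
        rw [map_sum, Finset.sum_eq_single E]
        · exact gcomp_eq_self (w E).2.2
        · intro D _ hD
          exact gcomp_of_ne (w D).2.2 fun h => hD (Subtype.ext h.symm)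
        · simp }
  rw [Φ.finrank_eq, Module.finrank_pi_fintype]
  exact Finset.sum_coe_sort s fun D => HF deg (U ⊓ degreeGE d deg (D - N)) D

theorem degreeGE_eq_top {q : ℕ} {deg : Fin q → ℤ} {t : ℤ} (h : ∀ i, t ≤ deg i) :
    degreeGE d deg t = ⊤ :=
  eq_top_iff.2 fun _ _ i hi => absurd (h i) (not_le.2 hi)

section

variable {n m : ℕ} {T : Matrix (Fin n) (Fin m) (DiffOp d)} {k : Fin n → ℤ} {θ : Fin m → ℤ}

/-- The annihilators are decomposed by degree. In degrees `D ≤ N` the bound on the order is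
automatic as all `θ i` are positive. In degree `N + 1 + t` it retains only the entries with `θ i ≥ t
+ 1`, and nothing remains for `t ≥ B`. -/
theorem jetDim_sub_jetDim (hT : IsHomogMatrix T k θ) (G : GaugeStructure T k θ)
    (hpos : ∀ i, 0 < θ i) {B : ℕ} (hB : ∀ i, θ i ≤ B) (N : ℕ) :
    (jetDim (solutions T) N : ℝ) - jetDim (trivialSolutions T) N =
      ∑ D ∈ Finset.range (N + 1), HFsub θ (trivialAnn G) (solutionAnn T) D +
        ∑ t ∈ Finset.range B, HFsub θ (trivialAnn G ⊓ degreeGE d θ (t + 1))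
          (solutionAnn T ⊓ degreeGE d θ (t + 1)) ((N + 1 + t : ℕ) : ℤ) := by
  have hs : ∀ i : Fin m, ∀ e : ℕ, e ≤ N →
      (e : ℤ) + θ i ∈ (Finset.range (N + 1 + B)).map Nat.castEmbedding := by
    intro i e he
    rw [Finset.mem_map]
    have h1 := hpos i
    have h2 := hB i
    refine ⟨(e + θ i).toNat, Finset.mem_range.2 (by omega), ?_⟩
    change (((e + θ i).toNat : ℕ) : ℤ) = _
    omega
  have h1 := jetDim_add_finrank_jetAnn (solutions T) N
  have h2 := jetDim_add_finrank_jetAnn (trivialSolutions T) N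
  rw [jetAnn_solutions hT, finrank_inf_orderLE (isHomogSub_solutionAnn hT) N hs] at h1
  rw [jetAnn_trivialSolutions G, finrank_inf_orderLE (isHomogSub_trivialAnn G) N hs] at h2
  have h3 : (jetDim (solutions T) N : ℝ) - jetDim (trivialSolutions T) N =
      ∑ D ∈ Finset.range (N + 1 + B), HFsub θ (trivialAnn G ⊓ degreeGE d θ ((D : ℤ) - N))
        (solutionAnn T ⊓ degreeGE d θ ((D : ℤ) - N)) D := by
    unfold HFsub
    rw [Finset.sum_sub_distrib, sub_eq_sub_iff_add_eq_add]
    rw [Finset.sum_map] at h1 h2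
    have h4 := h1.trans h2.symm
    have h5 := congrArg (Nat.cast (R := ℝ)) h4
    push_cast at h5
    rw [add_comm (∑ D ∈ _, _)]
    exact h5
  rw [h3, Finset.sum_range_add]
  congr 1
  · refine Finset.sum_congr rfl fun D hD => ?_
    rw [Finset.mem_range] at hD
    rw [degreeGE_eq_top fun i => by have := hpos i; omega, inf_top_eq, inf_top_eq]
  · refine Finset.sum_congr rfl fun t _ => ?_
    rw [show ((N + 1 + t : ℕ) : ℤ) - N = t + 1 by push_cast; ring]

/-- Taking differences in `N`, the first sum leaves one value of the Hilbert function of the torsion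
module. The truncated terms leave one-step differences of torsion quotients with the same
annihilator `f`, which are negligible. -/
theorem negligible_hilbertFn_sub (hd : 2 ≤ d) (hT : IsHomogMatrix T k θ)
    (G : GaugeStructure T k θ) (hpos : ∀ g : Generator G, 0 < g.order) :
    Negligible d fun N => ((hilbertFn (solutions T) N : ℝ) - hilbertFn (trivialSolutions T) N) -
      dof G * binomB d N := by
  have hθ : ∀ i, 0 < θ i := fun i => hpos (.field i)
  obtain ⟨B, hB⟩ : ∃ B : ℕ, ∀ i, θ i ≤ B := by
    refine ⟨∑ i, (θ i).toNat, fun i => ?_⟩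
    have := Finset.single_le_sum (f := fun i => (θ i).toNat) (fun _ _ => Nat.zero_le _)
      (Finset.mem_univ i)
    have h2 := Int.self_le_toNat (θ i)
    omega
  obtain ⟨f, e, hf, hf0, hfU⟩ := exists_smul_trivialAnn_le hT G
  have hu : ∀ t : ℕ, Negligible d fun N =>
      HFsub θ (trivialAnn G ⊓ degreeGE d θ (t + 1)) (solutionAnn T ⊓ degreeGE d θ (t + 1))
        ((N + 1 : ℕ) : ℤ) -
      HFsub θ (trivialAnn G ⊓ degreeGE d θ (t + 1)) (solutionAnn T ⊓ degreeGE d θ (t + 1)) N :=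
    fun t => negligible_HFsub_succ hd
      ((isHomogSub_trivialAnn G).inf (isHomogSub_degreeGE θ _))
      ((isHomogSub_solutionAnn hT).inf (isHomogSub_degreeGE θ _))
      (inf_le_inf_right _ (solutionAnn_le_trivialAnn G)) hf hf0
      fun u hu => ⟨hfU u hu.1, Submodule.smul_mem _ f hu.2⟩
  have h1 := ((negligible_HFsub_sub_dof hd hT G hpos).shift 1).add
    (Negligible.sum (s := Finset.range B) fun t _ => (hu t).shift (1 + t))
  -- The difference of jet dimensions from `N` to `N + 1` is the value of `hilbertFn` at `N + 1`, so
  -- the estimate is moved back by one and used for arguments at least 1.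
  refine (h1.unshift 1).congr ?_
  filter_upwards [eventually_ge_atTop 1] with N hN
  obtain ⟨N, rfl⟩ := Nat.exists_eq_add_of_le' hN
  have h2 := jetDim_sub_jetDim hT G hθ hB N
  have h3 := jetDim_sub_jetDim hT G hθ hB (N + 1)
  rw [Nat.add_sub_cancel, Finset.sum_sub_distrib]
  simp only [hilbertFn, Int.cast_sub, Int.cast_natCast]
  rw [Finset.sum_range_succ] at h3
  have h4 : ∀ t, N + (1 + t) = N + 1 + t := fun t => by ring
  have h5 : ∀ t, N + 1 + t + 1 = N + 1 + 1 + t := fun t => by ring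
  simp only [h4, h5]
  linarith

theorem isDegreeOfFreedom_dof (hd : 2 ≤ d) (hT : IsHomogMatrix T k θ)
    (G : GaugeStructure T k θ) (hpos : ∀ g : Generator G, 0 < g.order) :
    IsDegreeOfFreedom T (dof G) :=
  tendsto_degreeOfFreedom hd (negligible_hilbertFn_sub hd hT G hpos)

end

/-! ### Bases of free graded commutative algebras -/

section

variable (A : Type) [CommRing A]

/-- The product of the odd generators in a list. -/
def exteriorMonomial {I : Type} (l : List I) : ExteriorAlgebra A (I →₀ A) :=
  (l.map fun x => ExteriorAlgebra.ι A (Finsupp.single x (1 : A))).prod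

theorem exteriorMonomial_cons {I : Type} (x : I) (l : List I) :
    exteriorMonomial A (x :: l) =
      ExteriorAlgebra.ι A (Finsupp.single x (1 : A)) * exteriorMonomial A l := by
  rw [exteriorMonomial, List.map_cons, List.prod_cons]
  rfl

theorem exteriorMonomial_eq_ιMulti {I : Type} (l : List I) :
    exteriorMonomial A l =
      ExteriorAlgebra.ιMulti A l.length fun i => Finsupp.single (l.get i) (1 : A) := by
  rw [ExteriorAlgebra.ιMulti_apply, exteriorMonomial]
  congr 1
  conv_lhs => rw [← List.ofFn_get l, List.map_ofFn]
  rfl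

theorem exteriorMonomial_eq_zero {I : Type} {l : List I} (hl : ¬l.Nodup) :
    exteriorMonomial A l = 0 := by
  rw [exteriorMonomial_eq_ιMulti]
  rw [List.nodup_iff_injective_get, Function.Injective] at hl
  push Not at hl
  obtain ⟨i, j, hij, hne⟩ := hl
  exact AlternatingMap.map_eq_zero_of_eq _ _ (by rw [hij]) hne

theorem exteriorMonomial_perm {I : Type} {l l' : List I} (h : l.Perm l') :
    ∃ c : A, exteriorMonomial A l = c • exteriorMonomial A l' := by
  induction h with
  | nil => exact ⟨1, (one_smul A _).symm⟩
  | cons x _ ih =>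
    obtain ⟨c, hc⟩ := ih
    exact ⟨c, by rw [exteriorMonomial_cons, exteriorMonomial_cons, hc, mul_smul_comm]⟩
  | swap x y l =>
    refine ⟨-1, ?_⟩
    simp only [exteriorMonomial_cons]
    rw [← mul_assoc, ← mul_assoc, eq_neg_of_add_eq_zero_left (ExteriorAlgebra.ι_add_mul_swap _ _),
      neg_smul, one_smul, neg_mul]
  | trans _ _ ih1 ih2 =>
    obtain ⟨c, hc⟩ := ih1
    obtain ⟨c', hc'⟩ := ih2
    exact ⟨c * c', by rw [hc, hc', smul_smul]⟩

theorem exists_exteriorMonomial_eq_basis {I : Type} [LinearOrder I] (s : Finset I) :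
    ∃ l : List I, l.Nodup ∧ l.toFinset = s ∧
      (Finsupp.basisSingleOne (R := A) (ι := I)).ExteriorAlgebra s = exteriorMonomial A l := by
  set t := (Set.powersetCard.prodEquiv.symm s).2 with ht
  refine ⟨List.ofFn (Set.powersetCard.ofFinEmbEquiv.symm t), ?_, ?_, ?_⟩
  · exact List.nodup_ofFn.2 (Set.powersetCard.ofFinEmbEquiv.symm t).injective
  · ext x
    rw [List.mem_toFinset, List.mem_ofFn]
    exact Set.powersetCard.mem_range_ofFinEmbEquiv_symm_iff_mem t x
  · rw [ExteriorAlgebra.basis_apply, ← ht, exteriorMonomial, List.map_ofFn]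
    simp only [ExteriorAlgebra.ιMulti_apply, Function.comp_def, Finsupp.coe_basisSingleOne]
    rfl

/-- The indices of the basis of the free graded commutative algebra. -/
abbrev GCIndex {X : Type} (gh : X → ℤ) : Type :=
  ({x : X // Even (gh x)} →₀ ℕ) × Finset {x : X // Odd (gh x)}

/-- The weight of a basis element. -/
def indexWeight {X : Type} (gh wt : X → ℤ) (p : GCIndex gh) : ℤ :=
  (p.1.sum fun x r => (r : ℤ) * wt x.1) + ∑ x ∈ p.2, wt x.1

theorem monomialWeight_eq_indexWeight {X : Type} {gh : X → ℤ}
    [DecidableEq {x : X // Odd (gh x)}] (wt : X → ℤ)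
    (e : {x : X // Even (gh x)} →₀ ℕ) {l : List {x : X // Odd (gh x)}} (hl : l.Nodup) :
    monomialWeight gh wt e l = indexWeight gh wt (e, l.toFinset) := by
  rw [monomialWeight, indexWeight, List.sum_toFinset _ hl]

/-- A basis of the free graded commutative algebra consisting of monomials. -/
theorem exists_basis_freeGC {X : Type} (gh : X → ℤ) :
    ∃ b : Module.Basis (GCIndex gh) A (FreeGC A gh), ∀ (wt wt' : X → ℤ) (i j : ℤ),
      Submodule.span A {y | ∃ e l, monomialWeight gh wt e l = i ∧ monomialWeight gh wt' e l = j ∧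
        y = gcMonomial A gh e l} =
      Submodule.span A (b '' {p | indexWeight gh wt p = i ∧ indexWeight gh wt' p = j}) := by
  let _ : LinearOrder {x : X // Odd (gh x)} := by
    classical exact linearOrderOfSTO WellOrderingRel
  let b := (MvPolynomial.basisMonomials {x : X // Even (gh x)} A).tensorProduct
    (Finsupp.basisSingleOne (R := A) (ι := {x : X // Odd (gh x)})).ExteriorAlgebra
  have hb : ∀ p, ∃ l : List {x : X // Odd (gh x)}, l.Nodup ∧ l.toFinset = p.2 ∧
      b p = gcMonomial A gh p.1 l := by
    rintro ⟨e, s⟩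
    obtain ⟨l, hl, hs, h⟩ := exists_exteriorMonomial_eq_basis A s
    refine ⟨l, hl, hs, ?_⟩
    rw [Module.Basis.tensorProduct_apply, MvPolynomial.coe_basisMonomials, h]
    rfl
  refine ⟨b, fun wt wt' i j => le_antisymm ?_ ?_⟩
  · rw [Submodule.span_le]
    rintro _ ⟨e, l, hi, hj, rfl⟩
    by_cases hl : l.Nodup
    · obtain ⟨l', hl', hs, h⟩ := hb (e, l.toFinset)
      obtain ⟨c, hc⟩ := exteriorMonomial_perm A (List.perm_of_nodup_nodup_toFinset_eq hl hl' hs.symm)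
      have h1 : gcMonomial A gh e l = c • b (e, l.toFinset) := by
        rw [h, gcMonomial, gcMonomial, ← TensorProduct.tmul_smul]
        exact congrArg _ hc
      rw [h1]
      refine Submodule.smul_mem _ c (Submodule.subset_span ⟨_, ⟨?_, ?_⟩, rfl⟩)
      · rw [← monomialWeight_eq_indexWeight wt e hl, hi]
      · rw [← monomialWeight_eq_indexWeight wt' e hl, hj]
    · have h1 : gcMonomial A gh e l = 0 := by
        have := exteriorMonomial_eq_zero A hl
        rw [exteriorMonomial] at this
        rw [gcMonomial, this, TensorProduct.tmul_zero]
      rw [h1]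
      exact zero_mem _
  · refine Submodule.span_mono ?_
    rintro _ ⟨⟨e, s⟩, ⟨hi, hj⟩, rfl⟩
    obtain ⟨l, hl, hs, h⟩ := hb (e, s)
    simp only at hs h
    subst hs
    exact ⟨e, l, by rw [monomialWeight_eq_indexWeight wt e hl, hi],
      by rw [monomialWeight_eq_indexWeight wt' e hl, hj], h⟩

end

/-! ### Ranks of the bihomogeneous components. -/

section

variable (A : Type) [CommRing A] {X : Type} {gh : X → ℤ} {ord : X → ℤ}

theorem finite_indexWeight [Finite X] (hpos : ∀ x, 0 < ord x) (j : ℤ) :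
    {p : GCIndex gh | indexWeight gh ord p = j}.Finite := by
  classical
  cases nonempty_fintype X
  -- All orders are at least 1, so no exponent in a monomial of weight `j` exceeds `j`.
  refine Set.Finite.subset ((Set.finite_Iic (Finsupp.equivFunOnFinite.symm fun _ => j.toNat :
    {x : X // Even (gh x)} →₀ ℕ)).prod (Set.finite_univ (α := Finset {x : X // Odd (gh x)}))) ?_
  rintro ⟨e, s⟩ (h : _ = j)
  refine ⟨fun x => ?_, Set.mem_univ _⟩
  change e x ≤ j.toNat
  rw [indexWeight, Finsupp.sum_fintype _ _ (by simp)] at h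
  have h1 : (e x : ℤ) * ord x.1 ≤ ∑ x, (e x : ℤ) * ord x.1 :=
    Finset.single_le_sum (f := fun x : {x : X // Even (gh x)} => (e x : ℤ) * ord x.1)
      (fun y _ => mul_nonneg (by positivity) (hpos _).le) (Finset.mem_univ x)
  have h2 : 0 ≤ ∑ x ∈ s, ord x.1 := Finset.sum_nonneg fun y _ => (hpos _).le
  have h3 : (e x : ℤ) ≤ (e x : ℤ) * ord x.1 :=
    le_mul_of_one_le_right (by positivity) (hpos x.1)
  simp only at h
  omega

theorem indexWeight_nonneg [Finite X] (hpos : ∀ x, 0 < ord x) (p : GCIndex gh) :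
    0 ≤ indexWeight gh ord p := by
  refine add_nonneg (Finset.sum_nonneg fun x _ => mul_nonneg (by positivity) (hpos _).le)
    (Finset.sum_nonneg fun y _ => (hpos _).le)

theorem component_eq_bot_of_forall {i j : ℤ}
    (h : ∀ p : GCIndex gh, indexWeight gh gh p = i → indexWeight gh ord p ≠ j) :
    component A gh ord i j = ⊥ := by
  obtain ⟨b, hb⟩ := exists_basis_freeGC A gh
  rw [component, hb gh ord i j]
  have : {p | indexWeight gh gh p = i ∧ indexWeight gh ord p = j} = ∅ :=
    Set.eq_empty_of_forall_notMem fun p hp => h p hp.1 hp.2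
  rw [this, Set.image_empty, Submodule.span_empty]

theorem component_eq_bot_of_neg [Finite X] (hpos : ∀ x, 0 < ord x) {i j : ℤ} (hj : j < 0) :
    component A gh ord i j = ⊥ :=
  component_eq_bot_of_forall A fun p _ hp => by
    have := indexWeight_nonneg hpos p
    omega

theorem free_finite_component [Nontrivial A] [Finite X] (hpos : ∀ x, 0 < ord x) (i j : ℤ) :
    Module.Free A (component A gh ord i j) ∧ Module.Finite A (component A gh ord i j) ∧
      Module.finrank A (component A gh ord i j) =
        {p : GCIndex gh | indexWeight gh gh p = i ∧ indexWeight gh ord p = j}.ncard := by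
  obtain ⟨b, hb⟩ := exists_basis_freeGC A gh
  rw [component, hb gh ord i j, Set.image_eq_range]
  set s := {p : GCIndex gh | indexWeight gh gh p = i ∧ indexWeight gh ord p = j} with hs
  have hfin : Finite s := (finite_indexWeight hpos j).subset fun p hp => hp.2
  have hli : LinearIndependent A fun x : s => b x :=
    b.linearIndependent.comp _ Subtype.val_injective
  have b' := Module.Basis.span hli
  refine ⟨Module.Free.of_basis b', Module.Finite.of_basis b', ?_⟩
  rw [Module.finrank_eq_nat_card_basis b']
  rfl

theorem eulerWellDefined [Nontrivial A] [Finite X] (hpos : ∀ x, 0 < ord x) :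
    EulerWellDefined A gh ord := by
  refine ⟨fun i j => ⟨(free_finite_component A hpos i j).1, (free_finite_component A hpos i j).2.1⟩,
    fun j => ?_⟩
  refine ((finite_indexWeight hpos j).image (indexWeight gh gh)).subset fun i hi => ?_
  by_contra h
  refine hi (component_eq_bot_of_forall A fun p hp hj => h ⟨p, hj, hp⟩)

/-- Only the order is reversed here. This reduces statements on the dual complex, whose orders are
negative, to the case of positive orders. -/
theorem component_neg (i j : ℤ) :
    component A gh (fun x => -ord x) i j = component A gh ord i (-j) := by
  have h : ∀ e l, monomialWeight gh (fun x => -ord x) e l = -monomialWeight gh ord e l := by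
    intro e l
    rw [monomialWeight, monomialWeight, neg_add, Finsupp.sum, Finsupp.sum, ← Finset.sum_neg_distrib]
    congr 1
    · exact Finset.sum_congr rfl fun x _ => by ring
    · induction l with
      | nil => simp
      | cons x l ih =>
        rw [List.map_cons, List.sum_cons, List.map_cons, List.sum_cons, ih, neg_add]
  unfold component
  simp only [h, neg_eq_iff_eq_neg]

theorem eulerWellDefined_neg (h : EulerWellDefined A gh ord) :
    EulerWellDefined A gh fun x => -ord x := by
  refine ⟨fun i j => ?_, fun j => ?_⟩
  · rw [component_neg]
    exact h.1 i (-j)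
  · simp only [component_neg]
    exact h.2 (-j)

theorem eulerCoeff_neg (j : ℤ) :
    eulerCoeff A gh (fun x => -ord x) j = eulerCoeff A gh ord (-j) := by
  exact finsum_congr fun i => by rw [component_neg]

theorem negOnePow_sum {ι : Type*} (s : Finset ι) (f : ι → ℤ) :
    (∑ x ∈ s, f x).negOnePow = ∏ x ∈ s, (f x).negOnePow := by
  classical
  induction s using Finset.induction_on with
  | empty => simp
  | insert x s hx ih => rw [Finset.sum_insert hx, Finset.prod_insert hx, Int.negOnePow_add, ih]

theorem negOnePow_indexWeight (p : GCIndex gh) :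
    ((indexWeight gh gh p).negOnePow : ℤ) = (-1) ^ p.2.card := by
  rw [indexWeight, Int.negOnePow_add, Finsupp.sum, negOnePow_sum, negOnePow_sum,
    Finset.prod_eq_one fun x _ => Int.negOnePow_even _ (x.2.mul_left _), one_mul,
    Finset.prod_congr rfl fun x _ => Int.negOnePow_odd _ x.2, Finset.prod_const]
  simp

/-- Summing over the ghost number removes the first grading: every basis monomial of order `j`
counts once, with the sign given by its number of odd factors. -/
theorem eulerCoeff_eq_sum [Nontrivial A] [Finite X] (hpos : ∀ x, 0 < ord x) (j : ℤ) :
    eulerCoeff A gh ord j =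
      ∑ p ∈ (finite_indexWeight (gh := gh) hpos j).toFinset, (-1) ^ p.2.card := by
  classical
  set F := (finite_indexWeight (gh := gh) hpos j).toFinset with hF
  have hcard : ∀ i, Module.finrank A (component A gh ord i j) =
      (F.filter fun p => indexWeight gh gh p = i).card := by
    intro i
    rw [(free_finite_component A hpos i j).2.2, ← Set.ncard_coe_finset]
    congr 1
    ext p
    simp [hF, and_comm]
  rw [eulerCoeff, finsum_eq_sum_of_support_subset (s := F.image (indexWeight gh gh))]
  · rw [← Finset.sum_fiberwise_of_maps_to (g := indexWeight gh gh)
      (fun p hp => Finset.mem_image_of_mem _ hp)]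
    refine Finset.sum_congr rfl fun i _ => ?_
    rw [hcard, Finset.sum_congr rfl (g := fun _ => (i.negOnePow : ℤ)), Finset.sum_const,
      nsmul_eq_mul, mul_comm]
    · intro p hp
      rw [← (Finset.mem_filter.1 hp).2, negOnePow_indexWeight]
  · intro i hi
    rw [Function.mem_support, hcard] at hi
    obtain ⟨p, hp⟩ := Finset.card_pos.1 (Nat.pos_of_ne_zero fun h => hi (by rw [h]; simp))
    rw [Finset.mem_filter] at hp
    exact Finset.mem_coe.2 (Finset.mem_image.2 ⟨p, hp.1, hp.2⟩)

end

/-! ### Generating functions -/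

/-- The geometric series `1 + X ^ o + X ^ (2 o) + ⋯`. -/
def geomSeries (o : ℕ) : PowerSeries ℂ := PowerSeries.mk fun n => if o ∣ n then 1 else 0

theorem one_sub_X_pow_mul_geomSeries {o : ℕ} (ho : 0 < o) :
    (1 - PowerSeries.X ^ o) * geomSeries o = 1 := by
  ext n
  rw [sub_mul, one_mul, map_sub, PowerSeries.coeff_X_pow_mul', geomSeries]
  simp only [PowerSeries.coeff_mk, PowerSeries.coeff_one]
  rcases Nat.lt_or_ge n o with h | h
  · rw [if_neg (not_le.2 h), sub_zero]
    by_cases hn : n = 0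
    · simp [hn]
    · rw [if_neg hn, if_neg (Nat.not_dvd_of_pos_of_lt (Nat.pos_of_ne_zero hn) h)]
  · rw [if_pos h, if_neg (by omega : n ≠ 0)]
    simp only [Nat.dvd_sub_iff_left h dvd_rfl, sub_self]

theorem coeff_prod_geomSeries {I : Type} [Fintype I] [DecidableEq I] {o : I → ℕ}
    (ho : ∀ x, 0 < o x) {s : Finset (I →₀ ℕ)} {n : ℕ}
    (hs : ∀ e : I →₀ ℕ, e ∈ s ↔ ∑ x, e x * o x = n) :
    PowerSeries.coeff n (∏ x, geomSeries (o x)) = s.card := by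
  rw [PowerSeries.coeff_prod]
  simp only [geomSeries, PowerSeries.coeff_mk]
  simp only [Finset.prod_ite_zero, Finset.prod_const_one]
  rw [Finset.sum_boole]
  congr 1
  symm
  refine Finset.card_bij' (fun e _ => Finsupp.equivFunOnFinite.symm fun x => e x * o x)
    (fun l _ => Finsupp.equivFunOnFinite.symm fun x => l x / o x) ?_ ?_ ?_ ?_
  · intro e he
    rw [Finset.mem_filter, Finset.mem_finsuppAntidiag]
    exact ⟨⟨(hs e).1 he, Finset.subset_univ _⟩, fun x _ => Dvd.intro_left _ rfl⟩
  · intro l hl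
    rw [Finset.mem_filter, Finset.mem_finsuppAntidiag] at hl
    rw [hs, ← hl.1.1]
    exact Finset.sum_congr rfl fun x _ => Nat.div_mul_cancel (hl.2 x (Finset.mem_univ x))
  · intro e _
    ext x
    exact Nat.mul_div_cancel _ (ho x)
  · intro l hl
    rw [Finset.mem_filter] at hl
    ext x
    exact Nat.div_mul_cancel (hl.2 x (Finset.mem_univ x))

section

variable (A : Type) [CommRing A] {X : Type} [Fintype X] {gh : X → ℤ} {o : X → ℕ}

/-- An odd generator of order `o` occurs at most once, with a sign, and gives 1 - X^o. An even one
occurs with any exponent and gives the geometric series in X^o. -/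
theorem mk_eulerCoeff [Nontrivial A] (ho : ∀ x, 0 < o x) :
    (PowerSeries.mk fun j : ℕ => (eulerCoeff A gh (fun x => (o x : ℤ)) j : ℂ)) =
      (∏ x : {x : X // Odd (gh x)}, (1 - PowerSeries.X ^ o x.1)) *
        ∏ x : {x : X // Even (gh x)}, geomSeries (o x.1) := by
  classical
  have hpos : ∀ x, 0 < (o x : ℤ) := fun x => Nat.cast_pos.2 (ho x)
  have hprod : (∏ x : {x : X // Odd (gh x)}, (1 - PowerSeries.X ^ o x.1 : PowerSeries ℂ)) =
      ∑ s : Finset {x : X // Odd (gh x)}, (-1) ^ s.card * PowerSeries.X ^ (∑ x ∈ s, o x.1) := by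
    simp only [sub_eq_add_neg]
    rw [Finset.prod_one_add, Finset.powerset_univ]
    refine Finset.sum_congr rfl fun s _ => ?_
    rw [Finset.prod_neg, Finset.prod_pow_eq_pow_sum]
  rw [hprod]
  ext j
  rw [PowerSeries.coeff_mk, eulerCoeff_eq_sum A hpos, Finset.sum_mul, map_sum]
  set F := (finite_indexWeight (gh := gh) hpos j).toFinset with hF
  push_cast
  rw [← Finset.sum_fiberwise F (fun p => p.2)]
  refine Finset.sum_congr rfl fun s _ => ?_
  rw [Finset.sum_congr rfl (g := fun _ => (-1) ^ s.card)
    fun p hp => by rw [(Finset.mem_filter.1 hp).2], Finset.sum_const, nsmul_eq_mul,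
    mul_assoc, show ((-1 : PowerSeries ℂ) ^ s.card) = PowerSeries.C ((-1) ^ s.card) by simp,
    PowerSeries.coeff_C_mul, mul_comm, PowerSeries.coeff_X_pow_mul']
  congr 1
  have hmem : ∀ e : {x : X // Even (gh x)} →₀ ℕ, (e, s) ∈ F ↔
      ∑ x, e x * o x.1 + ∑ x ∈ s, o x.1 = j := by
    intro e
    rw [hF, Set.Finite.mem_toFinset, Set.mem_ofPred_eq, indexWeight,
      Finsupp.sum_fintype _ _ (by simp)]
    norm_cast
  split_ifs with h
  · rw [coeff_prod_geomSeries (fun x => ho x.1) (s := (F.filter fun p => p.2 = s).image Prod.fst)]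
    · rw [Finset.card_image_of_injOn]
      intro p hp q hq hpq
      exact Prod.ext hpq ((Finset.mem_filter.1 hp).2.trans (Finset.mem_filter.1 hq).2.symm)
    · intro e
      rw [Finset.mem_image, eq_tsub_iff_add_eq_of_le h, ← hmem]
      constructor
      · rintro ⟨⟨e, t⟩, hp, rfl⟩
        rw [Finset.mem_filter] at hp
        obtain ⟨hp, rfl⟩ := hp
        exact hp
      · intro he
        exact ⟨(e, s), Finset.mem_filter.2 ⟨he, rfl⟩, rfl⟩
  · rw [Nat.cast_eq_zero, Finset.card_eq_zero, Finset.filter_eq_empty_iff]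
    rintro ⟨e, t⟩ hp rfl
    have := (hmem e).1 hp
    exact h (this ▸ Nat.le_add_left _ _)

end

open Complex

/-! ### Residues -/

theorem isOpen_norm_gt (R : ℝ) : IsOpen {z : ℂ | R < ‖z‖} :=
  isOpen_lt continuous_const continuous_norm

theorem isOpen_punctured_ball (r : ℝ) : IsOpen {z : ℂ | 0 < ‖z‖ ∧ ‖z‖ < r} :=
  (isOpen_norm_gt 0).inter (isOpen_lt continuous_norm continuous_const)

theorem differentiableOn_logDeriv {f : ℂ → ℂ} {s : Set ℂ} (hs : IsOpen s)
    (hf : DifferentiableOn ℂ f s) (h0 : ∀ z ∈ s, f z ≠ 0) : DifferentiableOn ℂ (logDeriv f) s :=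
  (hf.deriv hs).div hf h0

/-- The function z f(z) extends over the origin with value `c`, and Cauchy's formula at the centre
gives the integral of f. -/
theorem hasResidueAtZero_of_tendsto {f : ℂ → ℂ} {c : ℂ} {r₀ : ℝ} (hr₀ : 0 < r₀)
    (hf : DifferentiableOn ℂ f {z | 0 < ‖z‖ ∧ ‖z‖ < r₀})
    (hc : Tendsto (fun z => z * f z) (𝓝[≠] 0) (𝓝 c)) : HasResidueAtZero f c := by
  refine ⟨r₀, hr₀, hf, fun r hr hrr => ?_⟩
  have hd : DifferentiableOn ℂ (fun z => z * f z) {z | 0 < ‖z‖ ∧ ‖z‖ < r₀} :=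
    differentiableOn_id.mul hf
  have h1 := circleIntegral_sub_center_inv_smul_of_differentiable_on_off_countable_of_tendsto
    (c := 0) (R := r) hr (f := fun z => z * f z) (y := c) Set.countable_empty
    (hd.continuousOn.mono fun z hz => ⟨norm_pos_iff.2 hz.2,
      (mem_closedBall_zero_iff.1 hz.1).trans_lt hrr⟩)
    (fun z hz => hd.differentiableAt ((isOpen_punctured_ball r₀).mem_nhds
      ⟨norm_pos_iff.2 hz.1.2, (mem_ball_zero_iff.1 hz.1.1).trans hrr⟩)) hc
  have h2 : (∮ z in C(0, r), (z - 0)⁻¹ • (z * f z)) = ∮ z in C(0, r), f z := by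
    refine circleIntegral.integral_congr hr.le fun z hz => ?_
    have hz0 : z ≠ 0 := norm_pos_iff.1 (by rw [mem_sphere_zero_iff_norm.1 hz]; exact hr)
    simp only [sub_zero, smul_eq_mul]
    exact inv_mul_cancel_left₀ hz0 _
  rw [← h2, h1, smul_eq_mul]
  exact inv_mul_cancel_left₀ two_pi_I_ne_zero c

theorem hasResidueAtInfinity_of_tendsto {f : ℂ → ℂ} {c : ℂ} {R₀ : ℝ} (hR₀ : 0 < R₀)
    (hf : DifferentiableOn ℂ f {z | R₀ < ‖z‖})
    (hc : Tendsto (fun z => z * f z) (Bornology.cobounded ℂ) (𝓝 c)) :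
    HasResidueAtInfinity f (-c) := by
  refine ⟨R₀, hR₀, hf, fun R hR => ?_⟩
  have hR0 : 0 < R := hR₀.trans hR
  have hann : ∀ R', R ≤ R' → (∮ z in C(0, R'), f z) = ∮ z in C(0, R), f z := by
    intro R' hR'
    refine circleIntegral_eq_of_differentiable_on_annulus_off_countable hR0 hR'
      Set.countable_empty (hf.continuousOn.mono fun z hz => ?_)
      (fun z hz => hf.differentiableAt ((isOpen_norm_gt R₀).mem_nhds ?_))
    · have := hz.2
      rw [mem_ball_zero_iff, not_lt] at this
      exact hR.trans_le this
    · have := hz.1.2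
      rw [mem_closedBall_zero_iff, not_le] at this
      exact hR.trans this
  -- The integral does not depend on the radius. On a sufficiently large circle f differs from c/z
  -- by at most ε / (2πR'), so the integrals differ by at most ε.
  have hint : (∮ z in C(0, R), f z) = (2 * Real.pi * I) * c := by
    rw [← sub_eq_zero, ← norm_le_zero_iff]
    refine le_of_forall_gt_imp_ge_of_dense fun ε hε => ?_
    have hε' : 0 < ε / (2 * Real.pi) := div_pos hε Real.two_pi_pos
    have h1 := (Metric.tendsto_nhds.1 hc) _ hε'
    rw [← comap_norm_atTop, eventually_comap] at h1
    obtain ⟨R', h1, hR'⟩ := (h1.and (eventually_ge_atTop R)).exists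
    have hR'0 : 0 < R' := hR0.trans_le hR'
    rw [← hann R' hR']
    have h2 : (∮ z in C(0, R'), (z - 0)⁻¹ * c) = 2 * Real.pi * I * c := by
      have := circleIntegral.integral_sub_inv_of_mem_ball (c := 0) (w := 0) (R := R')
        (Metric.mem_ball_self hR'0)
      rw [← this, ← smul_eq_mul, ← circleIntegral.integral_smul_const]
      rfl
    have hcont : ContinuousOn f (Metric.sphere 0 R') := hf.continuousOn.mono fun z hz => by
      rw [mem_sphere_zero_iff_norm] at hz
      change R₀ < ‖z‖
      linarith
    rw [← h2, ← circleIntegral.integral_sub]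
    · refine (circleIntegral.norm_integral_le_of_norm_le_const
        (C := ε / (2 * Real.pi) / R') hR'0.le fun z hz => ?_).trans_eq ?_
      · rw [mem_sphere_zero_iff_norm] at hz
        have hz0 : z ≠ 0 := norm_pos_iff.1 (hz ▸ hR'0)
        have h3 := h1 z hz
        rw [dist_eq_norm] at h3
        have h4 : f z - (z - 0)⁻¹ * c = z⁻¹ * (z * f z - c) := by
          rw [sub_zero, mul_sub, inv_mul_cancel_left₀ hz0]
        rw [h4, norm_mul, norm_inv, hz, div_eq_inv_mul _ R']
        exact mul_le_mul_of_nonneg_left h3.le (inv_nonneg.2 hR'0.le)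
      · field_simp
    · exact hcont.circleIntegrable hR'0.le
    · refine ContinuousOn.circleIntegrable hR'0.le ?_
      refine ContinuousOn.mul (ContinuousOn.inv₀ (by fun_prop) fun z hz => ?_) continuousOn_const
      rw [mem_sphere_zero_iff_norm] at hz
      rw [sub_zero]
      exact norm_pos_iff.1 (hz ▸ hR'0)
  rw [hint, neg_mul, inv_mul_cancel_left₀ two_pi_I_ne_zero]

/-! ### Rational functions -/

/-- The definition of `ExpandsTo` refers to the reduced fraction; cross-multiplication passes to it
from `p` and `q`, which may have common factors. -/
theorem expandsTo_div {p q : Polynomial ℂ} (hq : q ≠ 0) {S : PowerSeries ℂ}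
    (h : (q : PowerSeries ℂ) * S = p) :
    ExpandsTo (algebraMap _ (RatFunc ℂ) p / algebraMap _ _ q) S := by
  set f := algebraMap _ (RatFunc ℂ) p / algebraMap _ _ q with hf
  have h1 := (RatFunc.num_mul_eq_mul_denom_iff hq).2 hf
  have h2 : (f.num : PowerSeries ℂ) * q = p * f.denom := by
    rw [← Polynomial.coe_mul, h1, Polynomial.coe_mul]
  have hq' : (q : PowerSeries ℂ) ≠ 0 := by
    rwa [Ne, Polynomial.coe_eq_zero_iff]
  refine mul_right_cancel₀ hq' ?_
  rw [h2, ← h]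
  ring

theorem ratFun_div {p q : Polynomial ℂ} {z : ℂ} (hz : q.eval z ≠ 0) :
    ratFun (algebraMap _ (RatFunc ℂ) p / algebraMap _ _ q) z = p.eval z / q.eval z := by
  have hq : q ≠ 0 := by
    rintro rfl
    exact hz Polynomial.eval_zero
  set f := algebraMap _ (RatFunc ℂ) p / algebraMap _ _ q with hf
  have h1 := congrArg (Polynomial.eval z) ((RatFunc.num_mul_eq_mul_denom_iff hq).2 hf)
  rw [Polynomial.eval_mul, Polynomial.eval_mul] at h1
  have h2 : f.denom.eval z ≠ 0 := fun h =>
    hz (Polynomial.eval_eq_zero_of_dvd_of_eval_eq_zero (RatFunc.denom_div_dvd p q) h)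
  exact (div_eq_div_iff h2 hz).2 h1

theorem one_sub_pow_ne_zero {z : ℂ} (hz : 1 < ‖z‖) {o : ℕ} (ho : 0 < o) : 1 - z ^ o ≠ 0 := by
  intro h
  have h1 := congrArg norm (sub_eq_zero.1 h)
  rw [norm_one, norm_pow] at h1
  exact absurd h1 (one_lt_pow₀ hz ho.ne').ne

/-- The expression equals o / (1 - z^(-o)) for |z| > 1. -/
theorem tendsto_mul_logDeriv_one_sub_pow {o : ℕ} (ho : 0 < o) :
    Tendsto (fun z : ℂ => z * logDeriv (fun w => 1 - w ^ o) z) (Bornology.cobounded ℂ)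
      (𝓝 (o : ℂ)) := by
  have h1 : Tendsto (fun z : ℂ => (z ^ o)⁻¹) (Bornology.cobounded ℂ) (𝓝 0) := by
    have := (tendsto_inv₀_cobounded (α := ℂ)).pow o
    rw [zero_pow ho.ne'] at this
    exact this.congr fun z => inv_pow z o
  have h2 : Tendsto (fun z : ℂ => (o : ℂ) / (1 - (z ^ o)⁻¹)) (Bornology.cobounded ℂ)
      (𝓝 (o : ℂ)) := by
    have := (tendsto_const_nhds (x := (o : ℂ))).div (tendsto_const_nhds.sub h1)
      (by norm_num : (1 : ℂ) - 0 ≠ 0)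
    rw [sub_zero, div_one] at this
    exact this
  refine h2.congr' ?_
  have h3 : ∀ᶠ z : ℂ in Bornology.cobounded ℂ, 1 < ‖z‖ :=
    tendsto_norm_cobounded_atTop.eventually_gt_atTop 1
  filter_upwards [h3] with z hz
  have hz0 : z ≠ 0 := norm_pos_iff.1 (one_pos.trans hz)
  have h4 := one_sub_pow_ne_zero hz ho
  have h5 : deriv (fun w : ℂ => 1 - w ^ o) z = -(o * z ^ (o - 1)) := by
    rw [deriv_const_sub]
    simp
  have h6 : z ^ o = z * z ^ (o - 1) := by rw [← pow_succ', Nat.sub_add_cancel ho]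
  have h7 : 1 - (z ^ o)⁻¹ ≠ 0 := by
    have : 1 - (z ^ o)⁻¹ = -(z ^ o)⁻¹ * (1 - z ^ o) := by
      rw [neg_mul, mul_sub, inv_mul_cancel₀ (pow_ne_zero o hz0)]
      ring
    rw [this]
    exact mul_ne_zero (neg_ne_zero.2 (inv_ne_zero (pow_ne_zero o hz0))) h4
  rw [logDeriv_apply, h5, ← mul_div_assoc, div_eq_div_iff h7 h4, mul_neg, mul_left_comm, ← h6]
  field_simp
  ring

/-- The sum of the power series of an Euler characteristic as a rational function. -/
theorem exists_ratFunc {I J : Type} [Fintype I] [Fintype J] {o : I → ℕ} {o' : J → ℕ}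
    (ho : ∀ x, 0 < o x) (ho' : ∀ x, 0 < o' x) :
    ∃ f : RatFunc ℂ, ExpandsTo f ((∏ x, (1 - PowerSeries.X ^ o x)) * ∏ x, geomSeries (o' x)) ∧
      DifferentiableOn ℂ (ratFun f) {z | 1 < ‖z‖} ∧ (∀ z, 1 < ‖z‖ → ratFun f z ≠ 0) ∧
      Tendsto (fun z => z * logDeriv (ratFun f) z) (Bornology.cobounded ℂ)
        (𝓝 (∑ x, (o x : ℂ) - ∑ x, (o' x : ℂ))) := by
  let p : Polynomial ℂ := ∏ x, (1 - Polynomial.X ^ o x)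
  let q : Polynomial ℂ := ∏ x, (1 - Polynomial.X ^ o' x)
  have hcoe : ∀ {K : Type} [Fintype K] (u : K → ℕ),
      ((∏ x, (1 - Polynomial.X ^ u x) : Polynomial ℂ) : PowerSeries ℂ) =
        ∏ x, (1 - PowerSeries.X ^ u x) := by
    intro K _ u
    rw [← Polynomial.coeToPowerSeries.ringHom_apply, map_prod]
    refine Finset.prod_congr rfl fun x _ => ?_
    rw [map_sub, map_one, map_pow, Polynomial.coeToPowerSeries.ringHom_apply, Polynomial.coe_X]
  have heval : ∀ {K : Type} [Fintype K] (u : K → ℕ) (z : ℂ),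
      (∏ x, (1 - Polynomial.X ^ u x) : Polynomial ℂ).eval z = ∏ x, (1 - z ^ u x) := by
    intro K _ u z
    rw [Polynomial.eval_prod]
    simp
  have hne : ∀ {K : Type} [Fintype K] {u : K → ℕ}, (∀ x, 0 < u x) → ∀ z : ℂ, 1 < ‖z‖ →
      ∏ x, (1 - z ^ u x) ≠ 0 := fun hu z hz =>
    Finset.prod_ne_zero_iff.2 fun x _ => one_sub_pow_ne_zero hz (hu x)
  have hq : q ≠ 0 := by
    intro h
    have h2 := heval o' 2
    change q.eval 2 = _ at h2
    rw [h, Polynomial.eval_zero] at h2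
    exact hne ho' 2 (by norm_num) h2.symm
  -- All zeros of the factors are roots of unity, so outside the closed unit disc the rational
  -- function is the quotient of two nonvanishing products, and logarithmic derivatives add up.
  have hrat : Set.EqOn (ratFun (algebraMap _ (RatFunc ℂ) p / algebraMap _ _ q))
      (fun z => (∏ x, (1 - z ^ o x)) / ∏ x, (1 - z ^ o' x)) {z | 1 < ‖z‖} := by
    intro z hz
    rw [ratFun_div (by rw [heval]; exact hne ho' z hz), heval, heval]
  refine ⟨algebraMap _ _ p / algebraMap _ _ q, expandsTo_div hq ?_, ?_, ?_, ?_⟩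
  · rw [hcoe, hcoe, mul_left_comm, ← Finset.prod_mul_distrib,
      Finset.prod_eq_one fun x _ => one_sub_X_pow_mul_geomSeries (ho' x), mul_one]
  · refine DifferentiableOn.congr ?_ hrat
    exact DifferentiableOn.div (by fun_prop) (by fun_prop) (hne ho')
  · intro z hz
    rw [hrat hz]
    exact div_ne_zero (hne ho z hz) (hne ho' z hz)
  · refine Tendsto.congr' ?_ ((tendsto_finsetSum _ fun x _ =>
      tendsto_mul_logDeriv_one_sub_pow (ho x)).sub (tendsto_finsetSum _ fun x _ =>
      tendsto_mul_logDeriv_one_sub_pow (ho' x)))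
    filter_upwards [tendsto_norm_cobounded_atTop.eventually_gt_atTop 1] with z hz
    rw [(logDeriv_congr_nhds (hrat.eventuallyEq_of_mem
      ((isOpen_norm_gt 1).mem_nhds hz))).eq_of_nhds,
      logDeriv_div z (hne ho z hz) (hne ho' z hz) (by fun_prop) (by fun_prop),
      logDeriv_prod (f := fun x w => 1 - w ^ o x) (fun x _ => one_sub_pow_ne_zero hz (ho x))
        fun x _ => by fun_prop,
      logDeriv_prod (f := fun x w => 1 - w ^ o' x) (fun x _ => one_sub_pow_ne_zero hz (ho' x))
        fun x _ => by fun_prop,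
      mul_sub, Finset.mul_sum, Finset.mul_sum]

/-! ### The Hilbert series of the ring of operators -/

theorem finrank_homogeneousSubmodule (d N : ℕ) :
    Module.finrank ℂ (MvPolynomial.homogeneousSubmodule (Fin d) ℂ N) = hP d N := by
  rw [MvPolynomial.homogeneousSubmodule_eq_finsupp_supported,
    (AddMonoidAlgebra.supportedEquivFinsupp _).finrank_eq]
  have h : {α : Fin d →₀ ℕ | α.degree = N} = exponents d (N : ℤ) := by
    ext α
    rw [Finset.mem_coe, mem_exponents, Nat.cast_inj]
    rfl
  rw [h, Module.finrank_finsupp_self, hP]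
  exact Fintype.card_coe _

theorem one_sub_X_pow_mul_hilbertP (hd : 0 < d) :
    (1 - PowerSeries.X) ^ d * hilbertP d = 1 := by
  obtain ⟨k, rfl⟩ := Nat.exists_eq_add_of_le' hd
  have h : hilbertP (k + 1) = PowerSeries.mk 1 ^ (k + 1) := by
    rw [PowerSeries.mk_one_pow_eq_mk_choose_add]
    ext N
    rw [hilbertP, PowerSeries.coeff_mk, PowerSeries.coeff_mk, finrank_homogeneousSubmodule,
      hP_natCast, add_comm]
  rw [h, ← mul_pow, mul_comm, PowerSeries.mk_one_mul_one_sub_eq_one, one_pow]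

theorem exists_ratFunc_hilbertP (hd : 0 < d) :
    ∃ h : RatFunc ℂ, ExpandsTo h (hilbertP d) ∧
      Set.EqOn (ratFun h) (fun z => 1 / (1 - z) ^ d) {z | z ≠ 1} := by
  have hq : (1 - Polynomial.X : Polynomial ℂ) ^ d ≠ 0 := by
    refine pow_ne_zero d fun h => ?_
    have := congrArg (Polynomial.eval 0) h
    simp at this
  refine ⟨_, expandsTo_div (p := 1) hq ?_, fun z hz => ?_⟩
  · rw [Polynomial.coe_pow, Polynomial.coe_sub, Polynomial.coe_one, Polynomial.coe_X,
      one_sub_X_pow_mul_hilbertP hd]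
  · have h1 : ((1 - Polynomial.X : Polynomial ℂ) ^ d).eval z = (1 - z) ^ d := by simp
    rw [ratFun_div, h1, Polynomial.eval_one]
    rw [h1]
    exact pow_ne_zero d (sub_ne_zero.2 (Ne.symm hz))

/-- In the punctured unit disc, z times the logarithmic derivative is d z / (1 - z) minus the
corresponding expression for f at z⁻¹. The first term vanishes at 0, and the second turns the limit
at infinity into one at 0 with the opposite sign. -/
theorem eulerFunB_properties {h f : RatFunc ℂ} {c : ℂ}
    (hh : Set.EqOn (ratFun h) (fun z => 1 / (1 - z) ^ d) {z | z ≠ 1})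
    (hf : DifferentiableOn ℂ (ratFun f) {z | 1 < ‖z‖}) (hf0 : ∀ z, 1 < ‖z‖ → ratFun f z ≠ 0)
    (hc : Tendsto (fun z => z * logDeriv (ratFun f) z) (Bornology.cobounded ℂ) (𝓝 c)) :
    Tendsto (fun z : ℂ => -(z * logDeriv (eulerFunB h f) z)) (𝓝[≠] 0) (𝓝 c) ∧
      HasResidueAtZero (logDeriv (eulerFunB h f)) (-c) := by
  set U : Set ℂ := {z | 0 < ‖z‖ ∧ ‖z‖ < 1} with hU
  have hUo : IsOpen U := isOpen_punctured_ball 1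
  have h1 : ∀ z ∈ U, z ≠ 1 := by
    rintro z hz rfl
    exact absurd hz.2 (by simp)
  have h0 : ∀ z ∈ U, z ≠ 0 := fun z hz => norm_pos_iff.1 hz.1
  have hinv : ∀ z ∈ U, 1 < ‖z⁻¹‖ := fun z hz => by
    rw [norm_inv]
    exact (one_lt_inv₀ hz.1).2 hz.2
  have hpow : ∀ z ∈ U, (1 - z) ^ d ≠ 0 := fun z hz => pow_ne_zero d (sub_ne_zero.2 (h1 z hz).symm)
  have hE : Set.EqOn (eulerFunB h f) (fun z => (1 / (1 - z) ^ d) * ratFun f z⁻¹) U :=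
    fun z hz => by rw [eulerFunB, hh (h1 z hz)]
  have hfat : ∀ z ∈ U, DifferentiableAt ℂ (ratFun f) z⁻¹ := fun z hz =>
    hf.differentiableAt ((isOpen_norm_gt 1).mem_nhds (hinv z hz))
  have hginv : ∀ z ∈ U, DifferentiableAt ℂ (fun z => ratFun f z⁻¹) z := fun z hz =>
    (hfat z hz).comp z (differentiableAt_inv (h0 z hz))
  have hdpow : ∀ z ∈ U, DifferentiableAt ℂ (fun z : ℂ => 1 / (1 - z) ^ d) z := fun z hz =>
    DifferentiableAt.div (by fun_prop) (by fun_prop) (hpow z hz)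
  have hlog : ∀ z ∈ U, z * logDeriv (eulerFunB h f) z =
      z * (d / (1 - z)) - z⁻¹ * logDeriv (ratFun f) z⁻¹ := by
    intro z hz
    have h2 : logDeriv (fun z : ℂ => 1 / (1 - z) ^ d) z = d / (1 - z) := by
      rw [logDeriv_div (f := fun _ => 1) z one_ne_zero (hpow z hz) (by fun_prop) (by fun_prop),
        logDeriv_const, logDeriv_fun_pow (by fun_prop), logDeriv_apply, deriv_const_sub]
      simp only [Pi.zero_apply, deriv_id'']
      ring
    have h3 : logDeriv (fun z => ratFun f z⁻¹) z = logDeriv (ratFun f) z⁻¹ * -(z ^ 2)⁻¹ := by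
      have := logDeriv_comp (hfat z hz) (differentiableAt_inv (h0 z hz))
      rw [deriv_inv] at this
      exact this
    rw [(logDeriv_congr_nhds (hE.eventuallyEq_of_mem (hUo.mem_nhds hz))).eq_of_nhds,
      logDeriv_mul (f := fun z : ℂ => 1 / (1 - z) ^ d) (g := fun z => ratFun f z⁻¹) z (div_ne_zero one_ne_zero (hpow z hz)) (hf0 _ (hinv z hz)) (hdpow z hz)
        (hginv z hz), h2, h3]
    have := h0 z hz
    field_simp
    ring
  have hmem : U ∈ 𝓝[≠] (0 : ℂ) := by
    refine mem_nhdsWithin.2 ⟨Metric.ball 0 1, Metric.isOpen_ball, Metric.mem_ball_self one_pos, ?_⟩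
    exact fun z hz => ⟨norm_pos_iff.2 hz.2, mem_ball_zero_iff.1 hz.1⟩
  have hlim : Tendsto (fun z : ℂ => z * logDeriv (eulerFunB h f) z) (𝓝[≠] 0) (𝓝 (-c)) := by
    have h4 : Tendsto (fun z : ℂ => z * (d / (1 - z))) (𝓝[≠] 0) (𝓝 0) := by
      have : ContinuousAt (fun z : ℂ => z * (d / (1 - z))) 0 := by
        refine continuousAt_id.mul (ContinuousAt.div (by fun_prop) (by fun_prop) (by norm_num))
      have h5 := this.tendsto
      rw [zero_mul] at h5
      exact h5.mono_left nhdsWithin_le_nhds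
    have h5 := h4.sub (hc.comp tendsto_inv₀_nhdsNE_zero)
    rw [zero_sub] at h5
    refine h5.congr' ?_
    filter_upwards [hmem] with z hz
    rw [hlog z hz]
    rfl
  refine ⟨by simpa using hlim.neg, hasResidueAtZero_of_tendsto one_pos ?_ hlim⟩
  refine differentiableOn_logDeriv hUo (DifferentiableOn.congr ?_ hE) fun z hz => ?_
  · exact fun z hz => ((hdpow z hz).mul (hginv z hz)).differentiableWithinAt
  · rw [hE hz]
    exact mul_ne_zero (div_ne_zero one_ne_zero (hpow z hz)) (hf0 _ (hinv z hz))

/-! ### The Euler characteristics of the BRST complex and of its algebraic dual -/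

theorem sum_odd_sub_sum_even {X : Type} [Fintype X] (gh : X → ℤ) (o : X → ℕ) :
    (∑ x : {x : X // Odd (gh x)}, (o x.1 : ℂ)) - ∑ x : {x : X // Even (gh x)}, (o x.1 : ℂ) =
      ((-∑ x, parity (gh x) * o x : ℝ) : ℂ) := by
  rw [← Finset.sum_subtype (Finset.univ.filter fun x => Odd (gh x)) (by simp)
      fun x => (o x : ℂ), ← Finset.sum_subtype (Finset.univ.filter fun x => Even (gh x)) (by simp)
      fun x => (o x : ℂ), Finset.sum_filter, Finset.sum_filter, ← Finset.sum_sub_distrib]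
  push_cast
  rw [← Finset.sum_neg_distrib]
  refine Finset.sum_congr rfl fun x _ => ?_
  rcases Int.even_or_odd (gh x) with h | h
  · rw [if_neg (Int.not_odd_iff_even.2 h), if_pos h, parity, Int.negOnePow_even _ h]
    simp
  · rw [if_pos h, if_neg (Int.not_even_iff_odd.2 h), parity, Int.negOnePow_odd _ h]
    simp

section

variable {n m : ℕ} {T : Matrix (Fin n) (Fin m) (DiffOp d)} {k : Fin n → ℤ} {θ : Fin m → ℤ}

theorem exists_nat_order {G : GaugeStructure T k θ} (hpos : ∀ g : Generator G, 0 < g.order) :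
    ∃ o : Generator G → ℕ, (∀ g, 0 < o g) ∧ ∀ g, (o g : ℤ) = g.order :=
  ⟨fun g => g.order.toNat, fun g => Int.lt_toNat.2 (hpos g), fun g =>
    Int.toNat_of_nonneg (hpos g).le⟩

theorem exists_ratFunc_eulerC {G : GaugeStructure T k θ} (hpos : ∀ g : Generator G, 0 < g.order) :
    ∃ f : RatFunc ℂ, ExpandsTo f (eulerC G) ∧
      DifferentiableOn ℂ (ratFun f) {z | 1 < ‖z‖} ∧ (∀ z, 1 < ‖z‖ → ratFun f z ≠ 0) ∧
      Filter.Tendsto (fun z => z * logDeriv (ratFun f) z) (Bornology.cobounded ℂ)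
        (𝓝 (dof G : ℂ)) := by
  obtain ⟨o, ho, hog⟩ := exists_nat_order hpos
  have h := exists_ratFunc (o := fun x : {g : Generator G // Odd g.gh} => o x.1)
    (o' := fun x : {g : Generator G // Even g.gh} => o x.1) (fun x => ho x.1) fun x => ho x.1
  rw [← mk_eulerCoeff (Smooth d) ho, sum_odd_sub_sum_even Generator.gh o] at h
  have h1 : dof G = -∑ g : Generator G, parity g.gh * o g := by
    rw [dof]
    simp only [← hog, Int.cast_natCast]
  rw [eulerC, h1, ← funext hog]
  exact h

theorem exists_ratFunc_eulerRankB {G : GaugeStructure T k θ}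
    (hpos : ∀ g : Generator G, 0 < g.order) :
    ∃ f : RatFunc ℂ, ExpandsTo f (eulerRankB G) ∧
      DifferentiableOn ℂ (ratFun f) {z | 1 < ‖z‖} ∧ (∀ z, 1 < ‖z‖ → ratFun f z ≠ 0) ∧
      Filter.Tendsto (fun z => z * logDeriv (ratFun f) z) (Bornology.cobounded ℂ)
        (𝓝 (dof G : ℂ)) := by
  obtain ⟨o, ho, hog⟩ := exists_nat_order hpos
  have h := exists_ratFunc (o := fun x : {g : Generator G // Odd (-g.gh)} => o x.1)
    (o' := fun x : {g : Generator G // Even (-g.gh)} => o x.1) (fun x => ho x.1) fun x => ho x.1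
  rw [← mk_eulerCoeff (DiffOp d) ho, sum_odd_sub_sum_even (fun g : Generator G => -g.gh) o] at h
  have h1 : dof G = -∑ g : Generator G, parity (-g.gh) * o g := by
    rw [dof]
    simp only [← hog, Int.cast_natCast, parity, Int.negOnePow_neg]
  -- The coefficient of w^j belongs to order -j for negated orders, that is, to order j for the
  -- original ones. Negating ghost numbers preserves parity, so `dof` is unchanged.
  have h2 : eulerRankB G = PowerSeries.mk fun j : ℕ =>
      (eulerCoeff (DiffOp d) (fun g : Generator G => -g.gh) (fun g => (o g : ℤ)) j : ℂ) := by
    rw [eulerRankB, funext hog]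
    simp only [eulerCoeff_neg, neg_neg]
  rw [h1, h2]
  exact h

end

end

end LinearGauge

/-! ### The proposition. -/

theorem mainTheorem5 {d n m : ℕ} (hd : 2 ≤ d) (T : Matrix (Fin n) (Fin m) (DiffOp d))
    (k : Fin n → ℤ) (θ : Fin m → ℤ) (hT : IsHomogMatrix T k θ) (G : GaugeStructure T k θ)
    (hpos : ∀ g : Generator G, 0 < g.order) :
    (EulerWellDefined (Smooth d) (Generator.gh (G := G)) Generator.order ∧
      ∀ i j : ℤ, j < 0 → componentC G i j = ⊥) ∧
    (EulerWellDefined (DiffOp d) (fun g : Generator G => -g.gh) (fun g => -g.order) ∧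
      ∀ i j : ℤ, 0 < j → componentB G i j = ⊥) ∧
    ∃ 𝒩 : ℝ, IsDegreeOfFreedom T 𝒩 ∧
      (∃ χ : RatFunc ℂ, ExpandsTo χ (eulerC G) ∧
        Filter.Tendsto (fun z : ℂ => z * logDeriv (ratFun χ) z) (Bornology.cobounded ℂ)
          (𝓝 (𝒩 : ℂ)) ∧
        HasResidueAtInfinity (logDeriv (ratFun χ)) (-(𝒩 : ℂ))) ∧
      (∃ h f : RatFunc ℂ, ExpandsTo h (hilbertP d) ∧ ExpandsTo f (eulerRankB G) ∧
        Filter.Tendsto (fun z : ℂ => -(z * logDeriv (eulerFunB h f) z)) (𝓝[≠] 0)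
          (𝓝 (𝒩 : ℂ)) ∧
        HasResidueAtZero (logDeriv (eulerFunB h f)) (-(𝒩 : ℂ))) := by
  have hC := eulerWellDefined (Smooth d) (gh := Generator.gh (G := G)) hpos
  have hB := eulerWellDefined_neg (DiffOp d)
    (eulerWellDefined (DiffOp d) (gh := fun g : Generator G => -g.gh) hpos)
  refine ⟨⟨hC, fun i j hj => component_eq_bot_of_neg _ hpos hj⟩, ⟨hB, fun i j hj => ?_⟩,
    dof G, isDegreeOfFreedom_dof hd hT G hpos, ?_, ?_⟩
  · rw [componentB, component_neg]
    exact component_eq_bot_of_neg _ hpos (neg_lt_zero.2 hj)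
  · obtain ⟨χ, hχ, hdiff, hne, hlim⟩ := exists_ratFunc_eulerC hpos
    exact ⟨χ, hχ, hlim, hasResidueAtInfinity_of_tendsto one_pos
      (differentiableOn_logDeriv (isOpen_norm_gt 1) hdiff hne) hlim⟩
  · obtain ⟨h, hh, heq⟩ := exists_ratFunc_hilbertP (d := d) (by omega)
    obtain ⟨f, hf, hdiff, hne, hlim⟩ := exists_ratFunc_eulerRankB hpos
    exact ⟨h, f, hh, hf, eulerFunB_properties heq hdiff hne hlim⟩
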